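/- Let $L\ge 4$. Put $x_1=0$, $x_2=1$, let $0<x_3<1$, and write $x_{ij}=x_i-x_j$. Let $s_{ij}=s_{ji}$ ($1\le i<j\le L$) be complex parameters with $\mathrm{Re}(s_{ij})>0$. For $i\in\{4,\dots,L+1\}$ and a permutation $\sigma$ of $\{1,\dots,L\}$ fixing $1,2,3$ set $$\hat F_{L,i}^{\sigma}(x_3)=\int_{0\le x_L\le\dots\le x_4\le x_3}\ \prod_{1\le k<m\le L}|x_{km}|^{s_{km}}\ \sigma\!\left[\prod_{k=i}^{L}\Big(\frac{s_{1k}}{x_k}+\sum_{j=k+1}^{L}\frac{s_{kj}}{x_{kj}}\Big)\prod_{m=4}^{i-1}\Big(\sum_{\substack{n=2\\ n\ne3}}^{m-1}\frac{s_{nm}}{x_{nm}}\Big)\right]\prod_{k=4}^{L}dx_k ,$$ where $\sigma$ acts on the labels of the $x$'s and of the $s$'s inside the bracket; these integrals converge absolutely. Let $\hat F_{L,i}=(\hat F_{L,i}^{\sigma})_\sigma$, which has $(L-3)!$ components, and let $\hat F_L=(\hat F_{L,4},\hat F_{L,5},\dots,\hat F_{L,L+1})^T$, which has $(L-2)!$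 components. There are matrices $e_0,e_1$ of size $(L-2)!\times(L-2)!$ with entries in the complex span $\langle s_{ij}\rangle_{\mathbb C}$ of the variables $s_{ij}$ such that the Knizhnik--Zamolodchikov equation $$\frac{\partial}{\partial x_3}\hat F_L(x_3)=\Big(\frac{e_0}{x_3}+\frac{e_1}{x_3-1}\Big)\hat F_L(x_3)$$ holds for all $0<x_3<1$ and all such values of the parameters, and any such matrices have the block forms $$e_0=\begin{pmatrix}s_{\max}\,I_{(L-3)!}&a\\0&b\end{pmatrix},\qquad e_1=\begin{pmatrix}s_{23}\,I_{(L-3)!}&0\\c&d\end{pmatrix},\qquad s_{\max}=\sum_{\substack{1\le i<j\le L\\ i,j\ne2}}s_{ij},$$ where $a$ is of size $(L-3)!\times(L-3)!(L-3)$, $c$ is of size $(L-3)!(L-3)\times(L-3)!$, and $b$ and $d$ are square of size $(L-3)!(L-3)$. -/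

import Mathlib

open MeasureTheory

/-- The labels `4, …, L` of the integrated points. -/
abbrev IntegratedLabel (L : ℕ) : Type := ↥(Finset.Icc 4 L)

/-- The index set of the Mandelstam variables `s_{ij}`, `1 ≤ i < j ≤ L`. -/
abbrev MandelstamIndex (L : ℕ) : Type :=
  {p : ℕ × ℕ // 1 ≤ p.1 ∧ p.1 < p.2 ∧ p.2 ≤ L}

/-- The symmetric family `s_{ij} = s_{ji}` (for `i ≠ j` in `{1, …, L}`) belonging to a choice of one
element of `R` for every pair `i < j`; arguments outside that range are never used. -/
def mandelstam {R : Type*} [Zero R] (L : ℕ) (s : MandelstamIndex L → R) (i j : ℕ) : R :=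
  if h : 1 ≤ i ∧ i < j ∧ j ≤ L then s ⟨(i, j), h⟩
  else if h : 1 ≤ j ∧ j < i ∧ i ≤ L then s ⟨(j, i), h⟩
  else 0

/-- The positions of the points: `x_1 = 0`, `x_2 = 1`, the unintegrated point `x_3`, and the
integration variables `x_4, …, x_L`. -/
def pointPosition (L : ℕ) (x₃ : ℝ) (y : IntegratedLabel L → ℝ) (k : ℕ) : ℝ :=
  if h : k ∈ Finset.Icc 4 L then y ⟨k, h⟩
  else if k = 3 then x₃
  else if k = 2 then 1
  else 0

/-- A permutation of the labels `4, …, L`, extended to all labels by fixing the others, in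
particular `1, 2, 3`. -/
def relabel (L : ℕ) (σ : Equiv.Perm (IntegratedLabel L)) : Equiv.Perm ℕ :=
  Equiv.Perm.ofSubtype (p := fun k => k ∈ Finset.Icc 4 L) σ

/-- The integration domain `0 ≤ x_L ≤ ⋯ ≤ x_4 ≤ x_3`. -/
def selbergDomain (L : ℕ) (x₃ : ℝ) : Set (IntegratedLabel L → ℝ) :=
  {y | Antitone y ∧ ∀ k, 0 ≤ y k ∧ y k ≤ x₃}

/-- The factor `∏_{1 ≤ k < m ≤ L} |x_{km}|^{s_{km}}`, where `x_{km} = x_k - x_m`. -/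
noncomputable def kobaNielsen (L : ℕ) (S : ℕ → ℕ → ℂ) (X : ℕ → ℝ) : ℂ :=
  ∏ k ∈ Finset.Icc 1 L, ∏ m ∈ Finset.Icc (k + 1) L, ((|X k - X m| : ℝ) : ℂ) ^ S k m

/-- The rational factor
`∏_{k=i}^{L} (s_{1k}/x_k + ∑_{j=k+1}^{L} s_{kj}/x_{kj}) · ∏_{m=4}^{i-1} ∑_{2 ≤ n < m, n ≠ 3} s_{nm}/x_{nm}`. -/
noncomputable def rationalFactor (L i : ℕ) (S : ℕ → ℕ → ℂ) (X : ℕ → ℝ) : ℂ :=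
  (∏ k ∈ Finset.Icc i L,
      (S 1 k / (X k : ℂ) + ∑ j ∈ Finset.Icc (k + 1) L, S k j / ((X k - X j : ℝ) : ℂ))) *
    ∏ m ∈ Finset.Ico 4 i,
      ∑ n ∈ (Finset.Ico 2 m).erase 3, S n m / ((X n - X m : ℝ) : ℂ)

/-- The integrand of `F̂_{L,i}^σ(x_3)`; the permutation `σ` acts on the labels of the positions and
of the Mandelstam variables in the rational factor. -/
noncomputable def selbergIntegrand (L i : ℕ) (σ : Equiv.Perm (IntegratedLabel L))
    (s : MandelstamIndex L → ℂ) (x₃ : ℝ) (y : IntegratedLabel L → ℝ) : ℂ :=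
  kobaNielsen L (mandelstam L s) (pointPosition L x₃ y) *
    rationalFactor L i
      (fun j k => mandelstam L s (relabel L σ j) (relabel L σ k))
      (fun k => pointPosition L x₃ y (relabel L σ k))

/-- The component `F̂_{L,i}^σ(x_3)`. -/
noncomputable def selbergComponent (L i : ℕ) (σ : Equiv.Perm (IntegratedLabel L))
    (s : MandelstamIndex L → ℂ) (x₃ : ℝ) : ℂ :=
  ∫ y in selbergDomain L x₃, selbergIntegrand L i σ s x₃ y

/-- The index set of the first subvector `F̂_{L,4}`. -/
abbrev FirstBlock (L : ℕ) : Type := Equiv.Perm (IntegratedLabel L)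

/-- The index set of the remaining subvectors `F̂_{L,5}, …, F̂_{L,L+1}`. -/
abbrev SecondBlock (L : ℕ) : Type :=
  ↥(Finset.Icc 5 (L + 1)) × Equiv.Perm (IntegratedLabel L)

/-- The number `i` of the subvector `F̂_{L,i}` to which a component belongs. -/
def componentLevel (L : ℕ) : FirstBlock L ⊕ SecondBlock L → ℕ
  | Sum.inl _ => 4
  | Sum.inr q => q.1

/-- The permutation `σ` of a component `F̂_{L,i}^σ`. -/
def componentPerm (L : ℕ) : FirstBlock L ⊕ SecondBlock L → Equiv.Perm (IntegratedLabel L)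
  | Sum.inl σ => σ
  | Sum.inr q => q.2

/-- The vector `F̂_L(x_3) = (F̂_{L,4}(x_3), F̂_{L,5}(x_3), …, F̂_{L,L+1}(x_3))`. -/
noncomputable def selbergVector (L : ℕ) (s : MandelstamIndex L → ℂ) (x₃ : ℝ) :
    FirstBlock L ⊕ SecondBlock L → ℂ :=
  fun q => selbergComponent L (componentLevel L q) (componentPerm L q) s x₃

/-- Square matrices of the size of `F̂_L` whose entries are polynomials in the Mandelstam
variables. -/
abbrev MandelstamMatrix (L : ℕ) : Type :=
  Matrix (FirstBlock L ⊕ SecondBlock L) (FirstBlock L ⊕ SecondBlock L)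
    (MvPolynomial (MandelstamIndex L) ℂ)

/-- All entries lie in the complex span `⟨s_{ij}⟩_ℂ` of the Mandelstam variables. -/
def HasLinearEntries (L : ℕ) (e : MandelstamMatrix L) : Prop :=
  ∀ p q, e p q ∈ Submodule.span ℂ
    (Set.range (MvPolynomial.X : MandelstamIndex L → MvPolynomial (MandelstamIndex L) ℂ))

/-- `e₀` and `e₁` have entries in `⟨s_{ij}⟩_ℂ` and `F̂_L` satisfies the Knizhnik–Zamolodchikov equation
`d/dx_3 F̂_L = (e₀ / x_3 + e₁ / (x_3 - 1)) F̂_L` on `0 < x_3 < 1`, for all values of the Mandelstam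
variables with positive real parts. -/
def IsKZPair (L : ℕ) (e₀ e₁ : MandelstamMatrix L) : Prop :=
  HasLinearEntries L e₀ ∧ HasLinearEntries L e₁ ∧
    ∀ s : MandelstamIndex L → ℂ, (∀ p, 0 < (s p).re) → ∀ x₃ ∈ Set.Ioo (0 : ℝ) 1,
      HasDerivAt (selbergVector L s)
        (((x₃ : ℂ)⁻¹ • e₀.map (MvPolynomial.eval s) +
            ((x₃ : ℂ) - 1)⁻¹ • e₁.map (MvPolynomial.eval s)).mulVec (selbergVector L s x₃))
        x₃

/-- The variable `s_{ij}` as a polynomial. -/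
noncomputable def mandelstamVar (L i j : ℕ) : MvPolynomial (MandelstamIndex L) ℂ :=
  mandelstam L MvPolynomial.X i j

/-- `s_max`, the sum of all `s_{ij}` with `1 ≤ i < j ≤ L` and `i, j ≠ 2`. -/
noncomputable def sMax (L : ℕ) : MvPolynomial (MandelstamIndex L) ℂ :=
  ∑ i ∈ (Finset.Icc 1 L).erase 2, ∑ j ∈ (Finset.Icc (i + 1) L).erase 2, mandelstamVar L i j

/-! Existence. Up to sign, the rational factor of a component is a product of two weighted sums over
increasing trees: one rooted at x_1 = 0 on a word A of labels, one rooted at x_2 = 1 on a word B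
(`componentFactor_eq_wordForm`). Substitute x_k = x_3 u_k for k in A and x_k = 1 + (x_3 - 1) u_k for
k in B. The Jacobian cancels the dependence of the rational factor on x_3
(`scaledJacobian_mul_componentFactor`), so only the Koba–Nielsen factor is differentiated. In its
logarithmic derivative, pairs inside A ∪ {1, 3} give s_{km}/x_3, pairs inside B ∪ {2, 3} give
s_{km}/(x_3 - 1), and pairs across give displacements x_k - x_1 or x_k - x_2 times propagators to
the other side (`logDerivative_eq`). A displacement telescopes along the path from k to its root: an
edge of the path loses its denominator and is cut, and the severed tree is attached to the other
root (`sum_displacement_mul_wordForm`). Iterated commutators turn the result back into words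
(`sum_mul_treeForm`), which gives rows of linear forms (`exists_kz_rows`).

The block forms are visible in these rows. A severed tree is never empty, so a transfer towards x_2
never ends in the first block; and for a component of the first block B is empty, so nothing can be
transferred towards x_1. Only the diagonal terms s_max and s_{23} remain.

The rescaling does not preserve the integration domain. The integrand is therefore continued by zero
to the whole space; for fixed u it is continuous in x_3 and differentiable off a countable set, so
the fundamental theorem of calculus and Fubini give an integrated equation (`integral_kz_eq`), from
which differentiability follows.

Uniqueness, which transfers the block forms to every pair of matrices, is linear independence of the
components over linear forms in the s_{ij} (`linear_relation_eq_zero`). Replacing s by (n + 1)s and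
letting n grow concentrates the integrals at the maximum of the Koba–Nielsen factor, so a relation
passes to the rational factors at critical points. In terms of c_{kj} = s_{kj}/x_{kj} the critical
point equations are linear and do not involve the positions; by analyticity the relation holds for
all circulations c and all positions of the integrated points (`sum_pairing_mul_chainProduct`).
Circulations supported on the chains of one component isolate its coefficients, and inductions over
cuts of the chains show that all of them vanish. -/

/-! ### Algebra of words and increasing trees -/

section WordAlgebra

variable {R : Type*} [CommRing R]

/-- The weighted sum over increasing trees on the letters of a word, read from its last letter:
every letter is attached to the root, with weight `f`, or to an earlier letter, with weight `c`. -/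
def wordForm (f : ℕ → R) (c : ℕ → ℕ → R) : List ℕ → R
  | [] => 1
  | w :: l => (f w + (l.map (c w)).sum) * wordForm f c l

/-- The weighted sum over increasing trees rooted at the last letter of a word. -/
def treeForm (c : ℕ → ℕ → R) : List ℕ → R
  | [] => 0
  | [_] => 1
  | w :: v :: l => ((v :: l).map (c w)).sum * treeForm c (v :: l)

/-- The signed words of the iterated commutator of the letters of a word. -/
def commutatorWords : List ℕ → List (ℤ × List ℕ)
  | [] => []
  | [v] => [(1, [v])]
  | w :: v :: l => (commutatorWords (v :: l)).map (fun p => (p.1, w :: p.2)) ++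
      (commutatorWords (v :: l)).map (fun p => (-p.1, p.2 ++ [w]))

/-- The ways to cut an edge of an increasing tree with root `r` on the letters of a word: the cut
edge, the word that stays attached to the root, and the word that is cut off. -/
def cutWords (r : ℕ) : List ℕ → List ((ℕ × ℕ) × List ℕ × List ℕ)
  | [] => []
  | w :: l => (cutWords r l).map (fun p => (p.1, w :: p.2.1, p.2.2)) ++
      ((cutWords r l).map (fun p => (p.1, p.2.1, w :: p.2.2)) ++
        (r :: l).map (fun u => ((u, w), l, [w])))

/-- For the letters of `V` the whole word `B` acts as part of the root. -/
theorem wordForm_append (f : ℕ → R) (c : ℕ → ℕ → R) (V B : List ℕ) :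
    wordForm f c (V ++ B) =
      wordForm (fun k => f k + (B.map (c k)).sum) c V * wordForm f c B := by
  induction V with
  | nil => simp [wordForm]
  | cons w l ih =>
    simp only [List.cons_append, wordForm, ih, List.map_append, List.sum_append]
    ring

theorem perm_of_mem_commutatorWords {V : List ℕ} {p : ℤ × List ℕ} (hp : p ∈ commutatorWords V) :
    p.2.Perm V := by
  induction V generalizing p with
  | nil => simp [commutatorWords] at hp
  | cons w l ih =>
    cases l with
    | nil => simp [commutatorWords] at hp; simp [hp]
    | cons v l =>
      simp only [commutatorWords, List.mem_append, List.mem_map] at hp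
      obtain ⟨q, hq, rfl⟩ | ⟨q, hq, rfl⟩ := hp
      · exact (ih hq).cons w
      · exact (List.perm_append_singleton w q.2).trans ((ih hq).cons w)

/-- This attaches a tree to a new root through any of its letters and expresses the outcome in
words. Induction on the first letter `w`: in the words that end with `w`, this letter becomes part
of the root, so `f` is replaced by `f + c · w`, and skewness of `c` makes the two halves of the
commutator combine. -/
theorem sum_mul_treeForm (c : ℕ → ℕ → R) (hc : ∀ k j, c k j = -c j k) (V : List ℕ) (f : ℕ → R) :
    (V.map f).sum * treeForm c V =
      ((commutatorWords V).map (fun p => (p.1 : R) * wordForm f c p.2)).sum := by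
  induction V generalizing f with
  | nil => simp [commutatorWords]
  | cons w l ih =>
    cases l with
    | nil => simp [commutatorWords, treeForm, wordForm]
    | cons v l =>
      have h1 : ((commutatorWords (v :: l)).map
          (fun p => (p.1 : R) * wordForm f c (w :: p.2))).sum =
          (f w + ((v :: l).map (c w)).sum) * (((v :: l).map f).sum * treeForm c (v :: l)) := by
        rw [ih f, ← List.sum_map_mul_left]
        refine congrArg List.sum (List.map_congr_left fun p hp => ?_)
        have : (p.2.map (c w)).sum = ((v :: l).map (c w)).sum :=
          ((perm_of_mem_commutatorWords hp).map _).sum_eq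
        simp only [wordForm, this]
        ring
      have h2 : ((commutatorWords (v :: l)).map
          (fun p => ((-p.1 : ℤ) : R) * wordForm f c (p.2 ++ [w]))).sum =
          -(f w * (((v :: l).map (fun k => f k + c k w)).sum * treeForm c (v :: l))) := by
        rw [ih (fun k => f k + c k w), ← neg_mul, ← List.sum_map_mul_left]
        refine congrArg List.sum (List.map_congr_left fun p hp => ?_)
        rw [wordForm_append]
        simp [wordForm]
        ring
      have h3 : ((v :: l).map (fun k => f k + c k w)).sum =
          ((v :: l).map f).sum - ((v :: l).map (c w)).sum := by
        generalize v :: l = t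
        induction t with
        | nil => simp
        | cons a t iht => simp only [List.map_cons, List.sum_cons, iht, hc a w]; ring
      rw [commutatorWords, List.map_append, List.sum_append, List.map_map, List.map_map]
      simp only [Function.comp_def]
      rw [h1, h2, h3, treeForm, List.map_cons (f := f), List.sum_cons]
      ring

theorem cutWords_spec {r : ℕ} {A : List ℕ} {p : (ℕ × ℕ) × List ℕ × List ℕ}
    (hp : p ∈ cutWords r A) :
    (p.2.2 ++ p.2.1).Perm A ∧ p.2.2 ≠ [] ∧ (p.1.1 = r ∨ p.1.1 ∈ A) ∧ p.1.2 ∈ A ∧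
      ((r :: A).Nodup → p.1.1 ≠ p.1.2) := by
  induction A generalizing p with
  | nil => simp [cutWords] at hp
  | cons w l ih =>
    simp only [cutWords, List.mem_append, List.mem_map] at hp
    have hsub : (r :: w :: l).Nodup → (r :: l).Nodup := fun h =>
      h.sublist (List.Sublist.cons_cons r (List.sublist_cons_self w l))
    obtain ⟨q, hq, rfl⟩ | ⟨q, hq, rfl⟩ | ⟨u, hu, rfl⟩ := hp
    · obtain ⟨h1, h2, h3, h4, h5⟩ := ih hq
      exact ⟨List.perm_middle.trans (h1.cons w), h2, h3.imp_right (List.mem_cons_of_mem w),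
        List.mem_cons_of_mem w h4, fun h => h5 (hsub h)⟩
    · obtain ⟨h1, h2, h3, h4, h5⟩ := ih hq
      exact ⟨h1.cons w, by simp, h3.imp_right (List.mem_cons_of_mem w),
        List.mem_cons_of_mem w h4, fun h => h5 (hsub h)⟩
    · refine ⟨by simp, by simp, ?_, by simp, fun h huw => ?_⟩
      · rcases List.mem_cons.1 hu with h | h
        · exact Or.inl h
        · exact Or.inr (List.mem_cons_of_mem w h)
      · obtain rfl : u = w := huw
        rcases List.mem_cons.1 hu with rfl | h'
        · simp at h
        · simp [h'] at h

theorem treeForm_cons (c : ℕ → ℕ → R) (w : ℕ) {V : List ℕ} (hV : V ≠ []) :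
    treeForm c (w :: V) = (V.map (c w)).sum * treeForm c V := by
  cases V with
  | nil => exact absurd rfl hV
  | cons v l => rfl

/-- In every tree x_k - x_r is the sum of the differences along the path from k to the root, and
multiplying an edge weight by its difference leaves `S`. Exchanging the two sums, each edge is cut
once and collects `h` from all letters beyond it. -/
theorem sum_displacement_mul_wordForm (r : ℕ) (S c : ℕ → ℕ → R) (x : ℕ → R) (A : List ℕ)
    (hA : (r :: A).Nodup)
    (hc : ∀ k ∈ A, ∀ j ∈ r :: A, k ≠ j → c k j * (x k - x j) = S j k) (h : ℕ → R) :
    (A.map (fun k => (x k - x r) * h k)).sum * wordForm (fun k => c k r) c A =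
      ((cutWords r A).map (fun p => S p.1.1 p.1.2 *
        (wordForm (fun k => c k r) c p.2.1 * ((p.2.2.map h).sum * treeForm c p.2.2)))).sum := by
  induction A generalizing h with
  | nil => simp [cutWords]
  | cons w l ih =>
    have hsub : (r :: l).Nodup :=
      hA.sublist (List.Sublist.cons_cons r (List.sublist_cons_self w l))
    have ih' := ih hsub (fun k hk j hj hkj => hc k (List.mem_cons_of_mem w hk) j
      (by rcases List.mem_cons.1 hj with rfl | hj <;> simp_all) hkj)
    have hwl : w ∉ l := by
      have := hA
      simp only [List.nodup_cons] at this
      exact this.2.1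
    have hwr : w ≠ r := by rintro rfl; simp at hA
    set φ := wordForm (fun k => c k r) c with hφ
    -- the letter `w` moves along the path that joins it to the root
    have key : (x w - x r) * ((c w r + (l.map (c w)).sum) * φ l) =
        ((r :: l).map (fun u => S u w)).sum * φ l +
          ((cutWords r l).map (fun p => S p.1.1 p.1.2 *
            (φ p.2.1 * treeForm c (w :: p.2.2)))).sum := by
      have h1 : ((cutWords r l).map (fun p => S p.1.1 p.1.2 *
            (φ p.2.1 * treeForm c (w :: p.2.2)))).sum =
          (l.map (fun k => (x k - x r) * c w k)).sum * φ l := by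
        rw [ih' (c w)]
        refine congrArg List.sum (List.map_congr_left fun p hp => ?_)
        rw [treeForm_cons c w (cutWords_spec hp).2.1]
      have h2 : ∀ t : List ℕ, (∀ j ∈ t, c w j * (x w - x j) = S j w) →
          (x w - x r) * (t.map (c w)).sum =
            (t.map (fun u => S u w)).sum + (t.map (fun k => (x k - x r) * c w k)).sum := by
        intro t ht
        induction t with
        | nil => simp
        | cons a t iht =>
          simp only [List.map_cons, List.sum_cons, mul_add,
            iht (fun j hj => ht j (List.mem_cons_of_mem a hj)), ← ht a (by simp)]
          ring
      have h3 := h2 l (fun j hj => hc w (by simp) j (by simp [hj]) (by rintro rfl; exact hwl hj))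
      have h4 := hc w (by simp) r (by simp) hwr
      rw [h1, List.map_cons, List.sum_cons, ← h4]
      linear_combination φ l * h3
    -- The letter `w` may hang from either piece of a tree already cut. The two pieces together are
    -- a permutation of `l`, so the weights add up to the full sum over `l`; the part with `h w` is
    -- kept for `key`.
    have e1 : ((cutWords r l).map (fun p => S p.1.1 p.1.2 *
        (φ (w :: p.2.1) * ((p.2.2.map h).sum * treeForm c p.2.2)))).sum +
        ((cutWords r l).map (fun p => S p.1.1 p.1.2 *
        (φ p.2.1 * (((w :: p.2.2).map h).sum * treeForm c (w :: p.2.2))))).sum =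
        (c w r + (l.map (c w)).sum) * ((l.map (fun k => (x k - x r) * h k)).sum * φ l) +
        h w * ((cutWords r l).map (fun p => S p.1.1 p.1.2 *
            (φ p.2.1 * treeForm c (w :: p.2.2)))).sum := by
      rw [ih' h, ← List.sum_map_mul_left, ← List.sum_map_mul_left, ← List.sum_map_add,
        ← List.sum_map_add]
      refine congrArg List.sum (List.map_congr_left fun p hp => ?_)
      obtain ⟨hperm, hne, -⟩ := cutWords_spec hp
      have : (l.map (c w)).sum = (p.2.2.map (c w)).sum + (p.2.1.map (c w)).sum := by
        rw [← List.sum_append, ← List.map_append, (hperm.map _).sum_eq]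
      rw [treeForm_cons c w hne, this, hφ, wordForm, List.map_cons, List.sum_cons]
      ring
    -- The remaining cuts sever the edge above `w` itself, which is a leaf.
    have e2 : ((r :: l).map (fun u => S u w * (φ l * (([w].map h).sum * treeForm c [w])))).sum =
        h w * (((r :: l).map (fun u => S u w)).sum * φ l) := by
      rw [List.sum_map_mul_right]
      simp [treeForm]
      ring
    rw [cutWords, List.map_append, List.map_append, List.sum_append, List.sum_append,
      List.map_map, List.map_map, List.map_map]
    simp only [Function.comp_def]
    rw [← add_assoc, e1, e2, hφ, wordForm, List.map_cons, List.sum_cons, ← hφ]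
    linear_combination h w * key

end WordAlgebra

/-! ### Components as pairs of words -/

section ComponentWords

/-- The word of the labels attached to the point `x_1` in a component. -/
def wordAtZero (L i : ℕ) (σ : Equiv.Perm (IntegratedLabel L)) : List ℕ :=
  (List.range' i (L + 1 - i)).map (relabel L σ)

/-- The word of the labels attached to the point `x_2` in a component. -/
def wordAtOne (L i : ℕ) (σ : Equiv.Perm (IntegratedLabel L)) : List ℕ :=
  ((List.range' 4 (i - 4)).reverse).map (relabel L σ)

/-- The indices of the vector `F̂_L`. -/
abbrev ComponentIndex (L : ℕ) : Type := FirstBlock L ⊕ SecondBlock L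

/-- The rational factor of a component. -/
noncomputable def componentFactor (L : ℕ) (q : ComponentIndex L) (S : ℕ → ℕ → ℂ) (X : ℕ → ℝ) : ℂ :=
  rationalFactor L (componentLevel L q)
    (fun j k => S (relabel L (componentPerm L q) j) (relabel L (componentPerm L q) k))
    (fun k => X (relabel L (componentPerm L q) k))

/-- The quotients `s_{kj} / x_{kj}`. -/
noncomputable def propagator (S : ℕ → ℕ → ℂ) (X : ℕ → ℝ) (k j : ℕ) : ℂ :=
  S k j / ((X k - X j : ℝ) : ℂ)

theorem propagator_skew {S : ℕ → ℕ → ℂ} (hS : ∀ k j, S k j = S j k) (X : ℕ → ℝ) (k j : ℕ) :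
    propagator S X k j = -propagator S X j k := by
  rw [propagator, propagator, hS k j, ← neg_sub (X j) (X k), Complex.ofReal_neg, div_neg]

theorem mandelstam_symm {R : Type*} [Zero R] (L : ℕ) (s : MandelstamIndex L → R) (k j : ℕ) :
    mandelstam L s k j = mandelstam L s j k := by
  unfold mandelstam
  split_ifs <;> first | rfl | omega

theorem wordForm_map_range' {R : Type*} [CommRing R] (f : ℕ → R) (c : ℕ → ℕ → R) (g : ℕ → ℕ)
    (i d : ℕ) :
    wordForm f c ((List.range' i d).map g) =
      ∏ k ∈ Finset.Ico i (i + d), (f (g k) + ∑ j ∈ Finset.Ico (k + 1) (i + d), c (g k) (g j)) := by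
  induction d generalizing i with
  | zero => simp [wordForm]
  | succ d ih =>
    have hs : ∀ (a n : ℕ) (h : ℕ → R),
        ((List.range' a n).map h).sum = ∑ j ∈ Finset.Ico a (a + n), h j := by
      intro a n h
      rw [← List.sum_toFinset h List.nodup_range']
      congr 1
      ext j
      simp [List.mem_range'_1]
    rw [List.range'_succ, List.map_cons, wordForm, ih,
      Finset.prod_eq_prod_Ico_succ_bot (by omega : i < i + (d + 1)), List.map_map, hs,
      show i + 1 + d = i + (d + 1) by omega]
    rfl

theorem wordForm_map_reverse_range' {R : Type*} [CommRing R] (f : ℕ → R) (c : ℕ → ℕ → R)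
    (g : ℕ → ℕ) (i d : ℕ) :
    wordForm f c ((List.range' i d).reverse.map g) =
      ∏ k ∈ Finset.Ico i (i + d), (f (g k) + ∑ j ∈ Finset.Ico i k, c (g k) (g j)) := by
  induction d with
  | zero => simp [wordForm]
  | succ d ih =>
    have hs : (((List.range' i d).reverse.map g).map (c (g (i + d)))).sum =
        ∑ j ∈ Finset.Ico i (i + d), c (g (i + d)) (g j) := by
      rw [List.map_map, List.map_reverse, List.sum_reverse, ← List.sum_toFinset _ List.nodup_range']
      refine Finset.sum_congr ?_ fun _ _ => rfl
      ext j
      simp [List.mem_range'_1]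
    rw [List.range'_1_concat, List.reverse_append, List.reverse_singleton, List.singleton_append,
      List.map_cons, wordForm, ih, hs, ← add_assoc, Finset.prod_Ico_succ_top (by omega), mul_comm]

theorem relabel_of_notMem (L : ℕ) (σ : Equiv.Perm (IntegratedLabel L)) {k : ℕ}
    (hk : k ∉ Finset.Icc 4 L) : relabel L σ k = k :=
  Equiv.Perm.ofSubtype_apply_of_not_mem (p := fun k => k ∈ Finset.Icc 4 L) σ hk

theorem relabel_of_mem (L : ℕ) (σ : Equiv.Perm (IntegratedLabel L)) {k : ℕ}
    (hk : k ∈ Finset.Icc 4 L) : relabel L σ k = σ ⟨k, hk⟩ :=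
  Equiv.Perm.ofSubtype_apply_of_mem (p := fun k => k ∈ Finset.Icc 4 L) σ hk

theorem relabel_mem_iff (L : ℕ) (σ : Equiv.Perm (IntegratedLabel L)) {k : ℕ} :
    relabel L σ k ∈ Finset.Icc 4 L ↔ k ∈ Finset.Icc 4 L := by
  by_cases hk : k ∈ Finset.Icc 4 L
  · rw [relabel_of_mem L σ hk]
    exact ⟨fun _ => hk, fun _ => (σ ⟨k, hk⟩).2⟩
  · rw [relabel_of_notMem L σ hk]

theorem componentLevel_mem (L : ℕ) (hL : 4 ≤ L) (q : ComponentIndex L) :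
    4 ≤ componentLevel L q ∧ componentLevel L q ≤ L + 1 := by
  rcases q with σ | q
  · exact ⟨le_rfl, by simp only [componentLevel]; omega⟩
  · have := Finset.mem_Icc.1 q.1.2
    exact ⟨by simp only [componentLevel]; omega, this.2⟩

/-- The factors at x_2 are written with the earlier label first, opposite to `wordForm`; reversing
them costs one sign for each of the `i - 4` factors. -/
theorem componentFactor_eq_wordForm (L : ℕ) (hL : 4 ≤ L) (q : ComponentIndex L)
    (S : ℕ → ℕ → ℂ) (hS : ∀ k j, S k j = S j k) (X : ℕ → ℝ) (h1 : X 1 = 0) :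
    componentFactor L q S X = (-1) ^ (componentLevel L q - 4) *
      (wordForm (fun k => propagator S X k 1) (propagator S X)
          (wordAtZero L (componentLevel L q) (componentPerm L q)) *
        wordForm (fun k => propagator S X k 2) (propagator S X)
          (wordAtOne L (componentLevel L q) (componentPerm L q))) := by
  obtain ⟨h4, h5⟩ := componentLevel_mem L hL q
  rw [componentFactor]
  set i := componentLevel L q
  set σ := componentPerm L q
  have r1 : relabel L σ 1 = 1 := relabel_of_notMem L σ (by simp)
  have r2 : relabel L σ 2 = 2 := relabel_of_notMem L σ (by simp)
  rw [rationalFactor, wordAtZero, wordAtOne, wordForm_map_range', wordForm_map_reverse_range',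
    show i + (L + 1 - i) = L + 1 by omega, show 4 + (i - 4) = i by omega, mul_left_comm,
    show (-1 : ℂ) ^ (i - 4) = ∏ _k ∈ Finset.Ico 4 i, (-1 : ℂ) by simp, ← Finset.prod_mul_distrib]
  congr 1
  · refine Finset.prod_congr (by ext; simp) fun k _ => ?_
    congr 1
    rw [propagator, h1, sub_zero, hS, r1]
  · refine Finset.prod_congr rfl fun m hm => ?_
    rw [Finset.mem_Ico] at hm
    have : (Finset.Ico 2 m).erase 3 = insert 2 (Finset.Ico 4 m) := by
      ext; simp; omega
    rw [this, Finset.sum_insert (by simp), r2, neg_one_mul, neg_add, ← Finset.sum_neg_distrib]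
    congr 1
    · rw [propagator_skew hS, neg_neg, propagator]
    · refine Finset.sum_congr rfl fun n _ => ?_
      rw [propagator_skew hS, neg_neg, propagator]

theorem perm_words (L : ℕ) (hL : 4 ≤ L) (q : ComponentIndex L) :
    (wordAtZero L (componentLevel L q) (componentPerm L q) ++
      wordAtOne L (componentLevel L q) (componentPerm L q)).Nodup ∧
    ∀ k, k ∈ wordAtZero L (componentLevel L q) (componentPerm L q) ++
      wordAtOne L (componentLevel L q) (componentPerm L q) ↔ k ∈ Finset.Icc 4 L := by
  obtain ⟨h4, h5⟩ := componentLevel_mem L hL q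
  set i := componentLevel L q
  set σ := componentPerm L q
  constructor
  · rw [wordAtZero, wordAtOne, ← List.map_append]
    refine List.Nodup.map (relabel L σ).injective ?_
    rw [List.nodup_append]
    refine ⟨List.nodup_range', List.nodup_reverse.2 List.nodup_range', ?_⟩
    intro a ha b hb
    simp [List.mem_range'_1] at ha hb
    omega
  · intro k
    rw [wordAtZero, wordAtOne, ← List.map_append, List.mem_map]
    constructor
    · rintro ⟨a, ha, rfl⟩
      rw [relabel_mem_iff]
      simp [List.mem_range'_1] at ha ⊢
      omega
    · intro hk
      refine ⟨(relabel L σ).symm k, ?_, by simp⟩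
      have : (relabel L σ).symm k ∈ Finset.Icc 4 L := by
        rw [← relabel_mem_iff L σ]; simpa using hk
      simp [List.mem_range'_1] at this ⊢
      omega

theorem exists_component_of_words (L : ℕ) (hL : 4 ≤ L) (A B : List ℕ) (hn : (A ++ B).Nodup)
    (hm : ∀ k, k ∈ A ++ B ↔ k ∈ Finset.Icc 4 L) :
    ∃ q : ComponentIndex L, wordAtZero L (componentLevel L q) (componentPerm L q) = A ∧
      wordAtOne L (componentLevel L q) (componentPerm L q) = B ∧
      (B ≠ [] → ∃ p, q = Sum.inr p) := by
  -- Positions 4, …, L carry `B` backwards and then `A`, because `wordAtOne` reads its positions in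
  -- descending order. The level is thus `4 + B.length`.
  set W := B.reverse ++ A with hW
  have hWn : W.Nodup := by
    have : W.Perm (A ++ B) := ((List.reverse_perm B).append_right A).trans List.perm_append_comm
    exact this.nodup_iff.2 hn
  have hWm : ∀ k, k ∈ W ↔ k ∈ Finset.Icc 4 L := fun k => by
    rw [← hm k]; simp [hW, or_comm]
  have hWl : W.length = L - 3 := by
    rw [← List.toFinset_card_of_nodup hWn, show W.toFinset = Finset.Icc 4 L by ext; simp [hWm],
      Nat.card_Icc]
    omega
  have hlen : W.length = B.length + A.length := by simp [hW]
  have hlt : ∀ k : IntegratedLabel L, (k : ℕ) - 4 < W.length := fun k => by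
    have := Finset.mem_Icc.1 k.2
    omega
  have hinj : Function.Injective (fun k : IntegratedLabel L =>
      (⟨W[(k : ℕ) - 4]'(hlt k), (hWm _).1 (List.getElem_mem _)⟩ : IntegratedLabel L)) := by
    intro k j hkj
    have h := (hWn.getElem_inj_iff).1 (congrArg Subtype.val hkj)
    have := Finset.mem_Icc.1 k.2
    have := Finset.mem_Icc.1 j.2
    exact Subtype.ext (by omega)
  set σ : Equiv.Perm (IntegratedLabel L) := Equiv.ofBijective _ (Finite.injective_iff_bijective.1 hinj)
    with hσ
  have hrel : ∀ (t : ℕ) (ht : t < W.length), relabel L σ (4 + t) = W[t] := by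
    intro t ht
    rw [relabel_of_mem L σ (Finset.mem_Icc.2 (by omega))]
    simp [hσ]
  have hA : wordAtZero L (4 + B.length) σ = A := by
    rw [wordAtZero]
    refine List.ext_getElem (by simp; omega) fun t h1 h2 => ?_
    rw [List.getElem_map, List.getElem_range', one_mul, add_assoc, hrel _ (by omega)]
    simp [hW]
  have hB : wordAtOne L (4 + B.length) σ = B := by
    rw [wordAtOne, ← List.reverse_inj, List.map_reverse, List.reverse_reverse]
    refine List.ext_getElem (by simp) fun t h1 h2 => ?_
    have h3 : t < B.length := by simpa using h2
    rw [List.getElem_map, List.getElem_range', one_mul, hrel _ (by omega)]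
    simp [hW, h3]
  by_cases hB0 : B = []
  · subst hB0
    exact ⟨Sum.inl σ, hA, hB, fun h => absurd rfl h⟩
  · have : 0 < B.length := List.length_pos_iff.2 hB0
    exact ⟨Sum.inr (⟨4 + B.length, Finset.mem_Icc.2 (by omega)⟩, σ), hA, hB, fun _ => ⟨_, rfl⟩⟩

theorem wordAtOne_inl (L : ℕ) (σ : Equiv.Perm (IntegratedLabel L)) :
    wordAtOne L (componentLevel L (Sum.inl σ)) (componentPerm L (Sum.inl σ)) = [] := by
  simp [wordAtOne, componentLevel]

end ComponentWords

/-! ### The logarithmic derivative under rescaling -/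

section LogDerivative

/-- The logarithmic derivative of the Koba–Nielsen factor when the points move with velocities
`u`. -/
noncomputable def logDerivative (L : ℕ) (S : ℕ → ℕ → ℂ) (X u : ℕ → ℝ) : ℂ :=
  ∑ k ∈ Finset.Icc 1 L, ∑ m ∈ Finset.Icc (k + 1) L, S k m * (((u k - u m) / (X k - X m) : ℝ) : ℂ)

/-- The sum of `S k m` over the pairs `k < m` in a set of labels. -/
def pairSum {M : Type*} [AddCommMonoid M] (L : ℕ) (T : Finset ℕ) (S : ℕ → ℕ → M) : M :=
  ∑ k ∈ Finset.Icc 1 L, ∑ m ∈ Finset.Icc (k + 1) L, if k ∈ T ∧ m ∈ T then S k m else 0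

theorem sum_Icc_pairs {M : Type*} [AddCommMonoid M] (L : ℕ) (z : ℕ → ℕ → M)
    (hz : ∀ k, z k k = 0) :
    ∑ k ∈ Finset.Icc 1 L, ∑ m ∈ Finset.Icc (k + 1) L, (z k m + z m k) =
      ∑ k ∈ Finset.Icc 1 L, ∑ m ∈ Finset.Icc 1 L, z k m := by
  have h : ∀ k ∈ Finset.Icc 1 L, ∑ m ∈ Finset.Icc 1 L, z k m =
      ∑ m ∈ Finset.Icc (k + 1) L, z k m + ∑ m ∈ Finset.Ico 1 k, z k m := by
    intro k hk
    rw [Finset.mem_Icc] at hk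
    have : Finset.Icc 1 L = insert k (Finset.Icc (k + 1) L ∪ Finset.Ico 1 k) := by
      ext; simp; omega
    rw [this, Finset.sum_insert (by simp), hz, zero_add, Finset.sum_union]
    rw [Finset.disjoint_left]
    intro a; simp; omega
  rw [Finset.sum_congr rfl h, Finset.sum_add_distrib]
  simp_rw [Finset.sum_add_distrib]
  congr 1
  refine Finset.sum_comm' fun a b => ?_
  simp; omega

theorem sum_toFinset_ite (L r : ℕ) (A : List ℕ) (hA : (r :: A).Nodup)
    (hs : ∀ k ∈ r :: A, k ∈ Finset.Icc 1 L) (f : ℕ → ℂ) :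
    ∑ k ∈ Finset.Icc 1 L, (if k ∈ insert r A.toFinset then f k else 0) =
      f r + (A.map f).sum := by
  rw [← Finset.sum_filter, Finset.filter_mem_eq_inter, Finset.inter_eq_right.2,
    Finset.sum_insert (by simpa using (List.nodup_cons.1 hA).1),
    List.sum_toFinset f (List.nodup_cons.1 hA).2]
  intro k hk
  exact hs k (by simpa using hk)

/-- For two points scaled about the same root the quotient of velocity difference and position
difference is a constant, 1/x or 1/(x - 1). For a pair on different sides it splits into two terms,
one for each endpoint, and the velocity of an endpoint is its displacement from its own root divided
by x or by x - 1. -/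
theorem logDerivative_eq (L : ℕ) (hL : 4 ≤ L) (A B : List ℕ) (hn : (A ++ B).Nodup)
    (hm : ∀ k, k ∈ A ++ B ↔ k ∈ Finset.Icc 4 L) (S : ℕ → ℕ → ℂ) (hS : ∀ k j, S k j = S j k)
    (X u : ℕ → ℝ) (x : ℝ) (hx0 : x ≠ 0) (hx1 : x ≠ 1)
    (hinj : Set.InjOn X (Finset.Icc 1 L)) (h1 : X 1 = 0) (h2 : X 2 = 1) (h3 : X 3 = x)
    (u1 : u 1 = 0) (u2 : u 2 = 0) (u3 : u 3 = 1)
    (hA : ∀ k ∈ A, X k = x * u k) (hB : ∀ k ∈ B, X k = 1 + (x - 1) * u k) :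
    logDerivative L S X u =
      (x : ℂ)⁻¹ * (pairSum L (insert 3 (insert 1 A.toFinset)) S +
        (A.map (fun k => ((X k : ℂ) - (X 1 : ℂ)) * (propagator S X k 2 +
          (B.map (propagator S X k)).sum))).sum) +
      ((x : ℂ) - 1)⁻¹ * (pairSum L (insert 3 (insert 2 B.toFinset)) S +
        (B.map (fun k => ((X k : ℂ) - (X 2 : ℂ)) * (propagator S X k 1 +
          (A.map (propagator S X k)).sum))).sum) := by
  set A1 : Finset ℕ := insert 1 A.toFinset with hA1
  set B2 : Finset ℕ := insert 2 B.toFinset with hB2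
  have hmA : ∀ k ∈ A, k ∈ Finset.Icc 4 L := fun k hk => (hm k).1 (by simp [hk])
  have hmB : ∀ k ∈ B, k ∈ Finset.Icc 4 L := fun k hk => (hm k).1 (by simp [hk])
  have hAB : ∀ k ∈ A, k ∉ B := fun k hk hk' => by
    rw [List.nodup_append] at hn
    exact hn.2.2 k hk k hk' rfl
  have hXA : ∀ k ∈ A1, X k = x * u k := by
    intro k hk
    rcases Finset.mem_insert.1 hk with rfl | hk
    · simp [h1, u1]
    · exact hA k (by simpa using hk)
  have hXB : ∀ k ∈ B2, X k = 1 + (x - 1) * u k := by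
    intro k hk
    rcases Finset.mem_insert.1 hk with rfl | hk
    · simp [h2, u2]
    · exact hB k (by simpa using hk)
  have hdisj : ∀ k ∈ A1, k ∉ B2 := by
    intro k hk hk'
    simp only [hA1, hB2, Finset.mem_insert, List.mem_toFinset] at hk hk'
    rcases hk with rfl | hk <;> rcases hk' with h | hk'
    · omega
    · simpa using hmB 1 hk'
    · subst h; simpa using hmA 2 hk
    · exact hAB k hk hk'
  have h3A : 3 ∉ A1 := by
    simp only [hA1, Finset.mem_insert, List.mem_toFinset]
    rintro (h | h)
    · omega
    · simpa using hmA 3 h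
  have h3B : 3 ∉ B2 := by
    simp only [hB2, Finset.mem_insert, List.mem_toFinset]
    rintro (h | h)
    · omega
    · simpa using hmB 3 h
  have hcov : ∀ k ∈ Finset.Icc 1 L, k = 3 ∨ k ∈ A1 ∨ k ∈ B2 := by
    intro k hk
    rw [Finset.mem_Icc] at hk
    have := hm k
    rw [List.mem_append, Finset.mem_Icc] at this
    simp only [hA1, hB2, Finset.mem_insert, List.mem_toFinset]
    by_cases h : 4 ≤ k
    · rcases this.2 ⟨h, hk.2⟩ with h | h <;> simp [h]
    · have : k = 1 ∨ k = 2 ∨ k = 3 := by omega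
      tauto
  -- The share of the endpoint `k` in a cross pair; it vanishes unless the two labels lie on
  -- different sides.
  set z : ℕ → ℕ → ℂ := fun k m =>
    if k ∈ A1 then (if m ∈ B2 then (u k : ℂ) * propagator S X k m else 0)
    else if k ∈ B2 then (if m ∈ A1 then (u k : ℂ) * propagator S X k m else 0) else 0 with hz
  have hzkk : ∀ k, z k k = 0 := by
    intro k
    simp only [hz]
    split_ifs with a b c
    · exact absurd b (hdisj k a)
    · rfl
    · rfl
    · rfl
  have hx1' : (x : ℂ) - 1 ≠ 0 := by
    rw [sub_ne_zero]; exact_mod_cast hx1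
  have hx0' : (x : ℂ) ≠ 0 := by exact_mod_cast hx0
  have hpair : ∀ k ∈ Finset.Icc 1 L, ∀ m ∈ Finset.Icc (k + 1) L,
      S k m * (((u k - u m) / (X k - X m) : ℝ) : ℂ) =
        (x : ℂ)⁻¹ * (if k ∈ insert 3 A1 ∧ m ∈ insert 3 A1 then S k m else 0) +
        ((x : ℂ) - 1)⁻¹ * (if k ∈ insert 3 B2 ∧ m ∈ insert 3 B2 then S k m else 0) +
        (z k m + z m k) := by
    intro k hk m hm'
    have hkm : k ≠ m := by rw [Finset.mem_Icc] at hm'; omega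
    have hmI : m ∈ Finset.Icc 1 L := by rw [Finset.mem_Icc] at hm' ⊢; omega
    have hne : X k - X m ≠ 0 := sub_ne_zero.2 fun h => hkm (hinj hk hmI h)
    have hne' : (X k : ℂ) - (X m : ℂ) ≠ 0 := by exact_mod_cast hne
    have hne'' : (X m : ℂ) - (X k : ℂ) ≠ 0 := by rw [← neg_sub]; exact neg_ne_zero.2 hne'
    have hB1 : ∀ k ∈ B2, k ∉ A1 := fun k hk h => hdisj k h hk
    have key0 : X k = x * u k → X m = x * u m → ((u k - u m) / (X k - X m)) = x⁻¹ := by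
      intro a b
      rw [div_eq_iff hne, a, b]; field_simp
    have key1 : X k = 1 + (x - 1) * u k → X m = 1 + (x - 1) * u m →
        ((u k - u m) / (X k - X m)) = (x - 1)⁻¹ := by
      intro a b
      have := sub_ne_zero.2 hx1
      rw [div_eq_iff hne, a, b]; field_simp; ring
    have n3 : ∀ j ∈ A1, j ≠ 3 := fun j hj h => h3A (h ▸ hj)
    have n3' : ∀ j ∈ B2, j ≠ 3 := fun j hj h => h3B (h ▸ hj)
    -- With velocity 1 the point x_3 fits both scalings, so it belongs to both sides.
    have x3A : X 3 = x * u 3 := by rw [h3, u3, mul_one]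
    have x3B : X 3 = 1 + (x - 1) * u 3 := by rw [h3, u3]; ring
    have cross : S k m * (((u k - u m) / (X k - X m) : ℝ) : ℂ) =
        (u k : ℂ) * propagator S X k m + (u m : ℂ) * propagator S X m k := by
      rw [propagator_skew hS X m k, propagator]
      push_cast
      ring
    rcases hcov k hk with rfl | ha | ha <;> rcases hcov m hmI with rfl | hb | hb
    · exact absurd rfl hkm
    · rw [key0 x3A (hXA m hb)]
      simp [hz, h3A, h3B, hb, hdisj m hb, n3 m hb, mul_comm]
    · rw [key1 x3B (hXB m hb)]
      simp [hz, h3A, h3B, hb, hB1 m hb, n3' m hb, mul_comm]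
    · rw [key0 (hXA k ha) x3A]
      simp [hz, h3A, h3B, ha, hdisj k ha, n3 k ha, mul_comm]
    · rw [key0 (hXA k ha) (hXA m hb)]
      simp [hz, ha, hb, hdisj k ha, n3 k ha, hdisj m hb, mul_comm]
    · rw [cross]
      simp [hz, ha, hb, hdisj k ha, n3 k ha, n3' m hb, hB1 m hb]
    · rw [key1 (hXB k ha) x3B]
      simp [hz, h3A, h3B, ha, hB1 k ha, n3' k ha, mul_comm]
    · rw [cross]
      simp [hz, ha, hb, hB1 k ha, n3' k ha, n3 m hb, hdisj m hb]
    · rw [key1 (hXB k ha) (hXB m hb)]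
      simp [hz, ha, hb, hB1 k ha, n3' k ha, hB1 m hb, mul_comm]
  have hnA : (1 :: A).Nodup := by
    refine List.nodup_cons.2 ⟨fun h => ?_, (List.nodup_append.1 hn).1⟩
    simpa using hmA 1 h
  have hnB : (2 :: B).Nodup := by
    refine List.nodup_cons.2 ⟨fun h => ?_, (List.nodup_append.1 hn).2.1⟩
    simpa using hmB 2 h
  have hsA : ∀ k ∈ 1 :: A, k ∈ Finset.Icc 1 L := by
    intro k hk
    rcases List.mem_cons.1 hk with rfl | hk
    · simp; omega
    · have := hmA k hk; simp at this ⊢; omega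
  have hsB : ∀ k ∈ 2 :: B, k ∈ Finset.Icc 1 L := by
    intro k hk
    rcases List.mem_cons.1 hk with rfl | hk
    · simp; omega
    · have := hmB k hk; simp at this ⊢; omega
  have hcross : ∑ k ∈ Finset.Icc 1 L, ∑ m ∈ Finset.Icc 1 L, z k m =
      (A.map (fun k => (u k : ℂ) * (propagator S X k 2 + (B.map (propagator S X k)).sum))).sum +
      (B.map (fun k => (u k : ℂ) * (propagator S X k 1 + (A.map (propagator S X k)).sum))).sum := by
    have e : ∀ k ∈ Finset.Icc 1 L, ∑ m ∈ Finset.Icc 1 L, z k m =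
        (if k ∈ A1 then (u k : ℂ) * (propagator S X k 2 + (B.map (propagator S X k)).sum) else 0) +
        (if k ∈ B2 then (u k : ℂ) * (propagator S X k 1 + (A.map (propagator S X k)).sum) else 0) := by
      intro k hk
      by_cases ha : k ∈ A1
      · simp only [hz, ha, hdisj k ha, if_true, if_false, add_zero]
        rw [sum_toFinset_ite L 2 B hnB hsB, List.sum_map_mul_left, mul_add]
      · by_cases hb : k ∈ B2
        · simp only [hz, ha, hb, if_true, if_false, zero_add]
          rw [sum_toFinset_ite L 1 A hnA hsA, List.sum_map_mul_left, mul_add]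
        · simp [hz, ha, hb]
    rw [Finset.sum_congr rfl e, Finset.sum_add_distrib, sum_toFinset_ite L 1 A hnA hsA,
      sum_toFinset_ite L 2 B hnB hsB, u1, u2]
    simp
  have hfin : logDerivative L S X u = (x : ℂ)⁻¹ * pairSum L (insert 3 A1) S +
      ((x : ℂ) - 1)⁻¹ * pairSum L (insert 3 B2) S +
      ∑ k ∈ Finset.Icc 1 L, ∑ m ∈ Finset.Icc 1 L, z k m := by
    rw [logDerivative, Finset.sum_congr rfl fun k hk => Finset.sum_congr rfl (hpair k hk)]
    simp_rw [Finset.sum_add_distrib, ← Finset.mul_sum, ← Finset.sum_add_distrib]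
    rw [sum_Icc_pairs L z hzkk]
    rfl
  have eA : (A.map (fun k => ((X k : ℂ) - (X 1 : ℂ)) * (propagator S X k 2 +
      (B.map (propagator S X k)).sum))).sum = (x : ℂ) *
      (A.map (fun k => (u k : ℂ) * (propagator S X k 2 + (B.map (propagator S X k)).sum))).sum := by
    rw [← List.sum_map_mul_left]
    refine congrArg List.sum (List.map_congr_left fun k hk => ?_)
    rw [h1, hA k hk]
    push_cast
    ring
  have eB : (B.map (fun k => ((X k : ℂ) - (X 2 : ℂ)) * (propagator S X k 1 +
      (A.map (propagator S X k)).sum))).sum = ((x : ℂ) - 1) *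
      (B.map (fun k => (u k : ℂ) * (propagator S X k 1 + (A.map (propagator S X k)).sum))).sum := by
    rw [← List.sum_map_mul_left]
    refine congrArg List.sum (List.map_congr_left fun k hk => ?_)
    rw [h2, hB k hk]
    push_cast
    ring
  rw [hfin, hcross, eA, eB, mul_add, mul_add, inv_mul_cancel_left₀ hx0', inv_mul_cancel_left₀ hx1']
  ring

end LogDerivative

/-! ### Rows of linear forms -/

section LinearRows

/-- The space `⟨s_{ij}⟩_ℂ` of linear forms in the Mandelstam variables. -/
noncomputable abbrev mandelstamSpan (L : ℕ) : Submodule ℂ (MvPolynomial (MandelstamIndex L) ℂ) :=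
  Submodule.span ℂ
    (Set.range (MvPolynomial.X : MandelstamIndex L → MvPolynomial (MandelstamIndex L) ℂ))

/-- A function of the Mandelstam variables and the positions is a combination of the rational
factors of the components in `J` whose coefficients are linear forms. -/
def IsLinearCombination (L : ℕ) (J : Set (ComponentIndex L))
    (G : (MandelstamIndex L → ℂ) → (ℕ → ℝ) → ℂ) : Prop :=
  ∃ row : ComponentIndex L → MvPolynomial (MandelstamIndex L) ℂ,
    (∀ q, row q ∈ mandelstamSpan L) ∧ (∀ q ∉ J, row q = 0) ∧
    ∀ s X, X 1 = 0 → X 2 = 1 → Set.InjOn X (Finset.Icc 1 L) →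
      G s X = ∑ q, MvPolynomial.eval s (row q) * componentFactor L q (mandelstam L s) X

variable {L : ℕ} {J : Set (ComponentIndex L)}

theorem isLinearCombination_zero : IsLinearCombination L J (fun _ _ => 0) :=
  ⟨fun _ => 0, fun _ => Submodule.zero_mem _, fun _ _ => rfl, by simp⟩

theorem IsLinearCombination.add {G H : (MandelstamIndex L → ℂ) → (ℕ → ℝ) → ℂ}
    (hG : IsLinearCombination L J G) (hH : IsLinearCombination L J H) :
    IsLinearCombination L J (fun s X => G s X + H s X) := by
  obtain ⟨r, h1, h2, h3⟩ := hG
  obtain ⟨r', h1', h2', h3'⟩ := hH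
  refine ⟨fun q => r q + r' q, fun q => Submodule.add_mem _ (h1 q) (h1' q),
    fun q hq => by simp [h2 q hq, h2' q hq], fun s X a b c => ?_⟩
  simp [h3 s X a b c, h3' s X a b c, add_mul, Finset.sum_add_distrib]

theorem IsLinearCombination.const_mul {G : (MandelstamIndex L → ℂ) → (ℕ → ℝ) → ℂ}
    (hG : IsLinearCombination L J G) (z : ℂ) :
    IsLinearCombination L J (fun s X => z * G s X) := by
  obtain ⟨r, h1, h2, h3⟩ := hG
  refine ⟨fun q => z • r q, fun q => Submodule.smul_mem _ _ (h1 q),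
    fun q hq => by simp [h2 q hq], fun s X a b c => ?_⟩
  simp only [h3 s X a b c, Finset.mul_sum, MvPolynomial.smul_eval, mul_assoc]

theorem isLinearCombination_list_sum {α : Type*} (l : List α)
    (G : α → (MandelstamIndex L → ℂ) → (ℕ → ℝ) → ℂ)
    (hG : ∀ p ∈ l, IsLinearCombination L J (G p)) :
    IsLinearCombination L J (fun s X => (l.map (fun p => G p s X)).sum) := by
  induction l with
  | nil => simpa using isLinearCombination_zero
  | cons a l ih =>
    simp only [List.map_cons, List.sum_cons]
    exact (hG a (by simp)).add (ih fun p hp => hG p (by simp [hp]))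

theorem mandelstamVar_mem (L i j : ℕ) : mandelstamVar L i j ∈ mandelstamSpan L := by
  unfold mandelstamVar mandelstam
  split_ifs
  · exact Submodule.subset_span ⟨_, rfl⟩
  · exact Submodule.subset_span ⟨_, rfl⟩
  · exact Submodule.zero_mem _

theorem eval_mandelstamVar (L i j : ℕ) (s : MandelstamIndex L → ℂ) :
    MvPolynomial.eval s (mandelstamVar L i j) = mandelstam L s i j := by
  unfold mandelstamVar mandelstam
  split_ifs <;> simp

/-- The product of the word forms with roots `x_1` and `x_2`. -/
noncomputable def twoRootForm (S : ℕ → ℕ → ℂ) (X : ℕ → ℝ) (A B : List ℕ) : ℂ :=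
  wordForm (fun k => propagator S X k 1) (propagator S X) A *
    wordForm (fun k => propagator S X k 2) (propagator S X) B

/-- A pair of words is one component up to the sign `ε`, so a single column suffices. A nonempty `B`
excludes the first block, which is what later produces the zero block of e_0. -/
theorem isLinearCombination_mandelstam_mul (hL : 4 ≤ L) (u v : ℕ) {A B : List ℕ}
    (hn : (A ++ B).Nodup) (hm : ∀ k, k ∈ A ++ B ↔ k ∈ Finset.Icc 4 L)
    (hJ : J = Set.univ ∨ B ≠ [] ∧ J = Set.range Sum.inr) :
    IsLinearCombination L J (fun s X => mandelstam L s u v *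
      twoRootForm (mandelstam L s) X A B) := by
  obtain ⟨q, hA, hB, hq⟩ := exists_component_of_words L hL A B hn hm
  set ε : ℂ := (-1) ^ (componentLevel L q - 4)
  have hε : ε * ε = 1 := by rw [← mul_pow]; simp
  refine ⟨fun q' => if q' = q then ε • mandelstamVar L u v else 0, fun q' => ?_, fun q' hq' => ?_,
    fun s X h1 _ _ => ?_⟩ <;> beta_reduce
  · split_ifs
    · exact Submodule.smul_mem _ _ (mandelstamVar_mem L u v)
    · exact Submodule.zero_mem _
  · rw [if_neg]
    rintro rfl
    rcases hJ with rfl | ⟨hB0, rfl⟩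
    · exact hq' trivial
    · obtain ⟨p, hp⟩ := hq hB0
      exact hq' ⟨p, hp.symm⟩
  · rw [Finset.sum_eq_single q (fun q' _ h => by simp [h]) (by simp), if_pos rfl,
      componentFactor_eq_wordForm L hL q _ (mandelstam_symm L s) X h1, hA, hB]
    rw [MvPolynomial.smul_eval, eval_mandelstamVar, twoRootForm]
    linear_combination (-mandelstam L s u v *
      (wordForm (fun k => propagator (mandelstam L s) X k 1) (propagator (mandelstam L s) X) A *
    wordForm (fun k => propagator (mandelstam L s) X k 2) (propagator (mandelstam L s) X) B)) * hε

/-- The severed tree is attached to the root `t` or to a letter of `B`. After conversion to words by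
commutators, `wordForm_append` merges each word with `B`. -/
theorem sum_displacement_mul_twoWords (r t : ℕ) (S : ℕ → ℕ → ℂ) (hS : ∀ k j, S k j = S j k)
    (X : ℕ → ℝ) (A B : List ℕ) (hA : (r :: A).Nodup) (hX : Set.InjOn X {k | k ∈ r :: A}) :
    (A.map (fun k => ((X k : ℂ) - (X r : ℂ)) * (propagator S X k t +
          (B.map (propagator S X k)).sum))).sum *
      (wordForm (fun k => propagator S X k r) (propagator S X) A *
        wordForm (fun k => propagator S X k t) (propagator S X) B) =
    ((cutWords r A).map (fun p => ((commutatorWords p.2.2).map (fun p' => (p'.1 : ℂ) *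
      (S p.1.1 p.1.2 * (wordForm (fun k => propagator S X k r) (propagator S X) p.2.1 *
        wordForm (fun k => propagator S X k t) (propagator S X) (p'.2 ++ B))))).sum)).sum := by
  rw [← mul_assoc, sum_displacement_mul_wordForm r S (propagator S X) (fun k => (X k : ℂ)) A hA,
    ← List.sum_map_mul_right]
  · refine congrArg List.sum (List.map_congr_left fun p _ => ?_)
    rw [sum_mul_treeForm _ (propagator_skew hS X), ← List.sum_map_mul_left,
      ← List.sum_map_mul_left, ← List.sum_map_mul_right]
    refine congrArg List.sum (List.map_congr_left fun p' _ => ?_)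
    rw [wordForm_append]
    ring
  · intro k hk j hj hkj
    have : (X k : ℂ) - (X j : ℂ) ≠ 0 := by
      rw [sub_ne_zero]
      exact fun h => hkj (hX (List.mem_cons_of_mem r hk) hj (by exact_mod_cast h))
    rw [propagator, hS j k]
    push_cast
    exact div_mul_cancel₀ _ this

/-- The second block is enough because the severed word is nonempty and is put in front of `B`. -/
theorem isLinearCombination_move_to_one (hL : 4 ≤ L) {A B : List ℕ} (hn : (A ++ B).Nodup)
    (hm : ∀ k, k ∈ A ++ B ↔ k ∈ Finset.Icc 4 L) :
    IsLinearCombination L (Set.range Sum.inr) (fun s X =>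
      ((cutWords 1 A).map (fun p => ((commutatorWords p.2.2).map (fun p' => (p'.1 : ℂ) *
        (mandelstam L s p.1.1 p.1.2 *
          twoRootForm (mandelstam L s) X p.2.1 (p'.2 ++ B)))).sum)).sum) := by
  refine isLinearCombination_list_sum _ (fun (p : (ℕ × ℕ) × List ℕ × List ℕ) s X =>
    ((commutatorWords p.2.2).map (fun p' => (p'.1 : ℂ) * (mandelstam L s p.1.1 p.1.2 *
          twoRootForm (mandelstam L s) X p.2.1 (p'.2 ++ B)))).sum) fun p hp => ?_
  refine isLinearCombination_list_sum _ (fun (p' : ℤ × List ℕ) s X => (p'.1 : ℂ) *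
    (mandelstam L s p.1.1 p.1.2 *
          twoRootForm (mandelstam L s) X p.2.1 (p'.2 ++ B))) fun p' hp' => ?_
  obtain ⟨h1, h2, -⟩ := cutWords_spec hp
  have h3 := perm_of_mem_commutatorWords hp'
  have hperm : (p.2.1 ++ (p'.2 ++ B)).Perm (A ++ B) := by
    rw [← List.append_assoc]
    exact (((h3.append_left p.2.1).trans List.perm_append_comm).trans h1).append_right B
  refine (isLinearCombination_mandelstam_mul hL _ _ (hperm.nodup_iff.2 hn)
    (fun k => hperm.mem_iff.trans (hm k)) (Or.inr ⟨?_, rfl⟩)).const_mul _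
  intro h
  rw [List.append_eq_nil_iff] at h
  rw [h.1] at h3
  exact h2 h3.symm.eq_nil

theorem isLinearCombination_move_to_zero (hL : 4 ≤ L) {A B : List ℕ} (hn : (A ++ B).Nodup)
    (hm : ∀ k, k ∈ A ++ B ↔ k ∈ Finset.Icc 4 L) :
    IsLinearCombination L Set.univ (fun s X =>
      ((cutWords 2 B).map (fun p => ((commutatorWords p.2.2).map (fun p' => (p'.1 : ℂ) *
        (mandelstam L s p.1.1 p.1.2 *
          twoRootForm (mandelstam L s) X (p'.2 ++ A) p.2.1))).sum)).sum) := by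
  refine isLinearCombination_list_sum _ (fun (p : (ℕ × ℕ) × List ℕ × List ℕ) s X =>
    ((commutatorWords p.2.2).map (fun p' => (p'.1 : ℂ) * (mandelstam L s p.1.1 p.1.2 *
          twoRootForm (mandelstam L s) X (p'.2 ++ A) p.2.1))).sum) fun p hp => ?_
  refine isLinearCombination_list_sum _ (fun (p' : ℤ × List ℕ) s X => (p'.1 : ℂ) *
    (mandelstam L s p.1.1 p.1.2 *
          twoRootForm (mandelstam L s) X (p'.2 ++ A) p.2.1)) fun p' hp' => ?_
  obtain ⟨h1, h2, -⟩ := cutWords_spec hp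
  have h3 := perm_of_mem_commutatorWords hp'
  have hperm : ((p'.2 ++ A) ++ p.2.1).Perm (A ++ B) := by
    refine (List.perm_append_comm.append_right _).trans ?_
    rw [List.append_assoc]
    exact ((h3.append_right p.2.1).trans h1).append_left A
  exact (isLinearCombination_mandelstam_mul hL _ _ (hperm.nodup_iff.2 hn)
    (fun k => hperm.mem_iff.trans (hm k)) (Or.inl rfl)).const_mul _

theorem pairSum_mem (L : ℕ) (T : Finset ℕ) :
    pairSum L T (mandelstamVar L) ∈ mandelstamSpan L := by
  refine Submodule.sum_mem _ fun k _ => Submodule.sum_mem _ fun m _ => ?_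
  split_ifs
  · exact mandelstamVar_mem L k m
  · exact Submodule.zero_mem _

theorem eval_pairSum (L : ℕ) (T : Finset ℕ) (s : MandelstamIndex L → ℂ) :
    MvPolynomial.eval s (pairSum L T (mandelstamVar L)) = pairSum L T (mandelstam L s) := by
  simp only [pairSum, map_sum]
  refine Finset.sum_congr rfl fun k _ => Finset.sum_congr rfl fun m _ => ?_
  split_ifs <;> simp [eval_mandelstamVar]

/-- The point from which a label moves away under the rescaling adapted to a component. -/
noncomputable def rootPosition (L : ℕ) (q : ComponentIndex L) (k : ℕ) : ℝ :=
  if k = 2 ∨ k ∈ wordAtOne L (componentLevel L q) (componentPerm L q) then 1 else 0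

/-- Transfers from `A` to x_2 carry the factor 1/x and feed `r₀`; transfers from `B` to x_1 carry
1/(x - 1) and feed `r₁`. Pairs on one side only add to the diagonal, and x_3 takes part on both
sides. -/
theorem exists_kz_rows (hL : 4 ≤ L) (q : ComponentIndex L) :
    ∃ r₀ r₁ : ComponentIndex L → MvPolynomial (MandelstamIndex L) ℂ,
      (∀ q', r₀ q' ∈ mandelstamSpan L) ∧ (∀ q', r₁ q' ∈ mandelstamSpan L) ∧
      (∀ σ, r₀ (Sum.inl σ) = if q = Sum.inl σ then sMax L else 0) ∧
      (∀ σ, q = Sum.inl σ → ∀ q', r₁ q' = if q' = q then mandelstamVar L 2 3 else 0) ∧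
      ∀ (s : MandelstamIndex L → ℂ) (X u : ℕ → ℝ) (x : ℝ), x ≠ 0 → x ≠ 1 →
        Set.InjOn X (Finset.Icc 1 L) → X 1 = 0 → X 2 = 1 → X 3 = x →
        u 1 = 0 → u 2 = 0 → u 3 = 1 →
        (∀ k ∈ Finset.Icc 4 L, X k = rootPosition L q k + (x - rootPosition L q k) * u k) →
        logDerivative L (mandelstam L s) X u * componentFactor L q (mandelstam L s) X =
          ∑ q', ((x : ℂ)⁻¹ * MvPolynomial.eval s (r₀ q') +
            ((x : ℂ) - 1)⁻¹ * MvPolynomial.eval s (r₁ q')) *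
              componentFactor L q' (mandelstam L s) X := by
  obtain ⟨hn, hm⟩ := perm_words L hL q
  set A := wordAtZero L (componentLevel L q) (componentPerm L q) with hA
  set B := wordAtOne L (componentLevel L q) (componentPerm L q) with hB
  set ε : ℂ := (-1) ^ (componentLevel L q - 4)
  have hmA : ∀ k ∈ A, k ∈ Finset.Icc 4 L := fun k hk => (hm k).1 (by simp [hk])
  have hmB : ∀ k ∈ B, k ∈ Finset.Icc 4 L := fun k hk => (hm k).1 (by simp [hk])
  obtain ⟨a, ha1, ha2, ha3⟩ := (isLinearCombination_move_to_one hL hn hm).const_mul ε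
  have hb : ∃ b : ComponentIndex L → MvPolynomial (MandelstamIndex L) ℂ,
      (∀ q, b q ∈ mandelstamSpan L) ∧ (B = [] → ∀ q, b q = 0) ∧
      ∀ s X, X 1 = 0 → X 2 = 1 → Set.InjOn X (Finset.Icc 1 L) →
        ε * ((cutWords 2 B).map (fun p => ((commutatorWords p.2.2).map (fun p' => (p'.1 : ℂ) *
        (mandelstam L s p.1.1 p.1.2 *
          twoRootForm (mandelstam L s) X (p'.2 ++ A) p.2.1))).sum)).sum =
        ∑ q, MvPolynomial.eval s (b q) * componentFactor L q (mandelstam L s) X := by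
    -- An empty `B` has no edge to cut. The zero row has to be chosen explicitly, since the general
    -- lemma does not say which row represents the sum.
    by_cases hB0 : B = []
    · exact ⟨fun _ => 0, fun _ => Submodule.zero_mem _, fun _ _ => rfl, by simp [hB0, cutWords]⟩
    · obtain ⟨b, hb1, -, hb3⟩ := (isLinearCombination_move_to_zero hL hn hm).const_mul ε
      exact ⟨b, hb1, fun h => absurd h hB0, hb3⟩
  obtain ⟨b, hb1, hb2, hb3⟩ := hb
  have h2A : 2 ∉ A := fun h => by simpa using hmA 2 h
  refine ⟨fun q' => a q' + if q' = q then
      pairSum L (insert 3 (insert 1 A.toFinset)) (mandelstamVar L) else 0,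
    fun q' => b q' + if q' = q then
      pairSum L (insert 3 (insert 2 B.toFinset)) (mandelstamVar L) else 0,
    fun q' => Submodule.add_mem _ (ha1 q') ?_, fun q' => Submodule.add_mem _ (hb1 q') ?_,
    fun σ => ?_, fun σ hσ q' => ?_, ?_⟩ <;> beta_reduce
  · split_ifs
    · exact pairSum_mem L _
    · exact Submodule.zero_mem _
  · split_ifs
    · exact pairSum_mem L _
    · exact Submodule.zero_mem _
  · rw [ha2 (Sum.inl σ) (by simp), zero_add]
    by_cases h : q = Sum.inl σ
    · rw [if_pos h.symm, if_pos h, pairSum, sMax]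
      have hB0 : B = [] := by rw [hB, h]; exact wordAtOne_inl L σ
      have hT : ∀ k ∈ Finset.Icc 1 L, k ∈ insert 3 (insert 1 A.toFinset) ↔ k ≠ 2 := by
        intro k hk
        have := hm k
        rw [hB0, List.append_nil] at this
        simp only [Finset.mem_insert, List.mem_toFinset, this]
        simp at hk ⊢
        omega
      have hI : ∀ k : ℕ, 1 ≤ k → ∀ f : ℕ → MvPolynomial (MandelstamIndex L) ℂ,
          ∑ j ∈ (Finset.Icc k L).erase 2, f j =
          ∑ j ∈ Finset.Icc k L, if j ∈ insert 3 (insert 1 A.toFinset) then f j else 0 := by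
        intro k hk f
        rw [← Finset.sum_filter]
        refine Finset.sum_congr ?_ fun _ _ => rfl
        ext j
        rw [Finset.mem_erase, Finset.mem_filter, and_comm, and_congr_right_iff]
        intro hj
        exact (hT j (by simp at hj ⊢; omega)).symm
      rw [hI 1 le_rfl]
      refine Finset.sum_congr rfl fun k hk => ?_
      rw [hI (k + 1) (by omega)]
      split_ifs with h'
      · simp [h']
      · simp [h']
    · rw [if_neg (Ne.symm h), if_neg h]
  · have hB0 : B = [] := by rw [hB, hσ]; exact wordAtOne_inl L σ
    rw [hb2 hB0, zero_add, hB0]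
    congr 1
    rw [pairSum, Finset.sum_eq_single 2, Finset.sum_eq_single 3]
    · simp
    · intro j hj hj'
      have : j ≠ 2 := by simp at hj; omega
      simp [hj', this]
    · simp; omega
    · intro j hj hj'
      refine Finset.sum_eq_zero fun k hk => if_neg ?_
      simp at hk ⊢
      omega
    · simp; omega
  · intro s X u x hx0 hx1 hinj h1 h2 h3 u1 u2 u3 hX
    have hroot : ∀ k ∈ A, rootPosition L q k = 0 := by
      intro k hk
      rw [rootPosition, if_neg]
      rintro (rfl | h)
      · exact h2A hk
      · rw [List.nodup_append] at hn
        exact hn.2.2 k hk k h rfl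
    have hroot' : ∀ k ∈ B, rootPosition L q k = 1 := fun k hk => if_pos (Or.inr hk)
    have hS := mandelstam_symm L s
    have hΛ := logDerivative_eq L hL A B hn hm (mandelstam L s) hS X u x hx0 hx1 hinj h1 h2 h3
      u1 u2 u3 (fun k hk => by rw [hX k (hmA k hk), hroot k hk]; ring)
      (fun k hk => by rw [hX k (hmB k hk), hroot' k hk])
    have hq := componentFactor_eq_wordForm L hL q (mandelstam L s) hS X h1
    have hsub : ∀ (r : ℕ) (l : List ℕ), r ∈ Finset.Icc 1 3 → (∀ k ∈ l, k ∈ Finset.Icc 4 L) →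
        l.Nodup → (r :: l).Nodup ∧ Set.InjOn X {k | k ∈ r :: l} := by
      intro r l hr hl hl'
      rw [Finset.mem_Icc] at hr
      refine ⟨List.nodup_cons.2 ⟨fun h => by have := hl r h; simp at this; omega, hl'⟩,
        hinj.mono fun k hk => ?_⟩
      rcases List.mem_cons.1 hk with rfl | hk
      · simp; omega
      · have := hl k hk; simp at this ⊢; omega
    obtain ⟨nA, iA⟩ := hsub 1 A (by simp) hmA (List.nodup_append.1 hn).1
    obtain ⟨nB, iB⟩ := hsub 2 B (by simp) hmB (List.nodup_append.1 hn).2.1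
    have cA := sum_displacement_mul_twoWords 1 2 (mandelstam L s) hS X A B nA iA
    have cB := sum_displacement_mul_twoWords 2 1 (mandelstam L s) hS X B A nB iB
    have ea := ha3 s X h1 h2 hinj
    have eb := hb3 s X h1 h2 hinj
    simp only [twoRootForm] at ea eb
    rw [← cA] at ea
    have eb' : ε * ((B.map (fun k => ((X k : ℂ) - (X 2 : ℂ)) *
        (propagator (mandelstam L s) X k 1 + (A.map (propagator (mandelstam L s) X k)).sum))).sum *
      (wordForm (fun k => propagator (mandelstam L s) X k 2) (propagator (mandelstam L s) X) B *
        wordForm (fun k => propagator (mandelstam L s) X k 1) (propagator (mandelstam L s) X) A)) =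
      ∑ q, MvPolynomial.eval s (b q) * componentFactor L q (mandelstam L s) X := by
      rw [cB, ← eb]
      congr 2
      refine List.map_congr_left fun p _ => congrArg List.sum (List.map_congr_left fun p' _ => ?_)
      ring
    have e0 : ∀ (g : ComponentIndex L → MvPolynomial (MandelstamIndex L) ℂ) (T : Finset ℕ),
        ∑ q', MvPolynomial.eval s (g q' + if q' = q then pairSum L T (mandelstamVar L) else 0) *
          componentFactor L q' (mandelstam L s) X =
        ∑ q', MvPolynomial.eval s (g q') * componentFactor L q' (mandelstam L s) X +
          pairSum L T (mandelstam L s) * componentFactor L q (mandelstam L s) X := by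
      intro g T
      simp_rw [map_add, add_mul, Finset.sum_add_distrib]
      congr 1
      rw [Finset.sum_eq_single q (fun q' _ h => by simp [h]) (by simp), if_pos rfl, eval_pairSum]
    simp_rw [add_mul, mul_assoc, Finset.sum_add_distrib, ← Finset.mul_sum]
    rw [e0 a, e0 b, ← ea, ← eb', hΛ, hq]
    ring

end LinearRows

/-! ### Continuation by zero and absolute integrability -/

section Integrability

open scoped ENNReal

/-- The power `t ^ z` of a positive real number, continued by zero. -/
noncomputable def posPow (t : ℝ) (z : ℂ) : ℂ := if 0 < t then (t : ℂ) ^ z else 0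

/-- The difference of two positions, with the sign that it has on the integration domain if
`k < m`. -/
def orderedDiff (X : ℕ → ℝ) (k m : ℕ) : ℝ := if k = 1 then X m - X k else X k - X m

/-- The Koba–Nielsen factor continued by zero from the integration domain. -/
noncomputable def cutKobaNielsen (L : ℕ) (S : ℕ → ℕ → ℂ) (X : ℕ → ℝ) : ℂ :=
  ∏ k ∈ Finset.Icc 1 L, ∏ m ∈ Finset.Icc (k + 1) L, posPow (orderedDiff X k m) (S k m)

theorem pointPosition_one (L : ℕ) (x : ℝ) (y : IntegratedLabel L → ℝ) :
    pointPosition L x y 1 = 0 := by simp [pointPosition]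

theorem pointPosition_two (L : ℕ) (x : ℝ) (y : IntegratedLabel L → ℝ) :
    pointPosition L x y 2 = 1 := by simp [pointPosition]

theorem pointPosition_three (L : ℕ) (x : ℝ) (y : IntegratedLabel L → ℝ) :
    pointPosition L x y 3 = x := by simp [pointPosition]

theorem pointPosition_coe (L : ℕ) (x : ℝ) (y : IntegratedLabel L → ℝ) (k : IntegratedLabel L) :
    pointPosition L x y k = y k := by
  rw [pointPosition, dif_pos k.2]

theorem pointPosition_of_mem (L : ℕ) (x : ℝ) (y : IntegratedLabel L → ℝ) {k : ℕ}
    (hk : k ∈ Finset.Icc 4 L) : pointPosition L x y k = y ⟨k, hk⟩ := dif_pos hk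

theorem abs_orderedDiff (X : ℕ → ℝ) (k m : ℕ) : |orderedDiff X k m| = |X k - X m| := by
  unfold orderedDiff
  split_ifs
  · exact abs_sub_comm _ _
  · rfl

theorem orderedDiff_nonneg_of_mem {L : ℕ} {x : ℝ} (hx0 : 0 < x) (hx1 : x < 1)
    {y : IntegratedLabel L → ℝ} (hy : y ∈ selbergDomain L x) {k m : ℕ} (hk : 1 ≤ k) (hkm : k < m)
    (hm : m ≤ L) : 0 ≤ orderedDiff (pointPosition L x y) k m := by
  obtain ⟨ha, hb⟩ := hy
  have h0 : ∀ j, 0 ≤ pointPosition L x y j := by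
    intro j; unfold pointPosition; split_ifs with h
    · exact (hb _).1
    · exact hx0.le
    · norm_num
    · exact le_rfl
  have h1 : ∀ j, pointPosition L x y j ≤ 1 := by
    intro j; unfold pointPosition; split_ifs with h
    · exact (hb _).2.trans hx1.le
    · exact hx1.le
    · norm_num
    · norm_num
  unfold orderedDiff
  split_ifs with h
  · subst h; rw [pointPosition_one]; simpa using h0 m
  · rcases (by omega : k = 2 ∨ k = 3 ∨ 4 ≤ k) with rfl | rfl | h4
    · rw [pointPosition_two]; linarith [h1 m]
    · rw [pointPosition_three, pointPosition_of_mem L x y (by simp; omega : m ∈ Finset.Icc 4 L)]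
      linarith [(hb ⟨m, by simp; omega⟩).2]
    · rw [pointPosition_of_mem L x y (by simp; omega : m ∈ Finset.Icc 4 L),
        pointPosition_of_mem L x y (by simp; omega : k ∈ Finset.Icc 4 L), sub_nonneg]
      exact ha (by exact hkm.le)

theorem mem_selbergDomain_of_orderedDiff_pos {L : ℕ} {x : ℝ} {y : IntegratedLabel L → ℝ}
    (h : ∀ k m, 1 ≤ k → k < m → m ≤ L → 0 < orderedDiff (pointPosition L x y) k m) :
    y ∈ selbergDomain L x := by
  constructor
  · intro a b hab
    rcases hab.eq_or_lt with rfl | hab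
    · exact le_rfl
    · have ha := Finset.mem_Icc.1 a.2
      have hb := Finset.mem_Icc.1 b.2
      have := h a b (by omega) hab hb.2
      rw [orderedDiff, if_neg (by omega), pointPosition_coe, pointPosition_coe] at this
      linarith
  · intro a
    have ha := Finset.mem_Icc.1 a.2
    have h1 := h 1 a le_rfl (by omega) ha.2
    have h3 := h 3 a (by omega) (by omega) ha.2
    rw [orderedDiff, if_pos rfl, pointPosition_coe, pointPosition_one] at h1
    rw [orderedDiff, if_neg (by omega), pointPosition_coe, pointPosition_three] at h3
    constructor <;> linarith

/-- On the domain the points are ordered 0 ≤ x_L ≤ ⋯ ≤ x_3 < 1, which fixes the sign of every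
`orderedDiff`. Off the domain some such difference is not positive, and on its boundary both sides
vanish because the exponents are not zero. -/
theorem indicator_kobaNielsen {L : ℕ} {x : ℝ} (hx0 : 0 < x) (hx1 : x < 1) {S : ℕ → ℕ → ℂ}
    (hS : ∀ k m, 1 ≤ k → k < m → m ≤ L → 0 < (S k m).re) (y : IntegratedLabel L → ℝ) :
    (selbergDomain L x).indicator (fun y => kobaNielsen L S (pointPosition L x y)) y =
      cutKobaNielsen L S (pointPosition L x y) := by
  by_cases hy : y ∈ selbergDomain L x
  · rw [Set.indicator_of_mem hy, kobaNielsen, cutKobaNielsen]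
    refine Finset.prod_congr rfl fun k hk => Finset.prod_congr rfl fun m hm => ?_
    rw [Finset.mem_Icc] at hk hm
    have h0 := orderedDiff_nonneg_of_mem hx0 hx1 hy hk.1 (by omega : k < m) hm.2
    rw [← abs_orderedDiff, abs_of_nonneg h0, posPow]
    split_ifs with h
    · rfl
    · rw [le_antisymm (not_lt.1 h) h0, Complex.ofReal_zero, Complex.zero_cpow]
      intro h'
      have := hS k m hk.1 (by omega) hm.2
      simp [h'] at this
  · rw [Set.indicator_of_notMem hy, cutKobaNielsen]
    by_contra h
    refine hy (mem_selbergDomain_of_orderedDiff_pos fun k m hk hkm hm => ?_)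
    have h1 := Finset.prod_ne_zero_iff.1 (Ne.symm h) k (by simp; omega)
    have h2 := Finset.prod_ne_zero_iff.1 h1 m (by simp; omega)
    by_contra h3
    exact h2 (if_neg h3)

theorem orderedDiff_pos_of_cutKobaNielsen_ne_zero {L : ℕ} {S : ℕ → ℕ → ℂ} {X : ℕ → ℝ}
    (h : cutKobaNielsen L S X ≠ 0) {k m : ℕ} (hk : 1 ≤ k) (hkm : k < m) (hm : m ≤ L) :
    0 < orderedDiff X k m := by
  have h1 := Finset.prod_ne_zero_iff.1 h k (by simp; omega)
  have h2 := Finset.prod_ne_zero_iff.1 h1 m (by simp; omega)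
  by_contra h3
  exact h2 (if_neg h3)

theorem injOn_of_orderedDiff_pos {L : ℕ} {X : ℕ → ℝ}
    (h : ∀ k m, 1 ≤ k → k < m → m ≤ L → 0 < orderedDiff X k m) :
    Set.InjOn X (Finset.Icc 1 L) := by
  have key : ∀ k m, 1 ≤ k → k < m → m ≤ L → X k ≠ X m := by
    intro k m hk hkm hm he
    have := h k m hk hkm hm
    have h' := abs_orderedDiff X k m
    rw [he, sub_self, abs_zero, abs_eq_zero] at h'
    exact this.ne' h'
  intro k hk m hm he
  simp only [Finset.coe_Icc, Set.mem_Icc] at hk hm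
  rcases lt_trichotomy k m with h' | h' | h'
  · exact absurd he (key k m hk.1 h' hm.2)
  · exact h'
  · exact absurd he.symm (key m k hm.1 h' hk.2)

theorem mem_Icc_of_orderedDiff_pos {L : ℕ} {X : ℕ → ℝ} (h1 : X 1 = 0)
    (h2 : X 2 = 1) (h : ∀ k m, 1 ≤ k → k < m → m ≤ L → 0 < orderedDiff X k m) {k : ℕ}
    (hk : k ∈ Finset.Icc 1 L) : X k ∈ Set.Icc (0 : ℝ) 1 := by
  rw [Finset.mem_Icc] at hk
  rcases (by omega : k = 1 ∨ k = 2 ∨ 3 ≤ k) with rfl | rfl | h3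
  · simp [h1]
  · simp [h2]
  · have a := h 1 k le_rfl (by omega) hk.2
    have b := h 2 k (by omega) (by omega) hk.2
    rw [orderedDiff, if_pos rfl] at a
    rw [orderedDiff, if_neg (by omega)] at b
    constructor <;> linarith

theorem prod_Icc_pairs {M : Type*} [CommMonoid M] (L : ℕ) (z : ℕ → ℕ → M) :
    ∏ k ∈ Finset.Icc 1 L, ∏ m ∈ Finset.Icc (k + 1) L, (z k m * z m k) =
      ∏ k ∈ Finset.Icc 1 L, ∏ m ∈ (Finset.Icc 1 L).erase k, z k m := by
  have h : ∀ k ∈ Finset.Icc 1 L, ∏ m ∈ (Finset.Icc 1 L).erase k, z k m =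
      (∏ m ∈ Finset.Icc (k + 1) L, z k m) * ∏ m ∈ Finset.Ico 1 k, z k m := by
    intro k hk
    rw [Finset.mem_Icc] at hk
    have : (Finset.Icc 1 L).erase k = Finset.Icc (k + 1) L ∪ Finset.Ico 1 k := by
      ext; simp; omega
    rw [this, Finset.prod_union]
    rw [Finset.disjoint_left]
    intro a; simp; omega
  rw [Finset.prod_congr rfl h, Finset.prod_mul_distrib]
  simp_rw [Finset.prod_mul_distrib]
  congr 1
  refine Finset.prod_comm' fun a b => ?_
  simp; omega

/-- All distances are at most 1, so exponents may be lowered to 2δ. Splitting them evenly gives each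
endpoint of a pair its own power δ, with which a label can pay for its propagator. -/
theorem enorm_cutKobaNielsen_le {L : ℕ} {δ : ℝ} {S : ℕ → ℕ → ℂ}
    (hS : ∀ k m, 1 ≤ k → k < m → m ≤ L → δ + δ ≤ (S k m).re) {X : ℕ → ℝ} (h1 : X 1 = 0)
    (h2 : X 2 = 1) (h : ∀ k m, 1 ≤ k → k < m → m ≤ L → 0 < orderedDiff X k m) :
    ‖cutKobaNielsen L S X‖ₑ ≤ ∏ k ∈ Finset.Icc 1 L, ∏ m ∈ (Finset.Icc 1 L).erase k,
      ENNReal.ofReal (|X k - X m| ^ δ) := by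
  have he : ∀ (T : Finset ℕ) (f : ℕ → ℂ), ‖∏ k ∈ T, f k‖ₑ = ∏ k ∈ T, ‖f k‖ₑ := by
    intro T f
    induction T using Finset.induction_on with
    | empty => simp
    | insert a T ha ih => rw [Finset.prod_insert ha, Finset.prod_insert ha, enorm_mul, ih]
  rw [← prod_Icc_pairs, cutKobaNielsen, he]
  refine Finset.prod_le_prod' fun k hk => ?_
  rw [he]
  refine Finset.prod_le_prod' fun m hm => ?_
  rw [Finset.mem_Icc] at hk hm
  have hpos := h k m hk.1 (by omega) hm.2
  have habs := abs_orderedDiff X k m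
  rw [abs_of_pos hpos] at habs
  rw [abs_sub_comm (X m), ← habs, posPow, if_pos hpos, ← ofReal_norm,
    Complex.norm_cpow_eq_rpow_re_of_pos hpos, ← ENNReal.ofReal_mul (by positivity),
    ← Real.rpow_add hpos]
  refine ENNReal.ofReal_le_ofReal (Real.rpow_le_rpow_of_exponent_ge hpos ?_
    (hS k m hk.1 (by omega) hm.2))
  rw [habs, abs_le]
  have a := mem_Icc_of_orderedDiff_pos h1 h2 h (Finset.mem_Icc.2 hk)
  have b := mem_Icc_of_orderedDiff_pos h1 h2 h
    (Finset.mem_Icc.2 ⟨by omega, hm.2⟩ : m ∈ Finset.Icc 1 L)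
  rw [Set.mem_Icc] at a b
  constructor <;> linarith

/-- The integrable singularity `|z| ^ (δ - 1)`. -/
noncomputable def singularity (δ z : ℝ) : ℝ≥0∞ := ENNReal.ofReal (|z| ^ (δ - 1))

/-- A majorant of the integrands: every letter of a word is attached to one of the points `0`, `1`
or to a later letter of the list. -/
noncomputable def wordMajorant {L : ℕ} (K : ℝ≥0∞) (δ : ℝ) :
    List (IntegratedLabel L) → (IntegratedLabel L → ℝ) → ℝ≥0∞
  | [], _ => 1
  | w :: t, y => K * ((Set.Icc (0 : ℝ) 1).indicator 1 (y w) *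
      (singularity δ (y w) + singularity δ (y w - 1) +
        (t.map (fun j => singularity δ (y w - y j))).sum)) * wordMajorant K δ t y

theorem measurable_singularity (δ : ℝ) : Measurable (singularity δ) := by
  unfold singularity
  fun_prop

theorem measurable_list_map_sum {α β : Type*} [MeasurableSpace α] (t : List β)
    {f : β → α → ℝ≥0∞} (hf : ∀ j, Measurable (f j)) :
    Measurable (fun y => (t.map (fun j => f j y)).sum) := by
  induction t with
  | nil => simp
  | cons a t ih =>
    simp only [List.map_cons, List.sum_cons]
    exact (hf a).add ih

theorem measurable_wordMajorant {L : ℕ} (K : ℝ≥0∞) (δ : ℝ) (l : List (IntegratedLabel L)) :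
    Measurable (wordMajorant K δ l) := by
  induction l with
  | nil => exact measurable_const
  | cons w t ih =>
    have h1 := measurable_singularity δ
    refine (measurable_const.mul (Measurable.mul ?_ ((Measurable.add ?_ ?_).add ?_))).mul ih
    · exact (measurable_const.indicator measurableSet_Icc).comp (measurable_pi_apply w)
    · exact h1.comp (measurable_pi_apply w)
    · exact h1.comp ((measurable_pi_apply w).sub_const 1)
    · exact measurable_list_map_sum t fun j =>
        h1.comp ((measurable_pi_apply w).sub (measurable_pi_apply j))

/-- Within distance 1 of `a` the integrand is dominated by a translate of one fixed integrable
function; farther away the singularity is at most 1. Hence the bound is uniform in `a`, which is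
essential for integrating variables successively. -/
theorem exists_lintegral_singularity_le {δ : ℝ} (hδ : 0 < δ) (hδ1 : δ ≤ 1) :
    ∃ C : ℝ≥0∞, C ≠ ∞ ∧ ∀ a : ℝ,
      ∫⁻ z, (Set.Icc (0 : ℝ) 1).indicator 1 z * singularity δ (z - a) ≤ C := by
  have hint : IntegrableOn (fun z : ℝ => |z| ^ (δ - 1)) (Set.Ioc (-1) 1) := by
    have h0 : IntervalIntegrable (fun z : ℝ => |z| ^ (δ - 1)) volume 0 1 := by
      refine (intervalIntegral.intervalIntegrable_rpow' (by linarith : -1 < δ - 1)).congr ?_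
      intro z hz
      rw [Set.uIoc_of_le zero_le_one] at hz
      simp only [abs_of_pos hz.1]
    have h1 : IntervalIntegrable (fun z : ℝ => |z| ^ (δ - 1)) volume (-1) 0 := by
      have := (IntervalIntegrable.iff_comp_neg).1 h0
      simpa using this.symm
    exact (intervalIntegrable_iff_integrableOn_Ioc_of_le (by norm_num)).1 (h1.trans h0)
  set g : ℝ → ℝ≥0∞ := (Set.Ioc (-1 : ℝ) 1).indicator (singularity δ) with hg
  have hgm : Measurable g := (measurable_singularity δ).indicator measurableSet_Ioc
  have hgf : ∫⁻ z, g z ≠ ∞ := by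
    rw [hg, lintegral_indicator measurableSet_Ioc]
    exact hint.lintegral_lt_top.ne
  refine ⟨(∫⁻ z, g z) + 1, ENNReal.add_ne_top.2 ⟨hgf, ENNReal.one_ne_top⟩, fun a => ?_⟩
  calc ∫⁻ z, (Set.Icc (0 : ℝ) 1).indicator 1 z * singularity δ (z - a)
      ≤ ∫⁻ z, (g (z - a) + (Set.Icc (0 : ℝ) 1).indicator 1 z) := by
        refine lintegral_mono fun z => ?_
        by_cases h : z - a ∈ Set.Ioc (-1 : ℝ) 1
        · rw [hg, Set.indicator_of_mem h]
          refine le_add_right ?_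
          calc _ ≤ 1 * singularity δ (z - a) :=
                mul_le_mul_left (Set.indicator_le_self' (fun _ _ => zero_le) z) _
            _ = _ := one_mul _
        · refine le_add_left ?_
          calc _ ≤ (Set.Icc (0 : ℝ) 1).indicator (1 : ℝ → ℝ≥0∞) z * 1 := by
                refine mul_le_mul_right ?_ _
                rw [singularity, ENNReal.ofReal_le_one]
                refine Real.rpow_le_one_of_one_le_of_nonpos ?_ (by linarith)
                rw [Set.mem_Ioc, not_and_or, not_lt, not_le] at h
                rcases h with h | h
                · exact (le_neg_of_le_neg h).trans (neg_le_abs _)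
                · exact h.le.trans (le_abs_self _)
            _ = _ := mul_one _
    _ = (∫⁻ z, g z) + 1 := by
        have hga : Measurable fun z => g (z - a) := hgm.comp (measurable_id.sub_const a)
        rw [lintegral_add_left hga,
          lintegral_sub_right_eq_self g a, lintegral_indicator_one measurableSet_Icc]
        simp

theorem wordMajorant_update {L : ℕ} (K : ℝ≥0∞) (δ : ℝ) {t : List (IntegratedLabel L)}
    {w : IntegratedLabel L} (hw : w ∉ t) (y : IntegratedLabel L → ℝ) (z : ℝ) :
    wordMajorant K δ t (Function.update y w z) = wordMajorant K δ t y := by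
  induction t with
  | nil => rfl
  | cons v t ih =>
    rw [List.mem_cons, not_or] at hw
    rw [wordMajorant, wordMajorant, ih hw.2, Function.update_of_ne (Ne.symm hw.1)]
    congr 5
    refine List.map_congr_left fun j hj => ?_
    rw [Function.update_of_ne (by rintro rfl; exact hw.2 hj)]

/-- The first letter occurs only in its own factor, so it is integrated first with all other
variables fixed. Each letter has at most `l.length + 2` possible attachments. -/
theorem lmarginal_wordMajorant_le {L : ℕ} {K C : ℝ≥0∞} {δ : ℝ}
    (hC : ∀ a : ℝ, ∫⁻ z, (Set.Icc (0 : ℝ) 1).indicator 1 z * singularity δ (z - a) ≤ C)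
    (l : List (IntegratedLabel L)) (hl : l.Nodup) (y : IntegratedLabel L → ℝ) :
    (∫⋯∫⁻_l.toFinset, wordMajorant K δ l ∂(fun _ => volume)) y ≤
      (l.map fun _ => K * (C * (l.length + 2))).prod := by
  -- A fixed `M` keeps the constant unchanged while the word becomes shorter.
  suffices h : ∀ M : ℕ, l.length ≤ M →
      (∫⋯∫⁻_l.toFinset, wordMajorant K δ l ∂(fun _ => volume)) y ≤
      (l.map fun _ => K * (C * (M + 2))).prod from h l.length le_rfl
  intro M hM
  induction l generalizing y with
  | nil => simp [wordMajorant]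
  | cons w t ih =>
    obtain ⟨hw, ht⟩ := List.nodup_cons.1 hl
    rw [List.length_cons] at hM
    have hw' : w ∉ t.toFinset := by simpa using hw
    rw [List.toFinset_cons, lmarginal_insert' _ (measurable_wordMajorant K δ _) hw']
    have hstep : ∀ y : IntegratedLabel L → ℝ,
        ∫⁻ z, wordMajorant K δ (w :: t) (Function.update y w z) ≤
          K * (C * (M + 2)) * wordMajorant K δ t y := by
      intro y
      have e : ∀ z, wordMajorant K δ (w :: t) (Function.update y w z) =
          (K * (((Set.Icc (0 : ℝ) 1).indicator 1 z * singularity δ (z - 0) +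
            (Set.Icc (0 : ℝ) 1).indicator 1 z * singularity δ (z - 1)) +
            (t.map (fun j => (Set.Icc (0 : ℝ) 1).indicator 1 z *
              singularity δ (z - y j))).sum)) * wordMajorant K δ t y := by
        intro z
        rw [wordMajorant, wordMajorant_update K δ hw, Function.update_self, List.sum_map_mul_left,
          ← mul_add, ← mul_add, sub_zero]
        congr 5
        refine List.map_congr_left fun j hj => ?_
        rw [Function.update_of_ne (by rintro rfl; exact hw hj)]
      have hm : ∀ a : ℝ, Measurable fun z : ℝ =>
          (Set.Icc (0 : ℝ) 1).indicator (1 : ℝ → ℝ≥0∞) z * singularity δ (z - a) := fun a =>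
        (measurable_const.indicator measurableSet_Icc).mul
          ((measurable_singularity δ).comp (measurable_id.sub_const a))
      have hsum : ∀ t : List (IntegratedLabel L),
          ∫⁻ z, (t.map (fun j => (Set.Icc (0 : ℝ) 1).indicator 1 z *
              singularity δ (z - y j))).sum ≤ C * t.length := by
        intro t
        induction t with
        | nil => simp
        | cons a t iht =>
          simp only [List.map_cons, List.sum_cons, List.length_cons, Nat.cast_add, Nat.cast_one]
          rw [lintegral_add_left (hm _), mul_add, mul_one, add_comm]
          exact add_le_add iht (hC _)
      simp_rw [e]
      rw [lintegral_mul_const, lintegral_const_mul]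
      · have h01 : Measurable fun z : ℝ =>
            (Set.Icc (0 : ℝ) 1).indicator (1 : ℝ → ℝ≥0∞) z * singularity δ (z - 0) +
            (Set.Icc (0 : ℝ) 1).indicator (1 : ℝ → ℝ≥0∞) z * singularity δ (z - 1) :=
          (hm 0).add (hm 1)
        rw [lintegral_add_left h01, lintegral_add_left (hm 0)]
        gcongr
        calc _ ≤ C + C + C * t.length := add_le_add (add_le_add (hC 0) (hC 1)) (hsum t)
          _ = C * (t.length + 2) := by ring
          _ ≤ C * (M + 2) := by gcongr; omega
      · exact ((hm 0).add (hm 1)).add (measurable_list_map_sum t fun j => hm _)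
      · exact (((hm 0).add (hm 1)).add (measurable_list_map_sum t fun j => hm _)).const_mul K
    refine (lmarginal_mono hstep y).trans ?_
    have : (∫⋯∫⁻_t.toFinset, (fun y => K * (C * (M + 2)) * wordMajorant K δ t y)
        ∂(fun _ => volume)) y = K * (C * (M + 2)) *
        (∫⋯∫⁻_t.toFinset, wordMajorant K δ t ∂(fun _ => volume)) y := by
      unfold lmarginal
      rw [lintegral_const_mul]
      exact (measurable_wordMajorant K δ t).comp measurable_updateFinset
    rw [this, List.map_cons, List.prod_cons]
    gcongr
    exact ih ht y (by omega)

theorem lintegral_wordMajorant_lt_top {L : ℕ} {K : ℝ≥0∞} (hK : K ≠ ∞) {δ : ℝ} (hδ : 0 < δ)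
    (hδ1 : δ ≤ 1) (l : List (IntegratedLabel L)) (hl : l.Nodup) (hl' : ∀ k, k ∈ l) :
    ∫⁻ y, wordMajorant K δ l y < ∞ := by
  obtain ⟨C, hC, h⟩ := exists_lintegral_singularity_le hδ hδ1
  have huniv : l.toFinset = Finset.univ := by ext; simp [hl']
  have := lmarginal_wordMajorant_le (K := K) h l hl 0
  rw [huniv, ← lintegral_eq_lmarginal_univ] at this
  refine lt_of_le_of_lt this ?_
  rw [List.map_const', List.prod_replicate]
  refine ENNReal.pow_lt_top (ENNReal.mul_lt_top hK.lt_top (ENNReal.mul_lt_top hC.lt_top ?_))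
  exact_mod_cast ENNReal.natCast_lt_top (l.length + 2)

/-- The share of `w` in the pair `w`, `j` softens the pole to |x_w - x_j|^(δ - 1); its other shares
are at most 1. -/
theorem prod_mul_enorm_propagator_le {L : ℕ} {δ : ℝ} (hδ : 0 < δ) {S : ℕ → ℕ → ℂ} {K : ℝ≥0∞}
    (hK : ∀ k m, ‖S k m‖ₑ ≤ K) {X : ℕ → ℝ} (h1 : X 1 = 0)
    (h2 : X 2 = 1) (h : ∀ k m, 1 ≤ k → k < m → m ≤ L → 0 < orderedDiff X k m) {w j : ℕ}
    (hw : w ∈ Finset.Icc 1 L) (hj : j ∈ Finset.Icc 1 L) (hwj : w ≠ j) :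
    (∏ m ∈ (Finset.Icc 1 L).erase w, ENNReal.ofReal (|X w - X m| ^ δ)) * ‖propagator S X w j‖ₑ ≤
      K * singularity δ (X w - X j) := by
  have hle : ∀ m ∈ (Finset.Icc 1 L).erase w, ENNReal.ofReal (|X w - X m| ^ δ) ≤ 1 := by
    intro m hm
    have a := mem_Icc_of_orderedDiff_pos h1 h2 h hw
    have b := mem_Icc_of_orderedDiff_pos h1 h2 h (Finset.mem_of_mem_erase hm)
    rw [ENNReal.ofReal_le_one]
    refine Real.rpow_le_one (abs_nonneg _) ?_ hδ.le
    rw [Set.mem_Icc] at a b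
    rw [abs_le]
    constructor <;> linarith
  have hj' : j ∈ (Finset.Icc 1 L).erase w := Finset.mem_erase.2 ⟨hwj.symm, hj⟩
  have hne : 0 < |X w - X j| :=
    abs_pos.2 (sub_ne_zero.2 fun e => hwj (injOn_of_orderedDiff_pos h hw hj e))
  rw [← Finset.mul_prod_erase _ _ hj']
  calc _ ≤ ENNReal.ofReal (|X w - X j| ^ δ) * 1 * ‖propagator S X w j‖ₑ := by
        gcongr
        exact Finset.prod_le_one' fun m hm => hle m (Finset.mem_of_mem_erase hm)
    _ = ‖S w j‖ₑ * singularity δ (X w - X j) := by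
        rw [mul_one, propagator, ← ofReal_norm, norm_div, Complex.norm_real, Real.norm_eq_abs,
          ← ofReal_norm, singularity, ← ENNReal.ofReal_mul (by positivity),
          ← ENNReal.ofReal_mul (by positivity), Real.rpow_sub_one hne.ne']
        congr 1
        ring
    _ ≤ _ := by gcongr; exact hK w j

/-- Each letter of `A` spends its own share once. The majorant of `A ++ B` also allows attachments
to letters of `B`, so the two word forms can be bounded in succession by a single majorant. -/
theorem prod_mul_enorm_wordForm_le {L : ℕ} {δ : ℝ} (hδ : 0 < δ) {S : ℕ → ℕ → ℂ} {K : ℝ≥0∞}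
    (hK : ∀ k m, ‖S k m‖ₑ ≤ K) {x : ℝ} {y : IntegratedLabel L → ℝ}
    (h : ∀ k m, 1 ≤ k → k < m → m ≤ L → 0 < orderedDiff (pointPosition L x y) k m) {r : ℕ}
    (hr : r = 1 ∨ r = 2) (A B : List (IntegratedLabel L)) (hA : A.Nodup) :
    (A.map (fun w : IntegratedLabel L => ∏ m ∈ (Finset.Icc 1 L).erase (w : ℕ),
        ENNReal.ofReal (|pointPosition L x y w - pointPosition L x y m| ^ δ))).prod *
      ‖wordForm (fun k => propagator S (pointPosition L x y) k r)
        (propagator S (pointPosition L x y)) (A.map Subtype.val)‖ₑ * wordMajorant K δ B y ≤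
      wordMajorant K δ (A ++ B) y := by
  set X := pointPosition L x y with hX
  have hX1 : X 1 = 0 := pointPosition_one L x y
  have hX2 : X 2 = 1 := pointPosition_two L x y
  induction A with
  | nil => simp [wordForm]
  | cons w t ih =>
    obtain ⟨hw, ht⟩ := List.nodup_cons.1 hA
    have hwL := Finset.mem_Icc.1 w.2
    have hwI : (w : ℕ) ∈ Finset.Icc 1 L := by simp; omega
    set P := ∏ m ∈ (Finset.Icc 1 L).erase (w : ℕ), ENNReal.ofReal (|X w - X m| ^ δ) with hP
    have hroot : P * ‖propagator S X w r‖ₑ ≤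
        K * (singularity δ (y w) + singularity δ (y w - 1)) := by
      refine (prod_mul_enorm_propagator_le hδ hK hX1 hX2 h hwI
        (by rw [Finset.mem_Icc]; omega : r ∈ Finset.Icc 1 L) (by omega)).trans ?_
      gcongr
      rw [hX, pointPosition_coe]
      rcases hr with rfl | rfl
      · rw [pointPosition_one, sub_zero]; exact le_self_add
      · rw [pointPosition_two]; exact le_add_self
    have hsum : ∀ t : List (IntegratedLabel L), w ∉ t →
        P * ‖((t.map Subtype.val).map (propagator S X w)).sum‖ₑ ≤
          K * (t.map (fun j => singularity δ (y w - y j))).sum := by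
      intro t ht
      induction t with
      | nil => simp
      | cons a t iht =>
        rw [List.mem_cons, not_or] at ht
        simp only [List.map_cons, List.sum_cons]
        calc _ ≤ P * (‖propagator S X w a‖ₑ +
              ‖((t.map Subtype.val).map (propagator S X w)).sum‖ₑ) := by
              gcongr; exact enorm_add_le _ _
          _ ≤ _ := by
              rw [mul_add, mul_add]
              refine add_le_add ?_ (iht ht.2)
              have haL := Finset.mem_Icc.1 a.2
              have := prod_mul_enorm_propagator_le hδ hK hX1 hX2 h hwI
                (by rw [Finset.mem_Icc]; omega : (a : ℕ) ∈ Finset.Icc 1 L)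
                (fun e => ht.1 (Subtype.ext e))
              refine this.trans_eq ?_
              rw [hX, pointPosition_coe, pointPosition_coe]
    have hsum' : (t.map (fun j => singularity δ (y w - y j))).sum ≤
        ((t ++ B).map (fun j => singularity δ (y w - y j))).sum := by
      rw [List.map_append, List.sum_append]
      exact le_self_add
    have hone : (Set.Icc (0 : ℝ) 1).indicator (1 : ℝ → ℝ≥0∞) (y w) = 1 := by
      rw [Set.indicator_of_mem]
      · rfl
      · have := mem_Icc_of_orderedDiff_pos hX1 hX2 h hwI
        rwa [hX, pointPosition_coe] at this
    rw [List.map_cons, List.map_cons, List.prod_cons, wordForm, enorm_mul, List.cons_append,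
      wordMajorant, hone, one_mul]
    calc _ = (P * ‖propagator S X w r + ((t.map Subtype.val).map (propagator S X w)).sum‖ₑ) *
          ((t.map (fun w : IntegratedLabel L => ∏ m ∈ (Finset.Icc 1 L).erase (w : ℕ),
            ENNReal.ofReal (|X w - X m| ^ δ))).prod *
            ‖wordForm (fun k => propagator S X k r) (propagator S X) (t.map Subtype.val)‖ₑ *
            wordMajorant K δ B y) := by ring
      _ ≤ _ := by
          refine mul_le_mul' ?_ (ih ht)
          calc _ ≤ P * (‖propagator S X w r‖ₑ +
                ‖((t.map Subtype.val).map (propagator S X w)).sum‖ₑ) := by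
                gcongr; exact enorm_add_le _ _
            _ ≤ _ := by
                rw [mul_add, mul_add]
                refine add_le_add hroot ((hsum t hw).trans ?_)
                gcongr

instance finite_mandelstamIndex (L : ℕ) : Finite (MandelstamIndex L) := by
  have : {p : ℕ × ℕ | 1 ≤ p.1 ∧ p.1 < p.2 ∧ p.2 ≤ L}.Finite := by
    refine ((Finset.range (L + 1)) ×ˢ (Finset.range (L + 1))).finite_toSet.subset ?_
    rintro ⟨i, j⟩ h
    simp at h ⊢
    omega
  exact this.to_subtype

noncomputable instance fintypeMandelstamIndex (L : ℕ) : Fintype (MandelstamIndex L) :=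
  Fintype.ofFinite _

/-- The constant does not depend on x: the majorant does not contain it, and the continued integrand
vanishes identically unless 0 < x < 1. This uniformity is used for Fubini. -/
theorem exists_lintegral_integrand_le {L : ℕ} (hL : 4 ≤ L) (s : MandelstamIndex L → ℂ)
    (hs : ∀ p, 0 < (s p).re) (q : ComponentIndex L) :
    ∃ C : ℝ≥0∞, C ≠ ∞ ∧ ∀ x : ℝ,
      ∫⁻ y, ‖cutKobaNielsen L (mandelstam L s) (pointPosition L x y) *
        componentFactor L q (mandelstam L s) (pointPosition L x y)‖ₑ ≤ C := by
  obtain ⟨δ, hδ, hδ1, hδs⟩ : ∃ δ : ℝ, 0 < δ ∧ δ ≤ 1 ∧ ∀ p, δ + δ ≤ (s p).re := by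
    have : Nonempty (MandelstamIndex L) := ⟨⟨(1, 2), by omega⟩⟩
    obtain ⟨p, hp⟩ := Finite.exists_min (fun p => (s p).re)
    refine ⟨min 1 ((s p).re / 2), lt_min one_pos (half_pos (hs p)), min_le_left _ _, fun p' => ?_⟩
    have := min_le_right 1 ((s p).re / 2)
    linarith [hp p']
  have hK : ∃ K : ℝ≥0∞, K ≠ ∞ ∧ ∀ k m, ‖mandelstam L s k m‖ₑ ≤ K := by
    refine ⟨∑ p, ‖s p‖ₑ, (ENNReal.sum_lt_top.2 fun p _ => enorm_lt_top).ne, fun k m => ?_⟩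
    unfold mandelstam
    split_ifs
    · exact Finset.single_le_sum (f := fun p => ‖s p‖ₑ) (fun _ _ => zero_le) (Finset.mem_univ _)
    · exact Finset.single_le_sum (f := fun p => ‖s p‖ₑ) (fun _ _ => zero_le) (Finset.mem_univ _)
    · simp
  obtain ⟨K, hKt, hK⟩ := hK
  obtain ⟨hn, hm⟩ := perm_words L hL q
  obtain ⟨A, hA⟩ : ∃ A : List (IntegratedLabel L), A.map Subtype.val =
      wordAtZero L (componentLevel L q) (componentPerm L q) := by
    have : CanLift (List ℕ) (List (IntegratedLabel L)) (List.map Subtype.val) _ := List.canLift _ _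
    exact CanLift.prf (wordAtZero L (componentLevel L q) (componentPerm L q))
      fun k hk => (hm k).1 (by simp [hk])
  obtain ⟨B, hB⟩ : ∃ B : List (IntegratedLabel L), B.map Subtype.val =
      wordAtOne L (componentLevel L q) (componentPerm L q) := by
    have : CanLift (List ℕ) (List (IntegratedLabel L)) (List.map Subtype.val) _ := List.canLift _ _
    exact CanLift.prf (wordAtOne L (componentLevel L q) (componentPerm L q))
      fun k hk => (hm k).1 (by simp [hk])
  rw [← hA, ← hB, ← List.map_append] at hn hm
  have hABn : (A ++ B).Nodup := List.Nodup.of_map _ hn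
  have hABm : ∀ k, k ∈ A ++ B := by
    intro k
    obtain ⟨k', hk', e⟩ := List.mem_map.1 ((hm k).2 k.2)
    rwa [← Subtype.ext e]
  refine ⟨_, (lintegral_wordMajorant_lt_top hKt hδ hδ1 (A ++ B) hABn hABm).ne, fun x => ?_⟩
  refine lintegral_mono fun y => ?_
  set X := pointPosition L x y with hX
  have hX1 : X 1 = 0 := pointPosition_one L x y
  have hX2 : X 2 = 1 := pointPosition_two L x y
  by_cases h0 : cutKobaNielsen L (mandelstam L s) X = 0
  · simp [h0]
  have hpos : ∀ k m, 1 ≤ k → k < m → m ≤ L → 0 < orderedDiff X k m := fun k m a b c =>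
    orderedDiff_pos_of_cutKobaNielsen_ne_zero h0 a b c
  set P : ℕ → ℝ≥0∞ := fun w => ∏ m ∈ (Finset.Icc 1 L).erase w, ENNReal.ofReal (|X w - X m| ^ δ)
    with hP
  have hKN : ‖cutKobaNielsen L (mandelstam L s) X‖ₑ ≤
      (A.map (fun w : IntegratedLabel L => P w)).prod * (B.map (fun w : IntegratedLabel L => P w)).prod := by
    refine (enorm_cutKobaNielsen_le (δ := δ) (fun k m a b c => ?_) hX1 hX2 hpos).trans ?_
    · rw [mandelstam, dif_pos ⟨a, b, c⟩]
      exact hδs _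
    · rw [← List.prod_append, ← List.map_append, ← List.prod_toFinset _ hABn]
      have huniv : (A ++ B).toFinset = Finset.univ := by ext k; simpa using hABm k
      rw [huniv, Finset.univ_eq_attach, Finset.prod_attach (Finset.Icc 4 L) P]
      -- Only the shares of the integrated labels are needed; those of 1, 2, 3 are at most 1.
      refine Finset.prod_le_prod_of_subset_of_le_one' (f := P) (fun k hk => ?_) fun k hk _ => ?_
      · simp at hk ⊢; omega
      · refine Finset.prod_le_one' fun m hm => ?_
        have a := mem_Icc_of_orderedDiff_pos hX1 hX2 hpos hk
        have b := mem_Icc_of_orderedDiff_pos hX1 hX2 hpos (Finset.mem_of_mem_erase hm)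
        rw [ENNReal.ofReal_le_one]
        refine Real.rpow_le_one (abs_nonneg _) ?_ hδ.le
        rw [Set.mem_Icc] at a b
        rw [abs_le]
        constructor <;> linarith
  have hBn : B.Nodup := (List.nodup_append.1 hABn).2.1
  have hAn : A.Nodup := (List.nodup_append.1 hABn).1
  have bB := prod_mul_enorm_wordForm_le hδ hK hpos (Or.inr rfl) B [] hBn
  have bA := prod_mul_enorm_wordForm_le hδ hK hpos (Or.inl rfl) A B hAn
  rw [List.append_nil, wordMajorant, mul_one] at bB
  rw [componentFactor_eq_wordForm L hL q _ (mandelstam_symm L s) X hX1, ← hA, ← hB, enorm_mul,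
    enorm_mul, enorm_mul]
  have hε : ‖((-1 : ℂ)) ^ (componentLevel L q - 4)‖ₑ = 1 := by
    rw [← ofReal_norm]; simp
  rw [hε, one_mul]
  refine le_trans ?_ (le_trans (mul_le_mul_right bB _) bA)
  calc _ ≤ ((A.map (fun w : IntegratedLabel L => P w)).prod * (B.map (fun w : IntegratedLabel L => P w)).prod) * _ :=
        mul_le_mul_left hKN _
    _ = _ := by simp only [hP]; ring

end Integrability

/-! ### The rescaling of the integration variables -/

section Scaling

open scoped ENNReal

theorem measurable_posPow (z : ℂ) : Measurable (fun t => posPow t z) := by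
  unfold posPow
  refine Measurable.ite measurableSet_Ioi ?_ measurable_const
  exact Complex.measurable_ofReal.pow_const z

theorem continuous_posPow {z : ℂ} (hz : 0 < z.re) : Continuous (fun t => posPow t z) := by
  have : (fun t => posPow t z) = fun t => ((max t 0 : ℝ) : ℂ) ^ z := by
    funext t
    unfold posPow
    split_ifs with h
    · rw [max_eq_left h.le]
    · rw [max_eq_right (not_lt.1 h), Complex.ofReal_zero, Complex.zero_cpow]
      rintro rfl
      simp at hz
  rw [this]
  exact (Complex.continuous_ofReal_cpow_const hz).comp (continuous_id.max continuous_const)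

/-- A negative base gives a locally constant zero. A zero of `l` at `x` must be excluded unless `l`
vanishes identically, as it does for a pair of equal labels. -/
theorem hasDerivAt_posPow {z : ℂ} (hz : z ≠ 0) {l : ℝ → ℝ} {b x : ℝ} (hl : HasDerivAt l b x)
    (h : l x ≠ 0 ∨ ∀ t, l t = 0) :
    HasDerivAt (fun t => posPow (l t) z) (posPow (l x) z * (z * ((b / l x : ℝ) : ℂ))) x := by
  rcases h with h | h
  · rcases h.lt_or_gt with h | h
    · have e : (fun t => posPow (l t) z) =ᶠ[nhds x] fun _ => 0 := by
        filter_upwards [hl.continuousAt.eventually_lt continuousAt_const h] with t ht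
        exact if_neg ht.le.not_gt
      rw [posPow, if_neg h.le.not_gt, zero_mul]
      exact (hasDerivAt_const x (0 : ℂ)).congr_of_eventuallyEq e
    · have e : (fun t => posPow (l t) z) =ᶠ[nhds x] fun t => (l t : ℂ) ^ z := by
        filter_upwards [continuousAt_const.eventually_lt hl.continuousAt h] with t ht
        exact if_pos ht
      refine HasDerivAt.congr_of_eventuallyEq ?_ e
      have h1 := (hasDerivAt_ofReal_cpow_const (r := z) h.ne' hz).scomp x hl
      refine h1.congr_deriv ?_
      have h' : (l x : ℂ) ≠ 0 := by exact_mod_cast h.ne'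
      rw [posPow, if_pos h, Complex.cpow_sub _ _ h', Complex.cpow_one, Complex.real_smul]
      push_cast
      field_simp
  · simpa [posPow, h] using hasDerivAt_const x (0 : ℂ)

/-- The multiplicative form of the hypothesis replaces division by `f i`, which may vanish after the
continuation by zero. -/
theorem hasDerivAt_prod_of_logDeriv {ι : Type*} (T : Finset ι) (f : ι → ℝ → ℂ) (c : ι → ℂ) (x : ℝ)
    (h : ∀ i ∈ T, HasDerivAt (f i) (f i x * c i) x) :
    HasDerivAt (fun t => ∏ i ∈ T, f i t) ((∏ i ∈ T, f i x) * ∑ i ∈ T, c i) x := by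
  classical
  induction T using Finset.induction_on with
  | empty => simpa using hasDerivAt_const x (1 : ℂ)
  | insert a T ha ih =>
    simp_rw [Finset.prod_insert ha, Finset.sum_insert ha]
    refine ((h a (by simp)).mul (ih fun i hi => h i (by simp [hi]))).congr_deriv ?_
    ring

theorem hasDerivAt_orderedDiff {X : ℝ → ℕ → ℝ} {u : ℕ → ℝ} {x : ℝ}
    (hX : ∀ k, HasDerivAt (fun t => X t k) (u k) x) (k m : ℕ) :
    HasDerivAt (fun t => orderedDiff (X t) k m) (orderedDiff u k m) x := by
  unfold orderedDiff
  split_ifs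
  · exact (hX m).sub (hX k)
  · exact (hX k).sub (hX m)

theorem orderedDiff_div (X u : ℕ → ℝ) (k m : ℕ) :
    orderedDiff u k m / orderedDiff X k m = (u k - u m) / (X k - X m) := by
  unfold orderedDiff
  split_ifs
  · rw [← neg_sub (u k), ← neg_sub (X k), neg_div_neg_eq]
  · rfl

theorem hasDerivAt_cutKobaNielsen {L : ℕ} {S : ℕ → ℕ → ℂ}
    (hS : ∀ k m, 1 ≤ k → k < m → m ≤ L → 0 < (S k m).re) {X : ℝ → ℕ → ℝ} {u : ℕ → ℝ} {x : ℝ}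
    (hX : ∀ k, HasDerivAt (fun t => X t k) (u k) x)
    (h : ∀ k m, orderedDiff (X x) k m ≠ 0 ∨ ∀ t, orderedDiff (X t) k m = 0) :
    HasDerivAt (fun t => cutKobaNielsen L S (X t))
      (cutKobaNielsen L S (X x) * logDerivative L S (X x) u) x := by
  unfold cutKobaNielsen logDerivative
  refine hasDerivAt_prod_of_logDeriv _ (fun k t => ∏ m ∈ Finset.Icc (k + 1) L,
    posPow (orderedDiff (X t) k m) (S k m)) _ x fun k hk => ?_
  refine hasDerivAt_prod_of_logDeriv _ (fun m t => posPow (orderedDiff (X t) k m) (S k m)) _ x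
    fun m hm => ?_
  rw [Finset.mem_Icc] at hk hm
  have hS' := hS k m hk.1 (by omega) hm.2
  rw [← orderedDiff_div]
  exact hasDerivAt_posPow (fun h0 => by simp [h0] at hS') (hasDerivAt_orderedDiff hX k m) (h k m)

section Measurability

variable {α : Type*} [MeasurableSpace α] {X : α → ℕ → ℝ}

theorem measurable_orderedDiff (hX : ∀ k, Measurable fun a => X a k) (k m : ℕ) :
    Measurable fun a => orderedDiff (X a) k m := by
  unfold orderedDiff
  split_ifs
  · exact (hX m).sub (hX k)
  · exact (hX k).sub (hX m)

theorem measurable_cutKobaNielsen (L : ℕ) (S : ℕ → ℕ → ℂ) (hX : ∀ k, Measurable fun a => X a k) :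
    Measurable fun a => cutKobaNielsen L S (X a) := by
  unfold cutKobaNielsen
  exact Finset.measurable_prod _ fun k _ => Finset.measurable_prod _ fun m _ =>
    (measurable_posPow _).comp (measurable_orderedDiff hX k m)

theorem measurable_logDerivative (L : ℕ) (S : ℕ → ℕ → ℂ) {u : α → ℕ → ℝ}
    (hX : ∀ k, Measurable fun a => X a k) (hu : ∀ k, Measurable fun a => u a k) :
    Measurable fun a => logDerivative L S (X a) (u a) := by
  unfold logDerivative
  exact Finset.measurable_sum _ fun k _ => Finset.measurable_sum _ fun m _ =>
    (Complex.measurable_ofReal.comp (((hu k).sub (hu m)).div ((hX k).sub (hX m)))).const_mul _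

theorem measurable_componentFactor (L : ℕ) (q : ComponentIndex L) (S : ℕ → ℕ → ℂ)
    (hX : ∀ k, Measurable fun a => X a k) :
    Measurable fun a => componentFactor L q S (X a) := by
  have hc := Complex.measurable_ofReal
  unfold componentFactor rationalFactor
  refine Measurable.mul ?_ ?_
  · refine Finset.measurable_prod _ fun k _ => Measurable.add ?_ ?_
    · exact (hc.comp (hX _)).const_div _
    · exact Finset.measurable_sum _ fun j _ => (hc.comp ((hX _).sub (hX _))).const_div _
  · exact Finset.measurable_prod _ fun m _ => Finset.measurable_sum _ fun n _ =>
      (hc.comp ((hX _).sub (hX _))).const_div _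

theorem measurable_pointPosition (L : ℕ) {x : α → ℝ} {y : α → IntegratedLabel L → ℝ}
    (hx : Measurable x) (hy : Measurable y) (k : ℕ) :
    Measurable fun a => pointPosition L (x a) (y a) k := by
  unfold pointPosition
  split_ifs
  · exact (measurable_pi_apply _).comp hy
  · exact hx
  · exact measurable_const
  · exact measurable_const

end Measurability

/-- The rescaling of the integration variables adapted to a component. -/
noncomputable def scaledPoint (L : ℕ) (q : ComponentIndex L) (x : ℝ) (u : IntegratedLabel L → ℝ) :
    IntegratedLabel L → ℝ :=
  fun k => rootPosition L q k + (x - rootPosition L q k) * u k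

/-- The velocities of the points under the rescaling adapted to a component. -/
def scaledVelocity (L : ℕ) (u : IntegratedLabel L → ℝ) (k : ℕ) : ℝ :=
  if h : k ∈ Finset.Icc 4 L then u ⟨k, h⟩ else if k = 3 then 1 else 0

/-- The Jacobian determinant of the rescaling adapted to a component. -/
noncomputable def scaledJacobian (L : ℕ) (q : ComponentIndex L) (x : ℝ) : ℝ :=
  ∏ k : IntegratedLabel L, |x - rootPosition L q k|

theorem hasDerivAt_scaledPoint (L : ℕ) (q : ComponentIndex L) (u : IntegratedLabel L → ℝ) (x : ℝ)
    (k : ℕ) : HasDerivAt (fun t => pointPosition L t (scaledPoint L q t u) k)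
      (scaledVelocity L u k) x := by
  unfold pointPosition scaledVelocity scaledPoint
  split_ifs with h
  · simpa using (((hasDerivAt_id x).sub_const (rootPosition L q k)).mul_const
      (u ⟨k, h⟩)).const_add (rootPosition L q k)
  · exact hasDerivAt_id x
  · exact hasDerivAt_const x _
  · exact hasDerivAt_const x _

theorem rootPosition_eq (L : ℕ) (q : ComponentIndex L) (k : ℕ) :
    rootPosition L q k = 0 ∨ rootPosition L q k = 1 := by
  unfold rootPosition
  split_ifs <;> simp

theorem scaledJacobian_pos (L : ℕ) (q : ComponentIndex L) {x : ℝ} (hx0 : 0 < x) (hx1 : x < 1) :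
    0 < scaledJacobian L q x := by
  refine Finset.prod_pos fun k _ => abs_pos.2 ?_
  rcases rootPosition_eq L q k with h | h <;> rw [h] <;> intro h' <;> linarith

theorem map_scaledPoint (L : ℕ) (q : ComponentIndex L) {x : ℝ} (hx0 : 0 < x) (hx1 : x < 1) :
    ENNReal.ofReal (scaledJacobian L q x) • Measure.map (scaledPoint L q x) volume =
      (volume : Measure (IntegratedLabel L → ℝ)) := by
  set D : IntegratedLabel L → ℝ := fun k => x - rootPosition L q k with hD
  set v : IntegratedLabel L → ℝ := fun k => rootPosition L q k with hv
  have hdet : |(Matrix.diagonal D).det| = scaledJacobian L q x := by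
    rw [Matrix.det_diagonal, Finset.abs_prod, scaledJacobian]
  have hne : (Matrix.diagonal D).det ≠ 0 := by
    rw [← abs_pos, hdet]; exact scaledJacobian_pos L q hx0 hx1
  have h1 := Real.smul_map_diagonal_volume_pi hne
  have h2 : Measure.map (fun y => y + v) (volume : Measure (IntegratedLabel L → ℝ)) = volume :=
    (measurePreserving_add_right volume v).map_eq
  have hm : Measurable (Matrix.toLin' (Matrix.diagonal D)) :=
    (LinearMap.continuous_of_finiteDimensional _).measurable
  have h3 : scaledPoint L q x = (fun y => y + v) ∘ (Matrix.toLin' (Matrix.diagonal D)) := by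
    funext u k
    simp [scaledPoint, hD, hv, Matrix.mulVec_diagonal, add_comm]
  rw [h3, ← Measure.map_map (measurable_add_const v) hm, ← hdet, ← Measure.map_smul, h1, h2]

theorem measurable_scaledPoint (L : ℕ) (q : ComponentIndex L) :
    Measurable fun p : ℝ × (IntegratedLabel L → ℝ) => scaledPoint L q p.1 p.2 := by
  unfold scaledPoint
  refine measurable_pi_lambda _ fun k => ?_
  fun_prop

theorem measurableEmbedding_scaledPoint (L : ℕ) (q : ComponentIndex L) {x : ℝ} (hx0 : 0 < x)
    (hx1 : x < 1) : MeasurableEmbedding (scaledPoint L q x) := by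
  refine Measurable.measurableEmbedding
    ((measurable_scaledPoint L q).comp (measurable_const.prodMk measurable_id)) fun u v h => ?_
  funext k
  have h' := congrFun h k
  have : x - rootPosition L q k ≠ 0 := by
    rcases rootPosition_eq L q k with h | h <;> rw [h] <;> intro h' <;> linarith
  simpa [scaledPoint, this] using h'

theorem lintegral_scaledPoint (L : ℕ) (q : ComponentIndex L) {x : ℝ} (hx0 : 0 < x) (hx1 : x < 1)
    (f : (IntegratedLabel L → ℝ) → ℝ≥0∞) :
    ENNReal.ofReal (scaledJacobian L q x) * ∫⁻ u, f (scaledPoint L q x u) = ∫⁻ y, f y := by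
  conv_rhs => rw [← map_scaledPoint L q hx0 hx1]
  rw [lintegral_smul_measure, (measurableEmbedding_scaledPoint L q hx0 hx1).lintegral_map,
    smul_eq_mul]

theorem integral_scaledPoint (L : ℕ) (q : ComponentIndex L) {x : ℝ} (hx0 : 0 < x) (hx1 : x < 1)
    (f : (IntegratedLabel L → ℝ) → ℂ) :
    ∫ u, (scaledJacobian L q x : ℂ) * f (scaledPoint L q x u) = ∫ y, f y := by
  conv_rhs => rw [← map_scaledPoint L q hx0 hx1]
  rw [integral_smul_measure, (measurableEmbedding_scaledPoint L q hx0 hx1).integral_map,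
    integral_const_mul, ENNReal.toReal_ofReal (scaledJacobian_pos L q hx0 hx1).le,
    Complex.real_smul]

theorem wordForm_scale {R : Type*} [CommRing R] (z : R) {f f' : ℕ → R} {c c' : ℕ → ℕ → R}
    (l : List ℕ) (hl : l.Nodup) (hf : ∀ k ∈ l, z * f k = f' k)
    (hc : ∀ k ∈ l, ∀ j ∈ l, k ≠ j → z * c k j = c' k j) :
    z ^ l.length * wordForm f c l = wordForm f' c' l := by
  induction l with
  | nil => simp [wordForm]
  | cons w t ih =>
    obtain ⟨hw, ht⟩ := List.nodup_cons.1 hl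
    rw [wordForm, wordForm, ← ih ht (fun k hk => hf k (by simp [hk]))
      (fun k hk j hj => hc k (by simp [hk]) j (by simp [hj])), ← hf w (by simp),
      ← List.map_congr_left fun j hj => hc w (by simp) j (by simp [hj])
        (by rintro rfl; exact hw hj), List.sum_map_mul_left, List.length_cons, pow_succ]
    ring

/-- The Jacobian is x^|A| (1 - x)^|B|. A word form has one propagator per letter, so the rational
factor has degree -|A| in x and -|B| in x - 1, and everything cancels up to the sign (-1)^|B|. -/
theorem scaledJacobian_mul_componentFactor {L : ℕ} (hL : 4 ≤ L) (q : ComponentIndex L)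
    {S : ℕ → ℕ → ℂ} (hS : ∀ k j, S k j = S j k) :
    ∃ N : (IntegratedLabel L → ℝ) → ℂ, ∀ x : ℝ, 0 < x → x < 1 → ∀ u,
      (scaledJacobian L q x : ℂ) *
        componentFactor L q S (pointPosition L x (scaledPoint L q x u)) = N u := by
  obtain ⟨hn, hm⟩ := perm_words L hL q
  set A := wordAtZero L (componentLevel L q) (componentPerm L q) with hA
  set B := wordAtOne L (componentLevel L q) (componentPerm L q) with hB
  set ε : ℂ := (-1) ^ (componentLevel L q - 4)
  -- The velocities also serve as rescaled positions; in these coordinates both roots 1 and 2 lie at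
  -- 0.
  refine ⟨fun u => ε * (wordForm (fun k => propagator S (scaledVelocity L u) k 1)
    (propagator S (scaledVelocity L u)) A * ((-1) ^ B.length *
    wordForm (fun k => propagator S (scaledVelocity L u) k 2)
    (propagator S (scaledVelocity L u)) B)), fun x hx0 hx1 u => ?_⟩
  set X := pointPosition L x (scaledPoint L q x u) with hX
  have hmA : ∀ k ∈ A, k ∈ Finset.Icc 4 L := fun k hk => (hm k).1 (by simp [hk])
  have hmB : ∀ k ∈ B, k ∈ Finset.Icc 4 L := fun k hk => (hm k).1 (by simp [hk])
  have hrA : ∀ k ∈ A, rootPosition L q k = 0 := by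
    intro k hk
    rw [rootPosition, if_neg]
    rintro (rfl | h)
    · simpa using hmA 2 hk
    · rw [List.nodup_append] at hn
      exact hn.2.2 k hk k h rfl
  have hrB : ∀ k ∈ B, rootPosition L q k = 1 := fun k hk => if_pos (Or.inr hk)
  have hXA : ∀ k ∈ A, X k = x * scaledVelocity L u k := by
    intro k hk
    rw [hX, pointPosition_of_mem L x _ (hmA k hk), scaledVelocity, dif_pos (hmA k hk), scaledPoint]
    simp [hrA k hk]
  have hXB : ∀ k ∈ B, X k = 1 + (x - 1) * scaledVelocity L u k := by
    intro k hk
    rw [hX, pointPosition_of_mem L x _ (hmB k hk), scaledVelocity, dif_pos (hmB k hk), scaledPoint]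
    simp [hrB k hk]
  have hX1 : X 1 = x * scaledVelocity L u 1 := by
    rw [hX, pointPosition_one]; simp [scaledVelocity]
  have hX2 : X 2 = 1 + (x - 1) * scaledVelocity L u 2 := by
    rw [hX, pointPosition_two]; simp [scaledVelocity]
  have hx0' : (x : ℂ) ≠ 0 := by exact_mod_cast hx0.ne'
  have hx1' : (x : ℂ) - 1 ≠ 0 := by rw [sub_ne_zero]; exact_mod_cast hx1.ne
  have key0 : ∀ k j, X k = x * scaledVelocity L u k → X j = x * scaledVelocity L u j →
      (x : ℂ) * propagator S X k j = propagator S (scaledVelocity L u) k j := by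
    intro k j hk hj
    rw [propagator, propagator, hk, hj, ← mul_sub, Complex.ofReal_mul, ← mul_div_assoc,
      mul_div_mul_left _ _ hx0']
  have key1 : ∀ k j, X k = 1 + (x - 1) * scaledVelocity L u k →
      X j = 1 + (x - 1) * scaledVelocity L u j →
      ((x : ℂ) - 1) * propagator S X k j = propagator S (scaledVelocity L u) k j := by
    intro k j hk hj
    rw [propagator, propagator, hk, hj, add_sub_add_left_eq_sub, ← mul_sub, Complex.ofReal_mul,
      Complex.ofReal_sub, Complex.ofReal_one, ← mul_div_assoc, mul_div_mul_left _ _ hx1']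
  have eA := wordForm_scale (x : ℂ) A (List.nodup_append.1 hn).1
    (fun k hk => key0 k 1 (hXA k hk) hX1) (fun k hk j hj _ => key0 k j (hXA k hk) (hXA j hj))
  have eB := wordForm_scale ((x : ℂ) - 1) B (List.nodup_append.1 hn).2.1
    (fun k hk => key1 k 2 (hXB k hk) hX2) (fun k hk j hj _ => key1 k j (hXB k hk) (hXB j hj))
  have hJ : (scaledJacobian L q x : ℂ) =
      (x : ℂ) ^ A.length * ((-1) ^ B.length * ((x : ℂ) - 1) ^ B.length) := by
    have h1 : scaledJacobian L q x = ((A ++ B).map fun k => |x - rootPosition L q k|).prod := by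
      rw [scaledJacobian, Finset.univ_eq_attach,
        Finset.prod_attach (Finset.Icc 4 L) (fun k => |x - rootPosition L q k|),
        ← List.prod_toFinset _ hn]
      congr 1
      ext k
      rw [List.mem_toFinset, hm]
    rw [h1, List.map_append, List.prod_append,
      List.map_congr_left (g := fun _ => x) fun k hk => by rw [hrA k hk, sub_zero, abs_of_pos hx0],
      List.map_congr_left (l := B) (g := fun _ => -(x - 1)) fun k hk => by
        rw [hrB k hk, abs_of_neg (by linarith)], List.map_const', List.map_const',
      List.prod_replicate, List.prod_replicate, ← mul_pow]
    push_cast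
    ring
  beta_reduce
  rw [componentFactor_eq_wordForm L hL q S hS X (by rw [hX, pointPosition_one]), ← eA, ← eB, hJ]
  ring

end Scaling

/-! ### The Knizhnik–Zamolodchikov equation for the integrals -/

section KZ

open scoped ENNReal

variable {L : ℕ}

/-- The integrand of a component, continued by zero from the integration domain. -/
noncomputable def cutIntegrand (L : ℕ) (s : MandelstamIndex L → ℂ) (q : ComponentIndex L) (x : ℝ)
    (y : IntegratedLabel L → ℝ) : ℂ :=
  cutKobaNielsen L (mandelstam L s) (pointPosition L x y) *
    componentFactor L q (mandelstam L s) (pointPosition L x y)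

theorem mandelstam_re_pos {s : MandelstamIndex L → ℂ} (hs : ∀ p, 0 < (s p).re) (k m : ℕ)
    (hk : 1 ≤ k) (hkm : k < m) (hm : m ≤ L) : 0 < (mandelstam L s k m).re := by
  rw [mandelstam, dif_pos ⟨hk, hkm, hm⟩]
  exact hs _

theorem indicator_selbergIntegrand {s : MandelstamIndex L → ℂ} (hs : ∀ p, 0 < (s p).re) {x : ℝ}
    (hx0 : 0 < x) (hx1 : x < 1) (q : ComponentIndex L) :
    (selbergDomain L x).indicator
      (selbergIntegrand L (componentLevel L q) (componentPerm L q) s x) = cutIntegrand L s q x := by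
  funext y
  rw [cutIntegrand, ← indicator_kobaNielsen hx0 hx1 (mandelstam_re_pos hs)]
  by_cases hy : y ∈ selbergDomain L x
  · rw [Set.indicator_of_mem hy, Set.indicator_of_mem hy]
    rfl
  · rw [Set.indicator_of_notMem hy, Set.indicator_of_notMem hy, zero_mul]

theorem measurable_cutIntegrand (s : MandelstamIndex L → ℂ) (q : ComponentIndex L) :
    Measurable fun p : ℝ × (IntegratedLabel L → ℝ) => cutIntegrand L s q p.1 p.2 := by
  unfold cutIntegrand
  have h := measurable_pointPosition L (measurable_fst : Measurable fun p : ℝ ×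
    (IntegratedLabel L → ℝ) => p.1) measurable_snd
  exact (measurable_cutKobaNielsen L _ h).mul (measurable_componentFactor L q _ h)

theorem isCompact_selbergDomain (L : ℕ) (x : ℝ) : IsCompact (selbergDomain L x) := by
  have hsub : selbergDomain L x ⊆ Set.Icc (fun _ => 0) (fun _ => x) := fun y hy =>
    ⟨fun k => (hy.2 k).1, fun k => (hy.2 k).2⟩
  refine isCompact_Icc.of_isClosed_subset ?_ hsub
  have : selbergDomain L x = (⋂ (a : IntegratedLabel L) (b : IntegratedLabel L) (_ : a ≤ b),
      {y | y b ≤ y a}) ∩ ⋂ k : IntegratedLabel L, ({y | 0 ≤ y k} ∩ {y | y k ≤ x}) := by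
    ext y
    simp [selbergDomain, Antitone]
  rw [this]
  exact IsClosed.inter (isClosed_iInter fun a => isClosed_iInter fun b =>
    isClosed_iInter fun _ => isClosed_le (continuous_apply b) (continuous_apply a))
    (isClosed_iInter fun k => (isClosed_le continuous_const (continuous_apply k)).inter
      (isClosed_le (continuous_apply k) continuous_const))

theorem measurableSet_selbergDomain (L : ℕ) (x : ℝ) : MeasurableSet (selbergDomain L x) :=
  (isCompact_selbergDomain L x).isClosed.measurableSet

theorem integrable_cutIntegrand (hL : 4 ≤ L) {s : MandelstamIndex L → ℂ} (hs : ∀ p, 0 < (s p).re)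
    (q : ComponentIndex L) (x : ℝ) : Integrable (cutIntegrand L s q x) := by
  obtain ⟨C, hC, h⟩ := exists_lintegral_integrand_le hL s hs q
  exact ⟨((measurable_cutIntegrand s q).comp
    (measurable_const.prodMk measurable_id)).aestronglyMeasurable, (h x).trans_lt hC.lt_top⟩

theorem integrableOn_selbergIntegrand (hL : 4 ≤ L) {s : MandelstamIndex L → ℂ}
    (hs : ∀ p, 0 < (s p).re) {x : ℝ} (hx0 : 0 < x) (hx1 : x < 1) (q : ComponentIndex L) :
    IntegrableOn (selbergIntegrand L (componentLevel L q) (componentPerm L q) s x)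
      (selbergDomain L x) := by
  rw [← integrable_indicator_iff (measurableSet_selbergDomain L x),
    indicator_selbergIntegrand hs hx0 hx1]
  exact integrable_cutIntegrand hL hs q x

theorem selbergVector_eq {s : MandelstamIndex L → ℂ} (hs : ∀ p, 0 < (s p).re) {x : ℝ}
    (hx0 : 0 < x) (hx1 : x < 1) (q : ComponentIndex L) :
    selbergVector L s x q = ∫ y, cutIntegrand L s q x y := by
  rw [selbergVector, selbergComponent, ← indicator_selbergIntegrand hs hx0 hx1,
    integral_indicator (measurableSet_selbergDomain L x)]

/-- The derivative of the rescaled integrand of a component. -/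
noncomputable def scaledDerivative (L : ℕ) (s : MandelstamIndex L → ℂ) (q : ComponentIndex L)
    (N : (IntegratedLabel L → ℝ) → ℂ) (x : ℝ) (u : IntegratedLabel L → ℝ) : ℂ :=
  cutKobaNielsen L (mandelstam L s) (pointPosition L x (scaledPoint L q x u)) *
    logDerivative L (mandelstam L s) (pointPosition L x (scaledPoint L q x u))
      (scaledVelocity L u) * N u

/-- For fixed u the differences of positions are affine in x. The integrand is continuous because
the exponents have positive real part, and it is differentiable except where some difference that is
not identically zero vanishes. These are countably many points, which the fundamental theorem of
calculus tolerates. -/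
theorem integral_scaledDerivative {s : MandelstamIndex L → ℂ} (hs : ∀ p, 0 < (s p).re)
    (q : ComponentIndex L) (N : (IntegratedLabel L → ℝ) → ℂ) (u : IntegratedLabel L → ℝ)
    {a b : ℝ} (hab : IntervalIntegrable (fun x => scaledDerivative L s q N x u) volume a b) :
    ∫ x in a..b, scaledDerivative L s q N x u =
      cutKobaNielsen L (mandelstam L s) (pointPosition L b (scaledPoint L q b u)) * N u -
      cutKobaNielsen L (mandelstam L s) (pointPosition L a (scaledPoint L q a u)) * N u := by
  set X : ℝ → ℕ → ℝ := fun x => pointPosition L x (scaledPoint L q x u) with hX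
  set E : Set ℝ := ⋃ (k : ℕ) (m : ℕ),
    {x | orderedDiff (X x) k m = 0 ∧ ¬ ∀ t, orderedDiff (X t) k m = 0} with hE
  have hXd : ∀ x k, HasDerivAt (fun t => X t k) (scaledVelocity L u k) x := fun x k =>
    hasDerivAt_scaledPoint L q u x k
  have hod : ∀ k m x, HasDerivAt (fun t => orderedDiff (X t) k m)
      (orderedDiff (scaledVelocity L u) k m) x := fun k m x =>
    hasDerivAt_orderedDiff (hXd x) k m
  have hEc : E.Countable := by
    refine Set.countable_iUnion fun k => Set.countable_iUnion fun m => ?_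
    refine Set.Subsingleton.countable fun x hx t ht => ?_
    by_contra hxt
    -- an affine function with two zeros vanishes
    refine hx.2 fun t' => ?_
    have haff : ∀ a b, orderedDiff (X b) k m - orderedDiff (X a) k m =
        (b - a) * orderedDiff (scaledVelocity L u) k m := by
      have hc : ∀ a b, orderedDiff (X a) k m - a * orderedDiff (scaledVelocity L u) k m =
          orderedDiff (X b) k m - b * orderedDiff (scaledVelocity L u) k m := by
        refine is_const_of_deriv_eq_zero (fun x => ?_) fun x => ?_
        · exact ((hod k m x).sub ((hasDerivAt_id x).mul_const _)).differentiableAt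
        · refine (((hod k m x).sub ((hasDerivAt_id x).mul_const _)).congr_deriv ?_).deriv
          rw [one_mul, sub_self]
      intro a b
      linarith [hc a b]
    have h1 := haff x t
    rw [hx.1, ht.1, sub_zero] at h1
    have h2 : orderedDiff (scaledVelocity L u) k m = 0 := by
      rcases mul_eq_zero.1 h1.symm with h | h
      · exact absurd (sub_eq_zero.1 h).symm hxt
      · exact h
    have h3 := haff x t'
    rw [hx.1, h2, mul_zero, sub_zero] at h3
    exact h3
  have hcont : Continuous fun x => cutKobaNielsen L (mandelstam L s) (X x) * N u := by
    refine Continuous.mul ?_ continuous_const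
    unfold cutKobaNielsen
    refine continuous_finsetProd _ fun k hk => continuous_finsetProd _ fun m hm => ?_
    rw [Finset.mem_Icc] at hk hm
    exact (continuous_posPow (mandelstam_re_pos hs k m hk.1 (by omega) hm.2)).comp
      (continuous_iff_continuousAt.2 fun x => (hod k m x).continuousAt)
  refine integral_eq_of_hasDerivAt_off_countable
    (fun x => cutKobaNielsen L (mandelstam L s) (X x) * N u) _ hEc hcont.continuousOn
    (fun x hx => ?_) hab
  refine (hasDerivAt_cutKobaNielsen (mandelstam_re_pos hs) (hXd x) fun k m => ?_).mul_const (N u)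
  by_contra h
  rw [not_or, not_not] at h
  exact hx.2 (Set.mem_iUnion₂.2 ⟨k, m, h⟩)

theorem integrable_scaledPoint (q : ComponentIndex L) {x : ℝ} (hx0 : 0 < x) (hx1 : x < 1)
    {f : (IntegratedLabel L → ℝ) → ℂ} (hf : Integrable f) :
    Integrable fun u => (scaledJacobian L q x : ℂ) * f (scaledPoint L q x u) := by
  rw [← map_scaledPoint L q hx0 hx1] at hf
  rw [integrable_smul_measure
    (ENNReal.ofReal_pos.2 (scaledJacobian_pos L q hx0 hx1)).ne' ENNReal.ofReal_ne_top,
    (measurableEmbedding_scaledPoint L q hx0 hx1).integrable_map_iff] at hf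
  exact hf.const_mul _

/-- The components of a Knizhnik–Zamolodchikov system as functions of `x_3`. -/
noncomputable def kzCoefficient {Q : Type*} (r₀ r₁ : Q → Q → ℂ) (q q' : Q) (x : ℝ) : ℂ :=
  (x : ℂ)⁻¹ * r₀ q q' + ((x : ℂ) - 1)⁻¹ * r₁ q q'

theorem continuousOn_kzCoefficient {Q : Type*} (r₀ r₁ : Q → Q → ℂ) (q q' : Q) :
    ContinuousOn (kzCoefficient r₀ r₁ q q') (Set.Ioo 0 1) := by
  unfold kzCoefficient
  refine ContinuousOn.add (ContinuousOn.mul (ContinuousOn.inv₀ ?_ ?_) continuousOn_const)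
    (ContinuousOn.mul (ContinuousOn.inv₀ ?_ ?_) continuousOn_const)
  · exact Complex.continuous_ofReal.continuousOn
  · intro x hx
    exact_mod_cast hx.1.ne'
  · exact (Complex.continuous_ofReal.sub continuous_const).continuousOn
  · intro x hx
    rw [sub_ne_zero]
    exact_mod_cast hx.2.ne

/-- The logarithmic derivatives of the components close under the matrices `r₀` and `r₁`. -/
def ClosesUnderScaling (L : ℕ) (s : MandelstamIndex L → ℂ)
    (r₀ r₁ : ComponentIndex L → ComponentIndex L → ℂ) : Prop :=
  ∀ q (X u : ℕ → ℝ) (x : ℝ), x ≠ 0 → x ≠ 1 →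
    Set.InjOn X (Finset.Icc 1 L) → X 1 = 0 → X 2 = 1 → X 3 = x →
    u 1 = 0 → u 2 = 0 → u 3 = 1 →
    (∀ k ∈ Finset.Icc 4 L, X k = rootPosition L q k + (x - rootPosition L q k) * u k) →
    logDerivative L (mandelstam L s) X u * componentFactor L q (mandelstam L s) X =
      ∑ q', kzCoefficient r₀ r₁ q q' x * componentFactor L q' (mandelstam L s) X

theorem scaledDerivative_eq {s : MandelstamIndex L → ℂ}
    {r₀ r₁ : ComponentIndex L → ComponentIndex L → ℂ} (hr : ClosesUnderScaling L s r₀ r₁)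
    (q : ComponentIndex L) {N : (IntegratedLabel L → ℝ) → ℂ}
    (hN : ∀ x : ℝ, 0 < x → x < 1 → ∀ u, (scaledJacobian L q x : ℂ) * componentFactor L q
      (mandelstam L s) (pointPosition L x (scaledPoint L q x u)) = N u)
    {x : ℝ} (hx0 : 0 < x) (hx1 : x < 1) (u : IntegratedLabel L → ℝ) :
    scaledDerivative L s q N x u = (scaledJacobian L q x : ℂ) *
      ∑ q', kzCoefficient r₀ r₁ q q' x * cutIntegrand L s q' x (scaledPoint L q x u) := by
  set X := pointPosition L x (scaledPoint L q x u) with hX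
  rw [scaledDerivative, ← hN x hx0 hx1 u, ← hX]
  -- The algebraic identity is only available for distinct points; wherever points coincide the
  -- Koba–Nielsen factor kills both sides.
  by_cases h0 : cutKobaNielsen L (mandelstam L s) X = 0
  · simp only [cutIntegrand, ← hX, h0, zero_mul, mul_zero, Finset.sum_const_zero]
  · have hinj : Set.InjOn X (Finset.Icc 1 L) := injOn_of_orderedDiff_pos fun k m a b c =>
      orderedDiff_pos_of_cutKobaNielsen_ne_zero h0 a b c
    have h := hr q X (scaledVelocity L u) x hx0.ne' hx1.ne hinj (pointPosition_one L x _)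
      (pointPosition_two L x _) (pointPosition_three L x _) (by simp [scaledVelocity])
      (by simp [scaledVelocity]) (by simp [scaledVelocity]) (fun k hk => by
        rw [hX, pointPosition_of_mem L x _ hk, scaledVelocity, dif_pos hk, scaledPoint])
    simp only [cutIntegrand, ← hX]
    calc _ = (scaledJacobian L q x : ℂ) * (cutKobaNielsen L (mandelstam L s) X *
          (logDerivative L (mandelstam L s) X (scaledVelocity L u) *
            componentFactor L q (mandelstam L s) X)) := by ring
      _ = _ := by
          rw [h, Finset.mul_sum]
          congr 1
          refine Finset.sum_congr rfl fun q' _ => ?_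
          ring

theorem integral_scaledDerivative_eq (hL : 4 ≤ L) {s : MandelstamIndex L → ℂ} (hs : ∀ p, 0 < (s p).re)
    {r₀ r₁ : ComponentIndex L → ComponentIndex L → ℂ} (hr : ClosesUnderScaling L s r₀ r₁)
    (q : ComponentIndex L) {N : (IntegratedLabel L → ℝ) → ℂ}
    (hN : ∀ x : ℝ, 0 < x → x < 1 → ∀ u, (scaledJacobian L q x : ℂ) * componentFactor L q
      (mandelstam L s) (pointPosition L x (scaledPoint L q x u)) = N u) {x : ℝ}
    (hx : x ∈ Set.Ioo (0 : ℝ) 1) : ∫ u, scaledDerivative L s q N x u =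
      ∑ q', kzCoefficient r₀ r₁ q q' x * selbergVector L s x q' := by
  simp_rw [scaledDerivative_eq hr q hN hx.1 hx.2]
  rw [integral_scaledPoint L q hx.1 hx.2
    (fun y => ∑ q', kzCoefficient r₀ r₁ q q' x * cutIntegrand L s q' x y),
    integral_finsetSum _ fun q' _ => (integrable_cutIntegrand hL hs q' x).const_mul _]
  refine Finset.sum_congr rfl fun q' _ => ?_
  rw [integral_const_mul, selbergVector_eq hs hx.1 hx.2]

theorem measurable_scaledDerivative (s : MandelstamIndex L → ℂ)
    (q : ComponentIndex L) {N : (IntegratedLabel L → ℝ) → ℂ}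
    (hN : ∀ x : ℝ, 0 < x → x < 1 → ∀ u, (scaledJacobian L q x : ℂ) * componentFactor L q
      (mandelstam L s) (pointPosition L x (scaledPoint L q x u)) = N u) :
    Measurable fun p : ℝ × (IntegratedLabel L → ℝ) => scaledDerivative L s q N p.1 p.2 := by
  have hNm : Measurable N := by
    have : N = fun u => (scaledJacobian L q (1 / 2) : ℂ) * componentFactor L q (mandelstam L s)
        (pointPosition L (1 / 2) (scaledPoint L q (1 / 2) u)) :=
      funext fun u => (hN (1 / 2) (by norm_num) (by norm_num) u).symm
    rw [this]
    refine (measurable_componentFactor L q _ fun k => measurable_pointPosition L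
      measurable_const ?_ k).const_mul _
    exact (measurable_scaledPoint L q).comp (measurable_const.prodMk measurable_id)
  have hX := measurable_pointPosition L (measurable_fst : Measurable fun p : ℝ ×
    (IntegratedLabel L → ℝ) => p.1) (measurable_scaledPoint L q)
  refine ((measurable_cutKobaNielsen L _ hX).mul
    (measurable_logDerivative L _ hX fun k => ?_)).mul (hNm.comp measurable_snd)
  unfold scaledVelocity
  split_ifs
  · exact (measurable_pi_apply _).comp measurable_snd
  · exact measurable_const
  · exact measurable_const

theorem lintegral_enorm_scaledDerivative {s : MandelstamIndex L → ℂ}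
    {r₀ r₁ : ComponentIndex L → ComponentIndex L → ℂ} (hr : ClosesUnderScaling L s r₀ r₁)
    (q : ComponentIndex L) {N : (IntegratedLabel L → ℝ) → ℂ}
    (hN : ∀ x : ℝ, 0 < x → x < 1 → ∀ u, (scaledJacobian L q x : ℂ) * componentFactor L q
      (mandelstam L s) (pointPosition L x (scaledPoint L q x u)) = N u) {x : ℝ}
    (hx0 : 0 < x) (hx1 : x < 1) : ∫⁻ u, ‖scaledDerivative L s q N x u‖ₑ =
      ∫⁻ y, ‖∑ q', kzCoefficient r₀ r₁ q q' x * cutIntegrand L s q' x y‖ₑ := by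
  have hJ : ‖(scaledJacobian L q x : ℂ)‖ₑ = ENNReal.ofReal (scaledJacobian L q x) := by
    rw [← ofReal_norm, Complex.norm_real, Real.norm_eq_abs,
      abs_of_pos (scaledJacobian_pos L q hx0 hx1)]
  rw [← lintegral_scaledPoint L q hx0 hx1
    (fun y => ‖∑ q', kzCoefficient r₀ r₁ q q' x * cutIntegrand L s q' x y‖ₑ),
    ← lintegral_const_mul' _ _ ENNReal.ofReal_ne_top]
  refine lintegral_congr fun u => ?_
  rw [scaledDerivative_eq hr q hN hx0 hx1, enorm_mul, hJ]

theorem lintegral_enorm_sum_mul_le {α ι : Type*} [MeasurableSpace α] {μ : Measure α} [Fintype ι]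
    (c : ι → ℂ) {f : ι → α → ℂ} (hf : ∀ i, Measurable (f i)) :
    ∫⁻ y, ‖∑ i, c i * f i y‖ₑ ∂μ ≤ ∑ i, ‖c i‖ₑ * ∫⁻ y, ‖f i y‖ₑ ∂μ := by
  calc _ ≤ ∫⁻ y, ∑ i, ‖c i‖ₑ * ‖f i y‖ₑ ∂μ := by
        refine lintegral_mono fun y => (enorm_sum_le _ _).trans_eq ?_
        simp_rw [enorm_mul]
    _ = _ := by
        rw [lintegral_finsetSum _ fun i _ => (hf i).enorm.const_mul _]
        refine Finset.sum_congr rfl fun i _ => ?_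
        rw [lintegral_const_mul _ (hf i).enorm]

/-- Although the derivative has extra poles in cross pairs, it is a combination of integrands of the
same family, and its coefficients are bounded on a compact interval inside (0, 1). -/
theorem exists_lintegral_scaledDerivative_le (hL : 4 ≤ L) {s : MandelstamIndex L → ℂ} (hs : ∀ p, 0 < (s p).re)
    {r₀ r₁ : ComponentIndex L → ComponentIndex L → ℂ} (hr : ClosesUnderScaling L s r₀ r₁)
    (q : ComponentIndex L) {N : (IntegratedLabel L → ℝ) → ℂ}
    (hN : ∀ x : ℝ, 0 < x → x < 1 → ∀ u, (scaledJacobian L q x : ℂ) * componentFactor L q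
      (mandelstam L s) (pointPosition L x (scaledPoint L q x u)) = N u) {a b : ℝ}
    (ha : 0 < a) (hb : b < 1) : ∃ C : ℝ≥0∞, C ≠ ∞ ∧ ∀ x ∈ Set.Ioc a b,
      ∫⁻ u, ‖scaledDerivative L s q N x u‖ₑ ≤ C := by
  have hsub : Set.Icc a b ⊆ Set.Ioo 0 1 := fun x hx => ⟨ha.trans_le hx.1, hx.2.trans_lt hb⟩
  choose D hD using fun q' => isCompact_Icc.exists_bound_of_continuousOn
    ((continuousOn_kzCoefficient r₀ r₁ q q').mono hsub)
  choose C hC hC' using exists_lintegral_integrand_le hL s hs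
  refine ⟨∑ q', ENNReal.ofReal (D q') * C q', (ENNReal.sum_lt_top.2 fun q' _ =>
    ENNReal.mul_lt_top ENNReal.ofReal_lt_top (hC q').lt_top).ne, fun x hx => ?_⟩
  have hx' := hsub (Set.Ioc_subset_Icc_self hx)
  rw [lintegral_enorm_scaledDerivative hr q hN hx'.1 hx'.2]
  refine (lintegral_enorm_sum_mul_le _ fun q' =>
    (measurable_cutIntegrand s q').comp (measurable_const.prodMk measurable_id)).trans ?_
  refine Finset.sum_le_sum fun q' _ => mul_le_mul' ?_ (hC' q' x)
  rw [← ofReal_norm]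
  exact ENNReal.ofReal_le_ofReal (hD q' x (Set.Ioc_subset_Icc_self hx))

/-- The pointwise fundamental theorem in x is integrated over u and the two integrations are
exchanged. Working with the integrated equation avoids a dominating function for the derivative at
each u, which the moving singularities would obstruct. -/
theorem integral_kz_eq (hL : 4 ≤ L) {s : MandelstamIndex L → ℂ} (hs : ∀ p, 0 < (s p).re)
    {r₀ r₁ : ComponentIndex L → ComponentIndex L → ℂ} (hr : ClosesUnderScaling L s r₀ r₁)
    (q : ComponentIndex L) {a b : ℝ} (ha : 0 < a) (hab : a ≤ b) (hb : b < 1) :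
    IntervalIntegrable
      (fun x => ∑ q', kzCoefficient r₀ r₁ q q' x * selbergVector L s x q') volume a b ∧
    ∫ x in a..b, ∑ q', kzCoefficient r₀ r₁ q q' x * selbergVector L s x q' =
      selbergVector L s b q - selbergVector L s a q := by
  obtain ⟨N, hN⟩ := scaledJacobian_mul_componentFactor hL q (mandelstam_symm L s)
  set G := scaledDerivative L s q N with hG
  have hsub : Set.Ioc a b ⊆ Set.Ioo 0 1 := fun x hx => ⟨ha.trans hx.1, hx.2.trans_lt hb⟩
  have hGint := fun x hx => integral_scaledDerivative_eq (x := x) hL hs hr q hN hx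
  have hGm := measurable_scaledDerivative s q hN
  obtain ⟨C, hC, hbound⟩ := exists_lintegral_scaledDerivative_le hL hs hr q hN ha hb
  have hGi : Integrable (Function.uncurry G) ((volume.restrict (Set.Ioc a b)).prod volume) := by
    refine ⟨hGm.aestronglyMeasurable, ?_⟩
    have hGe := hGm.enorm.aemeasurable (μ := (volume.restrict (Set.Ioc a b)).prod volume)
    refine lt_of_eq_of_lt (lintegral_prod _ hGe) ?_
    calc _ ≤ ∫⁻ x in Set.Ioc a b, C := setLIntegral_mono measurable_const hbound
      _ < ∞ := by
          rw [setLIntegral_const]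
          exact ENNReal.mul_lt_top hC.lt_top (by simp)
  have hI : IntegrableOn
      (fun x => ∑ q', kzCoefficient r₀ r₁ q q' x * selbergVector L s x q') (Set.Ioc a b) :=
    hGi.integral_prod_left.congr (by
      filter_upwards [ae_restrict_mem measurableSet_Ioc] with x hx
      exact hGint x (hsub hx))
  refine ⟨(intervalIntegrable_iff_integrableOn_Ioc_of_le hab).2 hI, ?_⟩
  have hend : ∀ x, 0 < x → x < 1 → Integrable (fun u => cutKobaNielsen L (mandelstam L s)
      (pointPosition L x (scaledPoint L q x u)) * N u) ∧ ∫ u, cutKobaNielsen L (mandelstam L s)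
      (pointPosition L x (scaledPoint L q x u)) * N u = selbergVector L s x q := by
    intro x hx0 hx1
    have e : ∀ u, cutKobaNielsen L (mandelstam L s)
        (pointPosition L x (scaledPoint L q x u)) * N u =
        (scaledJacobian L q x : ℂ) * cutIntegrand L s q x (scaledPoint L q x u) := by
      intro u
      rw [← hN x hx0 hx1 u, cutIntegrand]
      ring
    simp_rw [e]
    exact ⟨integrable_scaledPoint q hx0 hx1 (integrable_cutIntegrand hL hs q x), by
      rw [integral_scaledPoint L q hx0 hx1 (cutIntegrand L s q x), selbergVector_eq hs hx0 hx1]⟩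
  obtain ⟨ib, eb⟩ := hend b (ha.trans_le hab) hb
  obtain ⟨ia, ea⟩ := hend a ha (hab.trans_lt hb)
  rw [← eb, ← ea, ← integral_sub ib ia, intervalIntegral.integral_of_le hab,
    setIntegral_congr_fun measurableSet_Ioc fun x hx => (hGint x (hsub hx)).symm,
    integral_integral_swap hGi]
  refine integral_congr_ae ?_
  filter_upwards [hGi.prod_left_ae] with u hu
  rw [← integral_scaledDerivative hs q N u, intervalIntegral.integral_of_le hab]
  exact (intervalIntegrable_iff_integrableOn_Ioc_of_le hab).2 hu

/-- A bootstrap: the integrated equation makes every component a primitive of an integrable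
function, hence continuous; then the right-hand side is continuous and the primitive is
differentiable. -/
theorem hasDerivAt_selbergVector_apply (hL : 4 ≤ L) {s : MandelstamIndex L → ℂ}
    (hs : ∀ p, 0 < (s p).re) {r₀ r₁ : ComponentIndex L → ComponentIndex L → ℂ}
    (hr : ClosesUnderScaling L s r₀ r₁) {x : ℝ} (hx0 : 0 < x) (hx1 : x < 1)
    (q : ComponentIndex L) :
    HasDerivAt (fun t => selbergVector L s t q)
      (∑ q', kzCoefficient r₀ r₁ q q' x * selbergVector L s x q') x := by
  set H : ComponentIndex L → ℝ → ℂ := fun q x =>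
    ∑ q', kzCoefficient r₀ r₁ q q' x * selbergVector L s x q' with hH
  have key := fun q a b ha hab hb => integral_kz_eq (a := a) (b := b) hL hs hr q ha hab hb
  have hcont : ∀ q, ContinuousOn (fun t => selbergVector L s t q) (Set.Ioo 0 1) := by
    intro q t ht
    obtain ⟨a, ha0, hat⟩ := exists_between ht.1
    obtain ⟨b, htb, hb1⟩ := exists_between ht.2
    have hab : a ≤ b := (hat.trans htb).le
    have h1 : ContinuousOn (fun t => ∫ x in a..t, H q x) (Set.uIcc a b) :=
      intervalIntegral.continuousOn_primitive_interval
        ((intervalIntegrable_iff').1 (key q a b ha0 hab hb1).1)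
    rw [Set.uIcc_of_le hab] at h1
    have h2 : ContinuousAt (fun t => selbergVector L s a q + ∫ x in a..t, H q x) t :=
      continuousAt_const.add (h1.continuousAt (Icc_mem_nhds hat htb))
    refine (h2.congr ?_).continuousWithinAt
    filter_upwards [Icc_mem_nhds hat htb] with t' ht'
    rw [(key q a t' ha0 ht'.1 (ht'.2.trans_lt hb1)).2]
    ring
  have hHc : ContinuousOn (H q) (Set.Ioo 0 1) :=
    continuousOn_finsetSum _ fun q' _ => (continuousOn_kzCoefficient r₀ r₁ q q').mul (hcont q')
  obtain ⟨a, ha0, hax⟩ := exists_between hx0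
  obtain ⟨b, hxb, hb1⟩ := exists_between hx1
  have hxm : Set.Ioo (0 : ℝ) 1 ∈ nhds x := Ioo_mem_nhds hx0 hx1
  have hd := (intervalIntegral.integral_hasDerivAt_right (key q a x ha0 hax.le hx1).1
    (hHc.stronglyMeasurableAtFilter isOpen_Ioo x ⟨hx0, hx1⟩) (hHc.continuousAt hxm)).const_add
    (selbergVector L s a q)
  refine hd.congr_of_eventuallyEq ?_
  filter_upwards [Icc_mem_nhds hax hxb] with t ht
  rw [(key q a t ha0 ht.1 (ht.2.trans_lt hb1)).2]
  ring

end KZ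

/-! ### Concentration at critical points -/

section CriticalPoint

variable {L : ℕ}

/-- The Koba–Nielsen factor for real exponents. -/
noncomputable def realKobaNielsen (L : ℕ) (S : ℕ → ℕ → ℝ) (X : ℕ → ℝ) : ℝ :=
  ∏ k ∈ Finset.Icc 1 L, ∏ m ∈ Finset.Icc (k + 1) L, |X k - X m| ^ S k m

theorem mandelstam_map {R R' : Type*} [Zero R] [Zero R'] (f : R → R') (hf : f 0 = 0)
    (s : MandelstamIndex L → R) (k m : ℕ) :
    mandelstam L (fun p => f (s p)) k m = f (mandelstam L s k m) := by
  unfold mandelstam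
  split_ifs <;> simp [hf]

theorem mandelstam_pos {s : MandelstamIndex L → ℝ} (hs : ∀ p, 0 < s p) {k m : ℕ}
    (hk : 1 ≤ k) (hkm : k < m) (hm : m ≤ L) : 0 < mandelstam L s k m := by
  rw [mandelstam, dif_pos ⟨hk, hkm, hm⟩]
  exact hs _

theorem mandelstam_nonneg {s : MandelstamIndex L → ℝ} (hs : ∀ p, 0 < s p) (k m : ℕ) :
    0 ≤ mandelstam L s k m := by
  unfold mandelstam
  split_ifs
  · exact (hs _).le
  · exact (hs _).le
  · exact le_rfl

/-- The scaling is by n + 1 rather than n so that one Koba–Nielsen factor is left over; it keeps the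
remaining integrand integrable while the n-th power acts as the peak. -/
theorem kobaNielsen_natCast_mul (s : MandelstamIndex L → ℝ) (X : ℕ → ℝ) (n : ℕ) :
    kobaNielsen L (mandelstam L (fun p => ((n : ℂ) + 1) * (s p : ℂ))) X =
      (realKobaNielsen L (mandelstam L s) X ^ n : ℝ) *
        kobaNielsen L (mandelstam L (fun p => (s p : ℂ))) X := by
  have h1 : ∀ k m, mandelstam L (fun p => ((n : ℂ) + 1) * (s p : ℂ)) k m =
      (((n + 1 : ℕ) : ℝ) * mandelstam L s k m : ℝ) := fun k m => by
    rw [mandelstam_map (fun t : ℝ => ((n : ℂ) + 1) * (t : ℂ)) (by simp)]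
    push_cast
    ring
  have h2 : ∀ k m, mandelstam L (fun p => (s p : ℂ)) k m = ((mandelstam L s k m : ℝ) : ℂ) :=
    fun k m => mandelstam_map (fun t : ℝ => (t : ℂ)) (by simp) s k m
  unfold kobaNielsen realKobaNielsen
  rw [← Finset.prod_pow, Complex.ofReal_prod, ← Finset.prod_mul_distrib]
  refine Finset.prod_congr rfl fun k _ => ?_
  rw [← Finset.prod_pow, Complex.ofReal_prod, ← Finset.prod_mul_distrib]
  refine Finset.prod_congr rfl fun m _ => ?_
  rw [h1, h2, ← Complex.ofReal_cpow (abs_nonneg _), ← Complex.ofReal_cpow (abs_nonneg _),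
    ← Complex.ofReal_mul, ← pow_succ, ← Real.rpow_natCast, ← Real.rpow_mul (abs_nonneg _), mul_comm]

theorem componentFactor_mul (hL : 4 ≤ L) (q : ComponentIndex L) (z : ℂ) (S : ℕ → ℕ → ℂ)
    (X : ℕ → ℝ) : componentFactor L q (fun k j => z * S k j) X =
      z ^ (L - 3) * componentFactor L q S X := by
  obtain ⟨h4, h5⟩ := componentLevel_mem L hL q
  unfold componentFactor rationalFactor
  have h : z ^ (L - 3) = (∏ _k ∈ Finset.Icc (componentLevel L q) L, z) *
      ∏ _m ∈ Finset.Ico 4 (componentLevel L q), z := by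
    rw [Finset.prod_const, Finset.prod_const, ← pow_add, Nat.card_Icc, Nat.card_Ico]
    congr 1
    omega
  rw [h, mul_mul_mul_comm, ← Finset.prod_mul_distrib, ← Finset.prod_mul_distrib]
  congr 1
  · refine Finset.prod_congr rfl fun k _ => ?_
    rw [mul_add, Finset.mul_sum, mul_div_assoc]
    simp_rw [mul_div_assoc]
  · refine Finset.prod_congr rfl fun m _ => ?_
    rw [Finset.mul_sum]
    simp_rw [mul_div_assoc]

theorem continuous_pointPosition (L : ℕ) (x : ℝ) (k : ℕ) :
    Continuous fun y => pointPosition L x y k := by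
  unfold pointPosition
  split_ifs
  · exact continuous_apply _
  all_goals exact continuous_const

theorem continuous_orderedDiff (L : ℕ) (x : ℝ) (k m : ℕ) :
    Continuous fun y => orderedDiff (pointPosition L x y) k m := by
  unfold orderedDiff
  split_ifs
  · exact (continuous_pointPosition L x m).sub (continuous_pointPosition L x k)
  · exact (continuous_pointPosition L x k).sub (continuous_pointPosition L x m)

theorem mem_interior_selbergDomain {x : ℝ} {y : IntegratedLabel L → ℝ}
    (h : ∀ k m, 1 ≤ k → k < m → m ≤ L → 0 < orderedDiff (pointPosition L x y) k m) :
    y ∈ interior (selbergDomain L x) := by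
  refine mem_interior_iff_mem_nhds.2 ?_
  have h' : ∀ k ∈ Finset.Icc 1 L, ∀ m ∈ Finset.Icc (k + 1) L,
      ∀ᶠ y' in nhds y, 0 < orderedDiff (pointPosition L x y') k m := by
    intro k hk m hm
    rw [Finset.mem_Icc] at hk hm
    exact continuousAt_const.eventually_lt (continuous_orderedDiff L x k m).continuousAt
      (h k m hk.1 (by omega) hm.2)
  have h'' := (Filter.eventually_all_finset _).2 fun k hk =>
    (Filter.eventually_all_finset _).2 (h' k hk)
  filter_upwards [h''] with y' hy'
  exact mem_selbergDomain_of_orderedDiff_pos fun k m hk hkm hm =>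
    hy' k (by simp; omega) m (by simp; omega)

theorem continuousAt_componentFactor (hL : 4 ≤ L) (q : ComponentIndex L) (S : ℕ → ℕ → ℂ) {x : ℝ}
    {y : IntegratedLabel L → ℝ} (hinj : Set.InjOn (pointPosition L x y) (Finset.Icc 1 L)) :
    ContinuousAt (fun y => componentFactor L q S (pointPosition L x y)) y := by
  obtain ⟨h4, h5⟩ := componentLevel_mem L hL q
  set σ := relabel L (componentPerm L q) with hσ
  have hc : ∀ k, ContinuousAt (fun y => ((pointPosition L x y k : ℝ) : ℂ)) y := fun k =>
    (Complex.continuous_ofReal.comp (continuous_pointPosition L x k)).continuousAt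
  have hσm : ∀ k ∈ Finset.Icc 1 L, σ k ∈ Finset.Icc 1 L := by
    intro k hk
    by_cases h : k ∈ Finset.Icc 4 L
    · have := (relabel_mem_iff L (componentPerm L q)).2 h
      rw [← hσ] at this
      simp at this ⊢; omega
    · rw [hσ, relabel_of_notMem L _ h]; exact hk
  have hσ1 : σ 1 = 1 := relabel_of_notMem L _ (by simp)
  have hne : ∀ k j, k ∈ Finset.Icc 1 L → j ∈ Finset.Icc 1 L → k ≠ j →
      pointPosition L x y (σ k) - pointPosition L x y (σ j) ≠ 0 := fun k j hk hj hkj =>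
    sub_ne_zero.2 fun e => hkj (σ.injective (hinj (hσm k hk) (hσm j hj) e))
  have hd : ∀ k j, k ∈ Finset.Icc 1 L → j ∈ Finset.Icc 1 L → k ≠ j →
      ContinuousAt (fun y => S (σ k) (σ j) /
        ((pointPosition L x y (σ k) - pointPosition L x y (σ j) : ℝ) : ℂ)) y := by
    intro k j hk hj hkj
    refine continuousAt_const.div ?_ (by exact_mod_cast hne k j hk hj hkj)
    push_cast
    exact (hc _).sub (hc _)
  unfold componentFactor rationalFactor
  refine ContinuousAt.mul ?_ ?_
  · refine tendsto_finsetProd _ fun k hk => ContinuousAt.add ?_ ?_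
    · refine continuousAt_const.div (hc _) ?_
      have := hne k 1 (by simp at hk ⊢; omega) (by simp; omega) (by simp at hk; omega)
      rw [hσ1, pointPosition_one, sub_zero] at this
      exact_mod_cast this
    · refine tendsto_finsetSum _ fun j hj => hd k j ?_ ?_ ?_ <;> simp at hk hj ⊢ <;> omega
  · refine tendsto_finsetProd _ fun m hm => tendsto_finsetSum _ fun n hn => hd n m ?_ ?_ ?_ <;>
      simp at hm hn ⊢ <;> omega

/-- Concavity of the logarithm on the domain makes a critical point the strict global maximum.
Configurations with coinciding points have value 0 and are treated separately. -/
theorem realKobaNielsen_lt {x : ℝ} (hx0 : 0 < x) (hx1 : x < 1) {s : MandelstamIndex L → ℝ}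
    (hs : ∀ p, 0 < s p) {y₀ y : IntegratedLabel L → ℝ}
    (h₀ : ∀ k m, 1 ≤ k → k < m → m ≤ L → 0 < orderedDiff (pointPosition L x y₀) k m)
    (hcrit : ∀ k ∈ Finset.Icc 4 L, ∑ j ∈ Finset.Icc 1 L, mandelstam L s k j /
      (pointPosition L x y₀ k - pointPosition L x y₀ j) = 0)
    (hy : y ∈ selbergDomain L x) (hne : y ≠ y₀) :
    realKobaNielsen L (mandelstam L s) (pointPosition L x y) <
      realKobaNielsen L (mandelstam L s) (pointPosition L x y₀) := by
  set S := mandelstam L s with hS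
  set X₀ := pointPosition L x y₀ with hX₀
  set X := pointPosition L x y with hX
  have hd₀ : ∀ k ∈ Finset.Icc 1 L, ∀ m ∈ Finset.Icc (k + 1) L, 0 < |X₀ k - X₀ m| := by
    intro k hk m hm
    rw [Finset.mem_Icc] at hk hm
    rw [← abs_orderedDiff]
    exact abs_pos.2 (h₀ k m hk.1 (by omega) hm.2).ne'
  have hpos₀ : 0 < realKobaNielsen L S X₀ := Finset.prod_pos fun k hk => Finset.prod_pos fun m hm =>
    Real.rpow_pos_of_pos (hd₀ k hk m hm) _
  by_cases hd : ∀ k ∈ Finset.Icc 1 L, ∀ m ∈ Finset.Icc (k + 1) L, 0 < |X k - X m|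
  · have hpos : 0 < realKobaNielsen L S X := Finset.prod_pos fun k hk => Finset.prod_pos fun m hm =>
      Real.rpow_pos_of_pos (hd k hk m hm) _
    rw [← Real.log_lt_log_iff hpos hpos₀]
    have hlog : ∀ Z : ℕ → ℝ, (∀ k ∈ Finset.Icc 1 L, ∀ m ∈ Finset.Icc (k + 1) L, 0 < |Z k - Z m|) →
        Real.log (realKobaNielsen L S Z) = ∑ k ∈ Finset.Icc 1 L, ∑ m ∈ Finset.Icc (k + 1) L,
          S k m * Real.log |Z k - Z m| := by
      intro Z hZ
      unfold realKobaNielsen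
      rw [Real.log_prod fun k hk => (Finset.prod_pos fun m hm =>
        Real.rpow_pos_of_pos (hZ k hk m hm) _).ne']
      refine Finset.sum_congr rfl fun k hk => ?_
      rw [Real.log_prod fun m hm => (Real.rpow_pos_of_pos (hZ k hk m hm) _).ne']
      refine Finset.sum_congr rfl fun m hm => ?_
      rw [Real.log_rpow (hZ k hk m hm)]
    rw [hlog X hd, hlog X₀ hd₀]
    -- `log t ≤ t - 1`, and the linear terms cancel at the critical point
    set z : ℕ → ℕ → ℝ := fun k m => (X k - X₀ k) * (S k m / (X₀ k - X₀ m)) with hz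
    have hzsum : ∑ k ∈ Finset.Icc 1 L, ∑ m ∈ Finset.Icc (k + 1) L, (z k m + z m k) = 0 := by
      rw [sum_Icc_pairs L z (by simp [hz])]
      refine Finset.sum_eq_zero fun k hk => ?_
      simp only [hz, ← Finset.mul_sum]
      by_cases h4 : k ∈ Finset.Icc 4 L
      · rw [hcrit k h4, mul_zero]
      · have : X k = X₀ k := by
          rw [hX, hX₀, pointPosition, pointPosition, dif_neg h4, dif_neg h4]
        rw [this, sub_self, zero_mul]
    have hratio : ∀ k ∈ Finset.Icc 1 L, ∀ m ∈ Finset.Icc (k + 1) L,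
        S k m * (|X k - X m| / |X₀ k - X₀ m| - 1) = z k m + z m k := by
      intro k hk m hm
      have h1 := hd₀ k hk m hm
      have h2 : X₀ k - X₀ m ≠ 0 := abs_pos.1 h1
      have h2' : X₀ m - X₀ k ≠ 0 := by rw [← neg_sub]; exact neg_ne_zero.2 h2
      have hk' := Finset.mem_Icc.1 hk
      have hm' := Finset.mem_Icc.1 hm
      -- Both configurations have the same order, so the absolute values drop out and the ratio is
      -- affine in `X`.
      have e : |X k - X m| / |X₀ k - X₀ m| = (X k - X m) / (X₀ k - X₀ m) := by
        rw [← abs_orderedDiff X, ← abs_orderedDiff X₀,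
          abs_of_nonneg (orderedDiff_nonneg_of_mem hx0 hx1 hy hk'.1 (by omega) hm'.2),
          abs_of_pos (h₀ k m hk'.1 (by omega) hm'.2), orderedDiff_div]
      have hSs : S m k = S k m := mandelstam_symm L s m k
      rw [e, hz]
      simp only [hSs]
      rw [← neg_sub (X₀ k) (X₀ m)]
      field_simp
      ring
    have hle : ∀ k ∈ Finset.Icc 1 L, ∀ m ∈ Finset.Icc (k + 1) L,
        S k m * Real.log |X k - X m| ≤ S k m * Real.log |X₀ k - X₀ m| + (z k m + z m k) := by
      intro k hk m hm
      have h1 := hd₀ k hk m hm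
      have h2 := hd k hk m hm
      rw [← hratio k hk m hm, ← mul_add]
      refine mul_le_mul_of_nonneg_left ?_ (mandelstam_nonneg hs k m)
      have := Real.log_le_sub_one_of_pos (div_pos h2 h1)
      rw [Real.log_div h2.ne' h1.ne'] at this
      linarith
    -- Strictness comes from the pair (1, j): since x_1 = 0, its ratio is y_j / y₀_j, which differs
    -- from 1.
    obtain ⟨j, hj⟩ : ∃ j, y j ≠ y₀ j := Function.ne_iff.1 hne
    have hjL := Finset.mem_Icc.1 j.2
    have h1m : (1 : ℕ) ∈ Finset.Icc 1 L := by simp; omega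
    have hjm : (j : ℕ) ∈ Finset.Icc (1 + 1) L := by simp; omega
    have hlt : S 1 j * Real.log |X 1 - X j| <
        S 1 j * Real.log |X₀ 1 - X₀ j| + (z 1 j + z j 1) := by
      have h1 := hd₀ 1 h1m j hjm
      have h2 := hd 1 h1m j hjm
      rw [← hratio 1 h1m j hjm, ← mul_add]
      refine mul_lt_mul_of_pos_left ?_ (mandelstam_pos hs le_rfl (by omega) hjL.2)
      have hne' : |X 1 - X j| / |X₀ 1 - X₀ j| ≠ 1 := by
        rw [Ne, div_eq_one_iff_eq h1.ne', hX, hX₀, pointPosition_one, pointPosition_one,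
          pointPosition_coe, pointPosition_coe, zero_sub, zero_sub, abs_neg, abs_neg,
          abs_of_nonneg (hy.2 j).1]
        have := h₀ 1 j le_rfl (by omega) hjL.2
        rw [orderedDiff, if_pos rfl, hX₀, pointPosition_one, pointPosition_coe, sub_zero] at this
        rwa [abs_of_pos this]
      have := Real.log_lt_sub_one_of_pos (div_pos h2 h1) hne'
      rw [Real.log_div h2.ne' h1.ne'] at this
      linarith
    calc _ < ∑ k ∈ Finset.Icc 1 L, ∑ m ∈ Finset.Icc (k + 1) L,
          (S k m * Real.log |X₀ k - X₀ m| + (z k m + z m k)) :=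
          Finset.sum_lt_sum (fun k hk => Finset.sum_le_sum (hle k hk))
            ⟨1, h1m, Finset.sum_lt_sum (hle 1 h1m) ⟨j, hjm, hlt⟩⟩
      _ = _ := by
          simp_rw [Finset.sum_add_distrib (f := fun m => S _ m * Real.log |X₀ _ - X₀ m|)]
          rw [Finset.sum_add_distrib, hzsum, add_zero]
  · push Not at hd
    obtain ⟨k, hk, m, hm, hkm⟩ := hd
    refine lt_of_eq_of_lt ?_ hpos₀
    refine Finset.prod_eq_zero hk (Finset.prod_eq_zero hm ?_)
    rw [le_antisymm hkm (abs_nonneg _), Real.zero_rpow]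
    rw [Finset.mem_Icc] at hk hm
    exact (mandelstam_pos hs hk.1 (by omega) hm.2).ne'

/-- At the parameters (n + 1)s the relation says that the integral of c^n g vanishes, up to a power
of n + 1 coming from homogeneity. The normalized weights c^n concentrate at the strict maximum `y₀`,
so g vanishes there. -/
theorem relation_at_critical_point (hL : 4 ≤ L) {x : ℝ} (hx0 : 0 < x) (hx1 : x < 1)
    (R : ComponentIndex L → MandelstamIndex L → ℂ)
    (hR : ∀ s : MandelstamIndex L → ℂ, (∀ p, 0 < (s p).re) →
      ∑ q, (∑ p, R q p * s p) * selbergVector L s x q = 0)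
    {s : MandelstamIndex L → ℝ} (hs : ∀ p, 0 < s p) {y₀ : IntegratedLabel L → ℝ}
    (h₀ : ∀ k m, 1 ≤ k → k < m → m ≤ L → 0 < orderedDiff (pointPosition L x y₀) k m)
    (hcrit : ∀ k ∈ Finset.Icc 4 L, ∑ j ∈ Finset.Icc 1 L, mandelstam L s k j /
      (pointPosition L x y₀ k - pointPosition L x y₀ j) = 0) :
    ∑ q, (∑ p, R q p * (s p : ℂ)) * componentFactor L q (mandelstam L (fun p => (s p : ℂ)))
      (pointPosition L x y₀) = 0 := by
  set sc : MandelstamIndex L → ℂ := fun p => (s p : ℂ) with hsc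
  have hscre : ∀ p, 0 < (sc p).re := fun p => by simpa [hsc] using hs p
  set c : (IntegratedLabel L → ℝ) → ℝ := fun y =>
    realKobaNielsen L (mandelstam L s) (pointPosition L x y) with hc
  set g : (IntegratedLabel L → ℝ) → ℂ := fun y => ∑ q, (∑ p, R q p * sc p) *
    selbergIntegrand L (componentLevel L q) (componentPerm L q) sc x y with hg
  have hint : ∀ n : ℕ, ∫ y in selbergDomain L x, c y ^ n • g y = 0 := by
    intro n
    have hn0 : ((n : ℂ) + 1) ≠ 0 := by exact_mod_cast Nat.succ_ne_zero n
    have h := hR (fun p => ((n : ℂ) + 1) * sc p) fun p => by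
      have : (((n : ℂ) + 1) * sc p) = (((n + 1 : ℝ) * s p : ℝ) : ℂ) := by
        rw [hsc]; push_cast; ring
      rw [this, Complex.ofReal_re]
      exact mul_pos (by positivity) (hs p)
    have hF : ∀ q, selbergVector L (fun p => ((n : ℂ) + 1) * sc p) x q =
        ((n : ℂ) + 1) ^ (L - 3) * ∫ y in selbergDomain L x, c y ^ n •
          selbergIntegrand L (componentLevel L q) (componentPerm L q) sc x y := by
      intro q
      rw [selbergVector, selbergComponent, ← integral_const_mul]
      refine integral_congr_ae (Filter.Eventually.of_forall fun y => ?_)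
      have h1 := kobaNielsen_natCast_mul s (pointPosition L x y) n
      have h2 := componentFactor_mul hL q ((n : ℂ) + 1) (mandelstam L sc) (pointPosition L x y)
      have h3 : (fun k j => ((n : ℂ) + 1) * mandelstam L sc k j) =
          mandelstam L (fun p => ((n : ℂ) + 1) * sc p) := by
        funext k j
        exact (mandelstam_map (fun t : ℂ => ((n : ℂ) + 1) * t) (by simp) sc k j).symm
      rw [h3] at h2
      change kobaNielsen L _ _ * componentFactor L q _ _ = _ * (_ • (kobaNielsen L _ _ *
        componentFactor L q _ _))
      rw [h1, h2, Complex.real_smul]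
      ring
    have hcint : ∀ q, IntegrableOn (fun y => c y ^ n •
        selbergIntegrand L (componentLevel L q) (componentPerm L q) sc x y)
        (selbergDomain L x) := by
      intro q
      have hi := integrableOn_selbergIntegrand hL (s := fun p => ((n : ℂ) + 1) * sc p)
        (fun p => by
          have : (((n : ℂ) + 1) * sc p) = (((n + 1 : ℝ) * s p : ℝ) : ℂ) := by
            rw [hsc]; push_cast; ring
          rw [this, Complex.ofReal_re]
          exact mul_pos (by positivity) (hs p)) hx0 hx1 q
      refine (hi.const_mul (((n : ℂ) + 1) ^ (L - 3))⁻¹).congr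
        (Filter.Eventually.of_forall fun y => ?_)
      have h1 := kobaNielsen_natCast_mul s (pointPosition L x y) n
      have h2 := componentFactor_mul hL q ((n : ℂ) + 1) (mandelstam L sc) (pointPosition L x y)
      have h3 : (fun k j => ((n : ℂ) + 1) * mandelstam L sc k j) =
          mandelstam L (fun p => ((n : ℂ) + 1) * sc p) := by
        funext k j
        exact (mandelstam_map (fun t : ℂ => ((n : ℂ) + 1) * t) (by simp) sc k j).symm
      rw [h3] at h2
      change _ * (kobaNielsen L _ _ * componentFactor L q _ _) = _ • (kobaNielsen L _ _ *
        componentFactor L q _ _)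
      rw [h1, h2, Complex.real_smul]
      have hne : ((n : ℂ) + 1) ^ (L - 3) ≠ 0 := pow_ne_zero _ hn0
      have hcancel : ∀ a b d : ℂ, (((n : ℂ) + 1) ^ (L - 3))⁻¹ *
          (a * b * (((n : ℂ) + 1) ^ (L - 3) * d)) = a * (b * d) := fun a b d => by
        field_simp
      exact hcancel _ _ _
    have hpull : ∀ q, (fun y => c y ^ n • ((∑ p, R q p * sc p) *
        selbergIntegrand L (componentLevel L q) (componentPerm L q) sc x y)) =
        fun y => (∑ p, R q p * sc p) * (c y ^ n •
          selbergIntegrand L (componentLevel L q) (componentPerm L q) sc x y) :=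
      fun q => funext fun y => (mul_smul_comm (c y ^ n) _ _).symm
    simp only [hg, Finset.smul_sum]
    rw [integral_finsetSum]
    · have hne : ((n : ℂ) + 1) * ((n : ℂ) + 1) ^ (L - 3) ≠ 0 :=
        mul_ne_zero hn0 (pow_ne_zero _ hn0)
      refine (mul_eq_zero.1 ?_).resolve_left hne
      rw [← h, Finset.mul_sum]
      refine Finset.sum_congr rfl fun q _ => ?_
      have : ∑ p, R q p * (((n : ℂ) + 1) * sc p) = ((n : ℂ) + 1) * ∑ p, R q p * sc p := by
        rw [Finset.mul_sum]
        exact Finset.sum_congr rfl fun p _ => by ring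
      rw [hF, this]
      rw [hpull, integral_const_mul]
      ring
    · intro q _
      rw [hpull]
      exact (hcint q).const_mul _
  have hinj := injOn_of_orderedDiff_pos h₀
  have hmem := mem_interior_selbergDomain h₀
  have hccont : Continuous c := by
    refine continuous_finsetProd _ fun k _ => continuous_finsetProd _ fun m _ => ?_
    exact Continuous.rpow_const ((continuous_pointPosition L x k).sub
      (continuous_pointPosition L x m)).abs fun _ => Or.inr (mandelstam_nonneg hs k m)
  have hcpos : 0 < c y₀ := by
    refine Finset.prod_pos fun k hk => Finset.prod_pos fun m hm => Real.rpow_pos_of_pos ?_ _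
    rw [Finset.mem_Icc] at hk hm
    rw [← abs_orderedDiff]
    exact abs_pos.2 (h₀ k m hk.1 (by omega) hm.2).ne'
  have hgint : IntegrableOn g (selbergDomain L x) :=
    integrable_finsetSum _ fun q _ =>
      (integrableOn_selbergIntegrand hL hscre hx0 hx1 q).const_mul _
  have hKN : ∀ y, kobaNielsen L (mandelstam L sc) (pointPosition L x y) = (c y : ℂ) := by
    intro y
    simp only [hc, kobaNielsen, realKobaNielsen]
    rw [Complex.ofReal_prod]
    refine Finset.prod_congr rfl fun k _ => ?_
    rw [Complex.ofReal_prod]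
    refine Finset.prod_congr rfl fun m _ => ?_
    rw [Complex.ofReal_cpow (abs_nonneg _)]
    congr 1
    exact mandelstam_map (fun t : ℝ => (t : ℂ)) (by simp) s k m
  have hgcont : ContinuousAt g y₀ := by
    refine tendsto_finsetSum _ fun q _ => ContinuousAt.mul continuousAt_const ?_
    change ContinuousAt (fun y => kobaNielsen L (mandelstam L sc) (pointPosition L x y) *
      componentFactor L q (mandelstam L sc) (pointPosition L x y)) y₀
    simp_rw [hKN]
    exact (Complex.continuous_ofReal.comp hccont).continuousAt.mul
      (continuousAt_componentFactor hL q _ hinj)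
  -- The peak function theorem: the weighted means of `g` converge to `g y₀`, yet each of them is
  -- zero.
  have hlim := tendsto_setIntegral_pow_smul_of_unique_maximum_of_isCompact_of_integrableOn
    (μ := volume) (isCompact_selbergDomain L x) hccont.continuousOn
    (fun y hy hne => realKobaNielsen_lt hx0 hx1 hs h₀ hcrit hy hne)
    (fun y _ => Finset.prod_nonneg fun k _ => Finset.prod_nonneg fun m _ =>
      Real.rpow_nonneg (abs_nonneg _) _) hcpos (subset_closure hmem) hgint
    hgcont.continuousWithinAt
  simp_rw [hint, smul_zero] at hlim
  have hg0 : g y₀ = 0 := tendsto_nhds_unique hlim tendsto_const_nhds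
  have hg1 : g y₀ = (c y₀ : ℂ) * ∑ q, (∑ p, R q p * sc p) *
      componentFactor L q (mandelstam L sc) (pointPosition L x y₀) := by
    rw [hg, Finset.mul_sum]
    refine Finset.sum_congr rfl fun q _ => ?_
    change _ * (kobaNielsen L (mandelstam L sc) (pointPosition L x y₀) *
      componentFactor L q (mandelstam L sc) (pointPosition L x y₀)) = _
    rw [hKN]
    ring
  rw [hg1] at hg0
  exact (mul_eq_zero.1 hg0).resolve_left (by exact_mod_cast hcpos.ne')

end CriticalPoint

/-! ### From critical points to arbitrary circulations -/

section Circulations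

/-- The labels in the order in which the chains `x_2, …` and `…, x_1` of a component list them:
position `3` carries the label `2` and position `L + 1` the label `1`. -/
def positionLabel (L : ℕ) (q : ComponentIndex L) : Equiv.Perm ℕ :=
  relabel L (componentPerm L q) * (Equiv.swap 2 3 * Equiv.swap 1 (L + 1))

theorem positionLabel_three {L : ℕ} (hL : 4 ≤ L) (q : ComponentIndex L) :
    positionLabel L q 3 = 2 := by
  rw [positionLabel, Equiv.Perm.mul_apply, Equiv.Perm.mul_apply,
    Equiv.swap_apply_of_ne_of_ne (a := 1) (by omega) (by omega), Equiv.swap_apply_right,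
    relabel_of_notMem L _ (by simp)]

theorem positionLabel_two {L : ℕ} (hL : 4 ≤ L) (q : ComponentIndex L) :
    positionLabel L q 2 = 3 := by
  rw [positionLabel, Equiv.Perm.mul_apply, Equiv.Perm.mul_apply,
    Equiv.swap_apply_of_ne_of_ne (a := 1) (by omega) (by omega), Equiv.swap_apply_left,
    relabel_of_notMem L _ (by simp)]

theorem positionLabel_last {L : ℕ} (q : ComponentIndex L) :
    positionLabel L q (L + 1) = 1 := by
  rw [positionLabel, Equiv.Perm.mul_apply, Equiv.Perm.mul_apply, Equiv.swap_apply_right,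
    Equiv.swap_apply_of_ne_of_ne (by omega) (by omega), relabel_of_notMem L _ (by simp)]

theorem positionLabel_of_mem {L : ℕ} (q : ComponentIndex L) {k : ℕ} (hk : k ∈ Finset.Icc 4 L) :
    positionLabel L q k = relabel L (componentPerm L q) k := by
  rw [Finset.mem_Icc] at hk
  rw [positionLabel, Equiv.Perm.mul_apply, Equiv.Perm.mul_apply,
    Equiv.swap_apply_of_ne_of_ne (a := 1) (by omega) (by omega),
    Equiv.swap_apply_of_ne_of_ne (by omega) (by omega)]

/-- The rational factor of a component as a polynomial in the quotients `c_{kj} = s_{kj} / x_{kj}`. -/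
def chainProduct (L : ℕ) (q : ComponentIndex L) (c : ℕ → ℕ → ℝ) : ℝ :=
  (∏ p ∈ Finset.Icc (componentLevel L q) L,
      ∑ r ∈ Finset.Icc (p + 1) (L + 1), c (positionLabel L q p) (positionLabel L q r)) *
    ∏ p ∈ Finset.Ico 4 (componentLevel L q),
      ∑ r ∈ Finset.Ico 3 p, c (positionLabel L q r) (positionLabel L q p)

theorem componentFactor_eq_chainProduct {L : ℕ} (hL : 4 ≤ L) (q : ComponentIndex L)
    {S : ℕ → ℕ → ℂ} (hS : ∀ k j, S k j = S j k) {X : ℕ → ℝ} (h1 : X 1 = 0) {c : ℕ → ℕ → ℝ}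
    (hc : ∀ k ∈ Finset.Icc 1 L, ∀ j ∈ Finset.Icc 1 L, k ≠ j →
      S k j / ((X k - X j : ℝ) : ℂ) = c k j) :
    componentFactor L q S X = chainProduct L q c := by
  obtain ⟨h4, h5⟩ := componentLevel_mem L hL q
  have r1 : relabel L (componentPerm L q) 1 = 1 := relabel_of_notMem L _ (by simp)
  have r2 : relabel L (componentPerm L q) 2 = 2 := relabel_of_notMem L _ (by simp)
  have hmem : ∀ k ∈ Finset.Icc 4 L, relabel L (componentPerm L q) k ∈ Finset.Icc 4 L :=
    fun k hk => (relabel_mem_iff L _).2 hk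
  have hsub : ∀ k ∈ Finset.Icc 4 L, k ∈ Finset.Icc 1 L := fun k hk => by
    rw [Finset.mem_Icc] at hk ⊢; omega
  rw [componentFactor, rationalFactor, chainProduct]
  push_cast at hc ⊢
  congr 1
  · refine Finset.prod_congr rfl fun k hk => ?_
    rw [Finset.mem_Icc] at hk
    have hk4 : k ∈ Finset.Icc 4 L := by rw [Finset.mem_Icc]; omega
    have := Finset.mem_Icc.1 (hmem k hk4)
    rw [← Finset.insert_Icc_right_eq_Icc_add_one (by omega), Finset.sum_insert (by simp),
      positionLabel_last, positionLabel_of_mem q hk4, r1,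
      ← hc _ (hsub _ (hmem k hk4)) 1 (by simp; omega) (by omega), h1, Complex.ofReal_zero, sub_zero, hS]
    congr 1
    refine Finset.sum_congr rfl fun j hj => ?_
    rw [Finset.mem_Icc] at hj
    have hj4 : j ∈ Finset.Icc 4 L := by rw [Finset.mem_Icc]; omega
    rw [positionLabel_of_mem q hj4]
    exact hc _ (hsub _ (hmem k hk4)) _ (hsub _ (hmem j hj4))
      ((relabel L _).injective.ne (by omega))
  · refine Finset.prod_congr rfl fun m hm => ?_
    rw [Finset.mem_Ico] at hm
    have hm4 : m ∈ Finset.Icc 4 L := by rw [Finset.mem_Icc]; omega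
    have := Finset.mem_Icc.1 (hmem m hm4)
    have e1 : (Finset.Ico 2 m).erase 3 = insert 2 (Finset.Ico 4 m) := by
      ext; simp; omega
    have e2 : Finset.Ico 3 m = insert 3 (Finset.Ico 4 m) := by
      ext; simp; omega
    rw [e1, e2, Finset.sum_insert (by simp), Finset.sum_insert (by simp), r2,
      positionLabel_three hL, positionLabel_of_mem q hm4,
      hc 2 (by simp; omega) _ (hsub _ (hmem m hm4)) (by omega)]
    congr 1
    refine Finset.sum_congr rfl fun j hj => ?_
    rw [Finset.mem_Ico] at hj
    have hj4 : j ∈ Finset.Icc 4 L := by rw [Finset.mem_Icc]; omega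
    rw [positionLabel_of_mem q hj4]
    exact hc _ (hsub _ (hmem j hj4)) _ (hsub _ (hmem m hm4))
      ((relabel L _).injective.ne (by omega))

theorem sum_mandelstamIndex {M : Type*} [AddCommMonoid M] (L : ℕ) (f : ℕ → ℕ → M) :
    ∑ p : MandelstamIndex L, f p.1.1 p.1.2 =
      ∑ k ∈ Finset.Icc 1 L, ∑ m ∈ Finset.Icc (k + 1) L, f k m := by
  rw [Finset.sum_sigma']
  refine Finset.sum_bij (fun p _ => ⟨p.1.1, p.1.2⟩) ?_ ?_ ?_ ?_
  · rintro ⟨⟨k, m⟩, h⟩ _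
    simp at h ⊢
    omega
  · rintro ⟨⟨k, m⟩, h⟩ _ ⟨⟨k', m'⟩, h'⟩ _ e
    simp at e
    simp [e]
  · rintro ⟨k, m⟩ h
    simp at h
    exact ⟨⟨(k, m), by omega⟩, Finset.mem_univ _, rfl⟩
  · intros; rfl

theorem mandelstam_mk {R : Type*} [Zero R] (L : ℕ) (s : MandelstamIndex L → R)
    (p : MandelstamIndex L) : mandelstam L s p.1.1 p.1.2 = s p := by
  rw [mandelstam, dif_pos p.2]

/-- The value of a linear form with coefficients `R` at `s_{kj} = c_{kj} x_{kj}`, counting every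
pair twice. -/
noncomputable def pairing (L : ℕ) (R : MandelstamIndex L → ℂ) (c : ℕ → ℕ → ℝ) (X : ℕ → ℝ) : ℂ :=
  ∑ k ∈ Finset.Icc 1 L, ∑ j ∈ Finset.Icc 1 L,
    mandelstam L R k j * ((c k j * (X k - X j) : ℝ) : ℂ)

theorem pairing_eq {L : ℕ} (R : MandelstamIndex L → ℂ) {c : ℕ → ℕ → ℝ}
    (hc : ∀ k j, c k j = -c j k) (X : ℕ → ℝ) :
    pairing L R c X = 2 * ∑ p : MandelstamIndex L, R p *
      ((c p.1.1 p.1.2 * (X p.1.1 - X p.1.2) : ℝ) : ℂ) := by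
  rw [pairing, ← sum_Icc_pairs L (fun k j => mandelstam L R k j *
    ((c k j * (X k - X j) : ℝ) : ℂ)) (fun k => by simp), ← sum_mandelstamIndex L
      (fun k m => mandelstam L R k m * ((c k m * (X k - X m) : ℝ) : ℂ) +
        mandelstam L R m k * ((c m k * (X m - X k) : ℝ) : ℂ)), Finset.mul_sum]
  refine Finset.sum_congr rfl fun p _ => ?_
  rw [mandelstam_symm L R p.1.2, mandelstam_mk, hc p.1.2]
  push_cast
  ring

/-- Half of a circulation all of whose quotients `s_{kj} / x_{kj}` have the sign of `x_{kj}`. -/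
noncomputable def halfCirculation (L k j : ℕ) : ℝ :=
  (if k < j then 1 else 0) + (if j = 1 then 2 * (k : ℝ) - 2 else 0) +
    (if j = 3 ∧ 4 ≤ k then 1 - (L : ℝ) else 0)

/-- The order comparison contributes (L - k) - (k - 1) at `k`; the entries 2k - 2 towards label 1
and 1 - L towards label 3 compensate for it. -/
theorem sum_halfCirculation {L k : ℕ} (hk : k ∈ Finset.Icc 4 L) :
    ∑ j ∈ Finset.Icc 1 L, (halfCirculation L k j - halfCirculation L j k) = 0 := by
  rw [Finset.mem_Icc] at hk
  have h1 : ∀ j, halfCirculation L k j - halfCirculation L j k =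
      ((if k < j then 1 else 0) - (if j < k then 1 else 0)) +
        (if j = 1 then 2 * (k : ℝ) - 2 else 0) + (if j = 3 then 1 - (L : ℝ) else 0) := by
    intro j
    have e1 : (j = 3 ∧ 4 ≤ k) ↔ j = 3 := ⟨fun h => h.1, fun h => ⟨h, hk.1⟩⟩
    simp only [halfCirculation, e1]
    rw [if_neg (show ¬ k = 1 by omega), if_neg (show ¬ (k = 3 ∧ 4 ≤ j) by omega)]
    ring
  have e2 : (Finset.Icc 1 L).filter (fun j => k < j) = Finset.Ioc k L := by
    ext; simp; omega
  have e3 : (Finset.Icc 1 L).filter (fun j => j < k) = Finset.Ico 1 k := by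
    ext; simp; omega
  simp_rw [h1]
  rw [Finset.sum_add_distrib, Finset.sum_add_distrib, Finset.sum_sub_distrib, Finset.sum_boole,
    Finset.sum_boole, e2, e3, Nat.card_Ioc, Nat.card_Ico, Finset.sum_ite_eq' _ 1,
    Finset.sum_ite_eq' _ 3, if_pos (by simp; omega), if_pos (by simp; omega),
    Nat.cast_sub hk.2, Nat.cast_sub (by omega)]
  push_cast
  ring

theorem pointPosition_orderedDiff_pos {L : ℕ} (hL : 4 ≤ L) {x : ℝ} (hx0 : 0 < x) (hx1 : x < 1)
    {y : IntegratedLabel L → ℝ} (hy : ∀ j : IntegratedLabel L, y j = x * (L + 1 - (j : ℕ)) / L)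
    {k m : ℕ} (hk : 1 ≤ k) (hkm : k < m) (hm : m ≤ L) :
    0 < orderedDiff (pointPosition L x y) k m := by
  have hLpos : (0 : ℝ) < L := by exact_mod_cast (by omega : 0 < L)
  have hX : ∀ j, 4 ≤ j → j ≤ L → pointPosition L x y j = x * (L + 1 - j) / L := by
    intro j h4 h5
    rw [pointPosition, dif_pos (Finset.mem_Icc.2 ⟨h4, h5⟩), hy]
  have hXpos : ∀ j, 4 ≤ j → j ≤ L → 0 < pointPosition L x y j := by
    intro j h4 h5
    have : (j : ℝ) ≤ L := by exact_mod_cast h5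
    rw [hX j h4 h5]
    exact div_pos (mul_pos hx0 (by linarith)) hLpos
  have hXlt : ∀ j, 4 ≤ j → j ≤ L → pointPosition L x y j < x := by
    intro j h4 h5
    have : (4 : ℝ) ≤ j := by exact_mod_cast h4
    rw [hX j h4 h5, div_lt_iff₀ hLpos]
    exact mul_lt_mul_of_pos_left (by linarith) hx0
  rw [orderedDiff]
  rcases (by omega : k = 1 ∨ k = 2 ∨ k = 3 ∨ 4 ≤ k) with rfl | rfl | rfl | h4
  · rw [if_pos rfl, pointPosition_one, sub_zero]
    rcases (by omega : m = 2 ∨ m = 3 ∨ 4 ≤ m) with rfl | rfl | h4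
    · rw [pointPosition_two]; exact one_pos
    · rwa [pointPosition_three]
    · exact hXpos m h4 hm
  · rw [if_neg (by omega), pointPosition_two]
    rcases (by omega : m = 3 ∨ 4 ≤ m) with rfl | h4
    · rw [pointPosition_three]; linarith
    · linarith [hXlt m h4 hm]
  · rw [if_neg (by omega), pointPosition_three]
    linarith [hXlt m hkm hm]
  · rw [if_neg (by omega), hX k h4 (by omega), hX m (by omega) hm, ← sub_div, ← mul_sub]
    have : (k : ℝ) < m := by exact_mod_cast hkm
    exact div_pos (mul_pos hx0 (by linarith)) hLpos

/-- For k < m the entry is 3 - 2m < 0 if k = 1, it is L if k = 3, and it is 1 otherwise. This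
matches the order of the points, in which only x_1 lies below the later labels. -/
theorem halfCirculation_mul_pos {L : ℕ} (hL : 4 ≤ L) {X : ℕ → ℝ} {k m : ℕ} (hk : 1 ≤ k)
    (hkm : k < m) (h : 0 < orderedDiff X k m) :
    0 < (halfCirculation L k m - halfCirculation L m k) * (X k - X m) := by
  have hL' : (4 : ℝ) ≤ L := by exact_mod_cast hL
  have hm' : (2 : ℝ) ≤ m := by exact_mod_cast (by omega : 2 ≤ m)
  rw [orderedDiff] at h
  simp only [halfCirculation]
  rw [if_pos hkm, if_neg (show ¬ m = 1 by omega), if_neg (show ¬ (m = 3 ∧ 4 ≤ k) by omega),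
    if_neg (show ¬ m < k by omega)]
  by_cases h1 : k = 1
  · rw [if_pos h1] at h ⊢
    rw [if_neg (show ¬ (k = 3 ∧ 4 ≤ m) by omega)]
    exact mul_pos_of_neg_of_neg (by linarith) (by linarith)
  · rw [if_neg h1] at h ⊢
    refine mul_pos ?_ h
    split_ifs <;> linarith

/-- A linear relation between the components holds with arbitrary real numbers satisfying the
critical point equations in place of the quotients `s_{kj} / x_{kj}`. -/
theorem sum_pairing_mul_chainProduct {L : ℕ} (hL : 4 ≤ L) {x : ℝ} (hx0 : 0 < x) (hx1 : x < 1)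
    (R : ComponentIndex L → MandelstamIndex L → ℂ)
    (hR : ∀ s : MandelstamIndex L → ℂ, (∀ p, 0 < (s p).re) →
      ∑ q, (∑ p, R q p * s p) * selbergVector L s x q = 0)
    {c : ℕ → ℕ → ℝ} (hc : ∀ k j, c k j = -c j k)
    (hsum : ∀ k ∈ Finset.Icc 4 L, ∑ j ∈ Finset.Icc 1 L, c k j = 0)
    {X : ℕ → ℝ} (hX1 : X 1 = 0) (hX2 : X 2 = 1) (hX3 : X 3 = x) :
    ∑ q, pairing L (R q) c X * (chainProduct L q c : ℂ) = 0 := by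
  -- A base point with positive s_{kj} = c_{kj} x_{kj}. From it a line leads to the given pair `c`,
  -- `X`; all its points are critical because the equations are linear in `c` and free of `X`.
  set c₀ : ℕ → ℕ → ℝ := fun k j => halfCirculation L k j - halfCirculation L j k with hc₀
  set y₀ : IntegratedLabel L → ℝ := fun j => x * (L + 1 - (j : ℕ)) / L with hy₀
  set cτ : ℝ → ℕ → ℕ → ℝ := fun τ k j => c₀ k j + τ * (c k j - c₀ k j) with hcτ
  set yτ : ℝ → IntegratedLabel L → ℝ := fun τ k => y₀ k + τ * (X k - y₀ k) with hyτ
  set Xτ : ℝ → ℕ → ℝ := fun τ k => pointPosition L x (yτ τ) k with hXτ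
  have hXτ_eq : ∀ k ∈ Finset.Icc 1 L, ∀ τ, Xτ τ k =
      pointPosition L x y₀ k + τ * (X k - pointPosition L x y₀ k) := by
    intro k hk τ
    rw [Finset.mem_Icc] at hk
    simp only [hXτ]
    rcases (by omega : k = 1 ∨ k = 2 ∨ k = 3 ∨ 4 ≤ k) with rfl | rfl | rfl | h4
    · simp [pointPosition_one, hX1]
    · simp [pointPosition_two, hX2]
    · simp [pointPosition_three, hX3]
    · have hk4 : k ∈ Finset.Icc 4 L := Finset.mem_Icc.2 ⟨h4, hk.2⟩
      rw [pointPosition_of_mem L x _ hk4, pointPosition_of_mem L x _ hk4]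
  have hcτ_skew : ∀ τ k j, cτ τ k j = -cτ τ j k := by
    intro τ k j
    simp only [hcτ, hc₀]
    rw [hc k j]
    ring
  have hcτ_sum : ∀ τ, ∀ k ∈ Finset.Icc 4 L, ∑ j ∈ Finset.Icc 1 L, cτ τ k j = 0 := by
    intro τ k hk
    have h0 : ∑ j ∈ Finset.Icc 1 L, c₀ k j = 0 := sum_halfCirculation hk
    simp only [hcτ]
    rw [Finset.sum_add_distrib, ← Finset.mul_sum, Finset.sum_sub_distrib (f := c k), hsum k hk,
      h0]
    ring
  set f : ℝ → ℂ := fun τ => ∑ q, (∑ p : MandelstamIndex L, R q p *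
    ((cτ τ p.1.1 p.1.2 * (Xτ τ p.1.1 - Xτ τ p.1.2) : ℝ) : ℂ)) * (chainProduct L q (cτ τ) : ℂ)
    with hf
  have hcont : ∀ k ∈ Finset.Icc 1 L, Continuous fun τ => Xτ τ k := by
    intro k hk
    simp_rw [hXτ_eq k hk]
    fun_prop
  have hccont : ∀ k j, Continuous fun τ => cτ τ k j := by
    intro k j
    simp only [hcτ]
    fun_prop
  -- Order of the points and positivity of all s_{kj} are open conditions, so near τ = 0 the
  -- relation at critical points applies.
  have hzero : ∀ᶠ τ in nhds (0 : ℝ), f τ = 0 := by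
    have hord : ∀ᶠ τ in nhds (0 : ℝ), ∀ p : MandelstamIndex L,
        0 < orderedDiff (Xτ τ) p.1.1 p.1.2 ∧
          0 < cτ τ p.1.1 p.1.2 * (Xτ τ p.1.1 - Xτ τ p.1.2) := by
      refine Filter.eventually_all.2 fun p => ?_
      obtain ⟨⟨k, m⟩, hk, hkm, hm⟩ := p
      dsimp only at hk hkm hm ⊢
      have hck := hcont k (Finset.mem_Icc.2 (by omega))
      have hcm := hcont m (Finset.mem_Icc.2 (by omega))
      have hX0 : Xτ 0 = pointPosition L x y₀ := by
        simp only [hXτ, hyτ, zero_mul, add_zero]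
      have hpos := pointPosition_orderedDiff_pos hL hx0 hx1 (y := y₀) (fun _ => rfl) hk hkm hm
      refine Filter.Eventually.and ?_ ?_
      · have hoc : Continuous fun τ => orderedDiff (Xτ τ) k m := by
          unfold orderedDiff
          split_ifs
          · exact hcm.sub hck
          · exact hck.sub hcm
        refine hoc.continuousAt.eventually (lt_mem_nhds ?_)
        rwa [← hX0] at hpos
      · refine (((hccont k m).mul (hck.sub hcm)).continuousAt (x := 0)).eventually
          (lt_mem_nhds ?_)
        change 0 < cτ 0 k m * (Xτ 0 k - Xτ 0 m)
        rw [hX0]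
        have := halfCirculation_mul_pos hL hk hkm hpos
        simpa [hcτ, hc₀] using this
    filter_upwards [hord] with τ hτ
    have h₀ : ∀ k m, 1 ≤ k → k < m → m ≤ L → 0 < orderedDiff (Xτ τ) k m :=
      fun k m hk hkm hm => (hτ ⟨(k, m), hk, hkm, hm⟩).1
    set s : MandelstamIndex L → ℝ := fun p => cτ τ p.1.1 p.1.2 * (Xτ τ p.1.1 - Xτ τ p.1.2)
      with hs
    have hinj := injOn_of_orderedDiff_pos h₀
    have hS : ∀ k ∈ Finset.Icc 1 L, ∀ j ∈ Finset.Icc 1 L, k ≠ j →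
        mandelstam L s k j / (Xτ τ k - Xτ τ j) = cτ τ k j := by
      intro k hk j hj hkj
      have hne : Xτ τ k - Xτ τ j ≠ 0 := sub_ne_zero.2 fun h => hkj (hinj hk hj h)
      rw [Finset.mem_Icc] at hk hj
      rw [div_eq_iff hne]
      rcases lt_or_gt_of_ne hkj with h | h
      · rw [mandelstam, dif_pos (by omega)]
      · rw [mandelstam, dif_neg (by omega), dif_pos (by omega), hs]
        dsimp only
        rw [hcτ_skew τ j k]
        ring
    have hcrit : ∀ k ∈ Finset.Icc 4 L, ∑ j ∈ Finset.Icc 1 L, mandelstam L s k j /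
        (Xτ τ k - Xτ τ j) = 0 := by
      intro k hk
      rw [← hcτ_sum τ k hk]
      refine Finset.sum_congr rfl fun j hj => ?_
      rw [Finset.mem_Icc] at hk
      rcases eq_or_ne k j with rfl | hkj
      · have := hcτ_skew τ k k
        rw [sub_self, div_zero]
        linarith
      · exact hS k (Finset.mem_Icc.2 (by omega)) j hj hkj
    have hrel := relation_at_critical_point hL hx0 hx1 R hR (s := s) (fun p => (hτ p).2) h₀ hcrit
    rw [← hrel, hf]
    refine Finset.sum_congr rfl fun q _ => ?_
    rw [componentFactor_eq_chainProduct hL q (mandelstam_symm L _) (pointPosition_one L x _)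
      (c := cτ τ)]
    intro k hk j hj hkj
    have := mandelstam_map (fun t : ℝ => (t : ℂ)) (by simp) s k j
    rw [this, ← Complex.ofReal_div]
    exact congrArg _ (hS k hk j hj hkj)
  have hreal : ∀ g : ℝ → ℝ, AnalyticOnNhd ℝ g Set.univ →
      AnalyticOnNhd ℝ (fun τ => (g τ : ℂ)) Set.univ := fun g hg τ hτ =>
    (Complex.ofRealCLM.analyticAt (g τ)).comp (hg τ hτ)
  have hcan : ∀ k j, AnalyticOnNhd ℝ (fun τ => cτ τ k j) Set.univ := by
    intro k j
    simp only [hcτ]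
    exact fun τ _ => by fun_prop
  have han : AnalyticOnNhd ℝ f Set.univ := by
    refine Finset.analyticOnNhd_fun_sum _ fun q _ => AnalyticOnNhd.mul ?_ (hreal _ ?_)
    · refine Finset.analyticOnNhd_fun_sum _ fun p _ =>
        AnalyticOnNhd.mul analyticOnNhd_const (hreal _ ((hcan _ _).mul ?_))
      have h1 := p.2
      simp_rw [hXτ_eq p.1.1 (Finset.mem_Icc.2 (by omega)),
        hXτ_eq p.1.2 (Finset.mem_Icc.2 (by omega))]
      exact fun τ _ => by fun_prop
    · exact (Finset.analyticOnNhd_fun_prod _ fun k _ => Finset.analyticOnNhd_fun_sum _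
        fun j _ => hcan _ _).mul (Finset.analyticOnNhd_fun_prod _ fun k _ =>
          Finset.analyticOnNhd_fun_sum _ fun j _ => hcan _ _)
  have hf1 : f 1 = 0 := by
    -- The identity theorem carries the relation to τ = 1, where neither positivity nor distinctness
    -- of the points is left.
    have := han.eq_of_eventuallyEq (analyticOnNhd_const (v := (0 : ℂ))) (z₀ := 0) hzero
    rw [this]
  have hc1 : cτ 1 = c := by
    funext k j
    simp [hcτ]
  rw [← mul_zero (2 : ℂ), ← hf1, hf, Finset.mul_sum]
  refine Finset.sum_congr rfl fun q _ => ?_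
  rw [pairing_eq _ hc, hc1, mul_assoc]
  congr 2
  refine Finset.sum_congr rfl fun p _ => ?_
  have h1 := p.2
  rw [hXτ_eq p.1.1 (Finset.mem_Icc.2 (by omega)), hXτ_eq p.1.2 (Finset.mem_Icc.2 (by omega))]
  congr 4 <;> ring

end Circulations

/-! ### Which chain products survive for a given support -/

section ChainOrder

/-- If every position of the upper chain has a neighbour closer to the root, and no edge jumps over
the position `b`, then all positions below `b` are listed before `b`. -/
theorem upper_chain_lt {L i i₀ b : ℕ} {ρ : ℕ → ℕ} {d : ℕ → ℕ → Prop} (hi₀ : 4 ≤ i₀)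
    (hρ : ∀ a ∈ Finset.Icc 3 (L + 1), ρ a ∈ Finset.Icc 3 (L + 1)) (hlast : ρ (L + 1) = L + 1)
    (hup : ∀ a ∈ Finset.Icc 4 L, i ≤ ρ a → ∃ r ∈ Finset.Icc 3 (L + 1), ρ a < ρ r ∧ d a r)
    (hdown : ∀ a ∈ Finset.Icc 4 L, ρ a < i → ∃ r ∈ Finset.Icc 3 (L + 1), ρ r < ρ a ∧ d a r)
    (hside : ∀ a ∈ Finset.Icc 4 L, ∀ r ∈ Finset.Icc 3 (L + 1), d a r → i₀ ≤ a → i₀ ≤ r)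
    (hb : b ≤ L + 1)
    (hjump : ∀ a ∈ Finset.Icc 4 L, ∀ r ∈ Finset.Icc 3 (L + 1), d a r → i₀ ≤ a → a < b → r ≤ b)
    {a : ℕ} (ha : i₀ ≤ a) (hab : a < b) : i ≤ ρ a ∧ ρ a < ρ b := by
  -- Otherwise neighbours with ever smaller ρ could be followed forever: they stay above `i₀` and
  -- cannot be the root L + 1, where ρ is maximal.
  have hle : ∀ n a, ρ a = n → i₀ ≤ a → a ≤ L → i ≤ ρ a := by
    intro n
    induction n using Nat.strong_induction_on with
    | _ n ih =>
      intro a han ha haL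
      by_contra! hlt
      obtain ⟨r, hr, hra, hd⟩ := hdown a (Finset.mem_Icc.2 (by omega)) hlt
      have hir := hside a (Finset.mem_Icc.2 (by omega)) r hr hd ha
      rw [Finset.mem_Icc] at hr
      have hrL : r ≤ L := by
        by_contra! h
        have : r = L + 1 := by omega
        have := Finset.mem_Icc.1 (hρ a (Finset.mem_Icc.2 (by omega)))
        rw [‹r = L + 1›, hlast] at hra
        omega
      have := ih (ρ r) (by omega) r rfl hir hrL
      omega
  refine ⟨hle _ a rfl ha (by omega), ?_⟩
  -- Following neighbours with growing ρ must terminate, and since no edge jumps over `b` the path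
  -- ends in `b`.
  have key : ∀ n a, L + 1 - ρ a = n → i₀ ≤ a → a < b → ρ a < ρ b := by
    intro n
    induction n using Nat.strong_induction_on with
    | _ n ih =>
      intro a han ha hab
      have ha4 : a ∈ Finset.Icc 4 L := Finset.mem_Icc.2 (by omega)
      obtain ⟨r, hr, hra, hd⟩ := hup a ha4 (hle _ a rfl ha (by omega))
      have hir := hside a ha4 r hr hd ha
      have hrb := hjump a ha4 r hr hd ha hab
      have := Finset.mem_Icc.1 (hρ r hr)
      rcases hrb.lt_or_eq with h | rfl
      · exact hra.trans (ih (L + 1 - ρ r) (by omega) r rfl hir h)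
      · exact hra
  exact key _ a rfl ha hab

/-- The mirror image of `upper_chain_lt`, with the root at position 3. -/
theorem lower_chain_lt {L i i₀ b : ℕ} {ρ : ℕ → ℕ} {d : ℕ → ℕ → Prop} (hi₀ : i₀ ≤ L + 1)
    (hρ : ∀ a ∈ Finset.Icc 3 (L + 1), ρ a ∈ Finset.Icc 3 (L + 1)) (hfirst : ρ 3 = 3)
    (hup : ∀ a ∈ Finset.Icc 4 L, i ≤ ρ a → ∃ r ∈ Finset.Icc 3 (L + 1), ρ a < ρ r ∧ d a r)
    (hdown : ∀ a ∈ Finset.Icc 4 L, ρ a < i → ∃ r ∈ Finset.Icc 3 (L + 1), ρ r < ρ a ∧ d a r)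
    (hside : ∀ a ∈ Finset.Icc 4 L, ∀ r ∈ Finset.Icc 3 (L + 1), d a r → a < i₀ → r < i₀)
    (hb : 3 ≤ b)
    (hjump : ∀ a ∈ Finset.Icc 4 L, ∀ r ∈ Finset.Icc 3 (L + 1), d a r → a < i₀ → b < a → b ≤ r)
    {a : ℕ} (ha : a < i₀) (hab : b < a) : ρ a < i ∧ ρ b < ρ a := by
  have hlt : ∀ n a, L + 1 - ρ a = n → 4 ≤ a → a < i₀ → ρ a < i := by
    intro n
    induction n using Nat.strong_induction_on with
    | _ n ih =>
      intro a han ha haL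
      by_contra! hle
      obtain ⟨r, hr, hra, hd⟩ := hup a (Finset.mem_Icc.2 (by omega)) hle
      have hir := hside a (Finset.mem_Icc.2 (by omega)) r hr hd haL
      have hρr := Finset.mem_Icc.1 (hρ r hr)
      rw [Finset.mem_Icc] at hr
      have hr4 : 4 ≤ r := by
        by_contra! h
        have : r = 3 := by omega
        have := Finset.mem_Icc.1 (hρ a (Finset.mem_Icc.2 (by omega)))
        rw [‹r = 3›, hfirst] at hra
        omega
      have := ih (L + 1 - ρ r) (by omega) r rfl hr4 hir
      omega
  refine ⟨hlt _ a rfl (by omega) ha, ?_⟩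
  have key : ∀ n a, ρ a = n → a < i₀ → b < a → ρ b < ρ a := by
    intro n
    induction n using Nat.strong_induction_on with
    | _ n ih =>
      intro a han ha hab
      have ha4 : a ∈ Finset.Icc 4 L := Finset.mem_Icc.2 (by omega)
      obtain ⟨r, hr, hra, hd⟩ := hdown a ha4 (hlt _ a rfl (by omega) ha)
      have hir := hside a ha4 r hr hd ha
      have hrb := hjump a ha4 r hr hd ha hab
      rcases hrb.lt_or_eq with h | rfl
      · exact (ih (ρ r) (by omega) r rfl hir h).trans hra
      · exact hra
  exact key _ a rfl ha hab

variable {L : ℕ}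

theorem positionLabel_mem (hL : 4 ≤ L) (q : ComponentIndex L) {p : ℕ}
    (hp : p ∈ Finset.Icc 3 (L + 1)) :
    positionLabel L q p ∈ Finset.Icc 1 L ∧ positionLabel L q p ≠ 3 := by
  constructor
  · rw [Finset.mem_Icc] at hp
    rcases (by omega : p = 3 ∨ p = L + 1 ∨ (4 ≤ p ∧ p ≤ L)) with rfl | rfl | h
    · rw [positionLabel_three hL, Finset.mem_Icc]; omega
    · rw [positionLabel_last, Finset.mem_Icc]; omega
    · have hp4 : p ∈ Finset.Icc 4 L := Finset.mem_Icc.2 h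
      rw [positionLabel_of_mem q hp4]
      have := Finset.mem_Icc.1 ((relabel_mem_iff L (componentPerm L q)).2 hp4)
      rw [Finset.mem_Icc]; omega
  · rw [Finset.mem_Icc] at hp
    rw [← positionLabel_two hL q]
    exact (positionLabel L q).injective.ne (by omega)

theorem positionLabel_symm_mem (hL : 4 ≤ L) (q : ComponentIndex L) {k : ℕ}
    (hk : k ∈ Finset.Icc 1 L) (hk3 : k ≠ 3) :
    (positionLabel L q).symm k ∈ Finset.Icc 3 (L + 1) := by
  rw [Finset.mem_Icc] at hk
  rcases (by omega : k = 1 ∨ k = 2 ∨ 4 ≤ k) with rfl | rfl | h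
  · rw [(Equiv.symm_apply_eq _).2 (positionLabel_last q).symm, Finset.mem_Icc]; omega
  · rw [(Equiv.symm_apply_eq _).2 (positionLabel_three hL q).symm, Finset.mem_Icc]; omega
  · have hk4 : k ∈ Finset.Icc 4 L := Finset.mem_Icc.2 ⟨h, hk.2⟩
    set p := (relabel L (componentPerm L q)).symm k with hp
    have hp4 : p ∈ Finset.Icc 4 L := by
      rw [← relabel_mem_iff L (componentPerm L q), hp, Equiv.apply_symm_apply]
      exact hk4
    have : positionLabel L q p = k := by
      rw [positionLabel_of_mem q hp4, hp, Equiv.apply_symm_apply]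
    rw [(Equiv.symm_apply_eq _).2 this.symm]
    rw [Finset.mem_Icc] at hp4 ⊢
    omega

/-- The position in the component `q` of the label at position `a` of the component `q₀`. -/
def transition (q₀ q : ComponentIndex L) (a : ℕ) : ℕ :=
  (positionLabel L q).symm (positionLabel L q₀ a)

theorem positionLabel_transition (q₀ q : ComponentIndex L) (a : ℕ) :
    positionLabel L q (transition q₀ q a) = positionLabel L q₀ a :=
  Equiv.apply_symm_apply _ _

theorem transition_transition (q₀ q : ComponentIndex L) (a : ℕ) :
    transition q₀ q (transition q q₀ a) = a := by
  rw [transition, positionLabel_transition, Equiv.symm_apply_apply]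

theorem transition_injective (q₀ q : ComponentIndex L) : Function.Injective (transition q₀ q) :=
  (positionLabel L q).symm.injective.comp (positionLabel L q₀).injective

theorem transition_mem (hL : 4 ≤ L) (q₀ q : ComponentIndex L) {a : ℕ}
    (ha : a ∈ Finset.Icc 3 (L + 1)) : transition q₀ q a ∈ Finset.Icc 3 (L + 1) :=
  positionLabel_symm_mem hL q (positionLabel_mem hL q₀ ha).1 (positionLabel_mem hL q₀ ha).2

theorem transition_three (hL : 4 ≤ L) (q₀ q : ComponentIndex L) : transition q₀ q 3 = 3 := by
  rw [transition, positionLabel_three hL, Equiv.symm_apply_eq, positionLabel_three hL]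

theorem transition_last (q₀ q : ComponentIndex L) : transition q₀ q (L + 1) = L + 1 := by
  rw [transition, positionLabel_last, Equiv.symm_apply_eq, positionLabel_last]

/-- No factor of a nonzero product vanishes, so in each factor some summand is nonzero: the label is
joined to one nearer to its root in `q`. Positions are translated to those of `q₀`. -/
theorem exists_neighbours_of_chainProduct_ne_zero (hL : 4 ≤ L) (q₀ : ComponentIndex L)
    {q : ComponentIndex L} {c : ℕ → ℕ → ℝ} (hc : ∀ k j, c k j = -c j k)
    (h : chainProduct L q c ≠ 0) {a : ℕ} (ha : a ∈ Finset.Icc 4 L) :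
    (componentLevel L q ≤ transition q₀ q a → ∃ r ∈ Finset.Icc 3 (L + 1),
      transition q₀ q a < transition q₀ q r ∧
        c (positionLabel L q₀ a) (positionLabel L q₀ r) ≠ 0) ∧
    (transition q₀ q a < componentLevel L q → ∃ r ∈ Finset.Icc 3 (L + 1),
      transition q₀ q r < transition q₀ q a ∧
        c (positionLabel L q₀ a) (positionLabel L q₀ r) ≠ 0) := by
  obtain ⟨h1, h2⟩ := mul_ne_zero_iff.1 h
  obtain ⟨h4, h5⟩ := componentLevel_mem L hL q
  rw [Finset.mem_Icc] at ha
  set p := transition q₀ q a with hp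
  have hp3 : p ∈ Finset.Icc 3 (L + 1) := transition_mem hL q₀ q (Finset.mem_Icc.2 (by omega))
  have hpa : positionLabel L q p = positionLabel L q₀ a := positionLabel_transition q₀ q a
  have hp4 : 4 ≤ p ∧ p ≤ L := by
    have e3 : p ≠ 3 := by
      rw [hp, ← transition_three hL q₀ q]; exact (transition_injective q₀ q).ne (by omega)
    have eL : p ≠ L + 1 := by
      rw [hp, ← transition_last q₀ q]; exact (transition_injective q₀ q).ne (by omega)
    rw [Finset.mem_Icc] at hp3
    omega
  constructor
  · intro hip
    obtain ⟨r, hr, hne⟩ := Finset.exists_ne_zero_of_sum_ne_zero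
      (Finset.prod_ne_zero_iff.1 h1 p (Finset.mem_Icc.2 ⟨hip, hp4.2⟩))
    rw [Finset.mem_Icc] at hr
    refine ⟨transition q q₀ r, transition_mem hL q q₀ (Finset.mem_Icc.2 (by omega)), ?_, ?_⟩
    · rw [transition_transition]; omega
    · rwa [positionLabel_transition, ← hpa]
  · intro hip
    obtain ⟨r, hr, hne⟩ := Finset.exists_ne_zero_of_sum_ne_zero
      (Finset.prod_ne_zero_iff.1 h2 p (Finset.mem_Ico.2 ⟨hp4.1, hip⟩))
    rw [Finset.mem_Ico] at hr
    refine ⟨transition q q₀ r, transition_mem hL q q₀ (Finset.mem_Icc.2 (by omega)), ?_, ?_⟩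
    · rw [transition_transition]; omega
    · rw [hc, neg_ne_zero] at hne
      rwa [positionLabel_transition, ← hpa]

theorem transition_lt_of_upper (hL : 4 ≤ L) {q₀ q : ComponentIndex L} {c : ℕ → ℕ → ℝ}
    (hc : ∀ k j, c k j = -c j k) (h : chainProduct L q c ≠ 0)
    (hside : ∀ a ∈ Finset.Icc 4 L, ∀ r ∈ Finset.Icc 3 (L + 1),
      c (positionLabel L q₀ a) (positionLabel L q₀ r) ≠ 0 →
        componentLevel L q₀ ≤ a → componentLevel L q₀ ≤ r)
    {b : ℕ} (hb : b ≤ L + 1)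
    (hjump : ∀ a ∈ Finset.Icc 4 L, ∀ r ∈ Finset.Icc 3 (L + 1),
      c (positionLabel L q₀ a) (positionLabel L q₀ r) ≠ 0 →
        componentLevel L q₀ ≤ a → a < b → r ≤ b)
    {a : ℕ} (ha : componentLevel L q₀ ≤ a) (hab : a < b) :
    componentLevel L q ≤ transition q₀ q a ∧ transition q₀ q a < transition q₀ q b :=
  upper_chain_lt (d := fun a r => c (positionLabel L q₀ a) (positionLabel L q₀ r) ≠ 0)
    (componentLevel_mem L hL q₀).1 (fun _ => transition_mem hL q₀ q) (transition_last q₀ q)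
    (fun _ ha => (exists_neighbours_of_chainProduct_ne_zero hL q₀ hc h ha).1)
    (fun _ ha => (exists_neighbours_of_chainProduct_ne_zero hL q₀ hc h ha).2) hside hb hjump ha hab

theorem transition_lt_of_lower (hL : 4 ≤ L) {q₀ q : ComponentIndex L} {c : ℕ → ℕ → ℝ}
    (hc : ∀ k j, c k j = -c j k) (h : chainProduct L q c ≠ 0)
    (hside : ∀ a ∈ Finset.Icc 4 L, ∀ r ∈ Finset.Icc 3 (L + 1),
      c (positionLabel L q₀ a) (positionLabel L q₀ r) ≠ 0 →
        a < componentLevel L q₀ → r < componentLevel L q₀)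
    {b : ℕ} (hb : 3 ≤ b)
    (hjump : ∀ a ∈ Finset.Icc 4 L, ∀ r ∈ Finset.Icc 3 (L + 1),
      c (positionLabel L q₀ a) (positionLabel L q₀ r) ≠ 0 →
        a < componentLevel L q₀ → b < a → b ≤ r)
    {a : ℕ} (ha : a < componentLevel L q₀) (hab : b < a) :
    transition q₀ q a < componentLevel L q ∧ transition q₀ q b < transition q₀ q a :=
  lower_chain_lt (d := fun a r => c (positionLabel L q₀ a) (positionLabel L q₀ r) ≠ 0)
    (componentLevel_mem L hL q₀).2 (fun _ => transition_mem hL q₀ q) (transition_three hL q₀ q)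
    (fun _ ha => (exists_neighbours_of_chainProduct_ne_zero hL q₀ hc h ha).1)
    (fun _ ha => (exists_neighbours_of_chainProduct_ne_zero hL q₀ hc h ha).2) hside hb hjump ha hab

/-- The nonzero entries of `c` at the integrated labels join neighbours in the chains of `q`. -/
def SupportedOnChains (q : ComponentIndex L) (c : ℕ → ℕ → ℝ) : Prop :=
  ∀ a ∈ Finset.Icc 4 L, ∀ r ∈ Finset.Icc 3 (L + 1),
    c (positionLabel L q a) (positionLabel L q r) ≠ 0 →
      (r = a + 1 ∨ a = r + 1) ∧ (componentLevel L q ≤ a ↔ componentLevel L q ≤ r)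

theorem component_ext {q₀ q : ComponentIndex L}
    (h1 : componentLevel L q = componentLevel L q₀)
    (h2 : ∀ a ∈ Finset.Icc 4 L, positionLabel L q a = positionLabel L q₀ a) : q = q₀ := by
  have h3 : componentPerm L q = componentPerm L q₀ := by
    ext a
    have := h2 a a.2
    rwa [positionLabel_of_mem q a.2, positionLabel_of_mem q₀ a.2, relabel_of_mem L _ a.2,
      relabel_of_mem L _ a.2] at this
  rcases q with σ | ⟨i, σ⟩ <;> rcases q₀ with σ₀ | ⟨i₀, σ₀⟩ <;>
    simp only [componentPerm, componentLevel] at h1 h3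
  · rw [h3]
  · have := Finset.mem_Icc.1 i₀.2
    omega
  · have := Finset.mem_Icc.1 i.2
    omega
  · rw [h3, Subtype.ext h1]

/-- With edges only between chain neighbours of `q₀`, no edge jumps over any position, so the
transition from `q₀` to `q` is increasing on 3, …, L + 1 and hence the identity. The sides are
preserved as well, which gives equality of the levels. -/
theorem eq_of_chainProduct_ne_zero (hL : 4 ≤ L) {q₀ q : ComponentIndex L} {c : ℕ → ℕ → ℝ}
    (hc : ∀ k j, c k j = -c j k) (hsupp : SupportedOnChains q₀ c)
    (h : chainProduct L q c ≠ 0) : q = q₀ := by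
  obtain ⟨h4, h5⟩ := componentLevel_mem L hL q₀
  obtain ⟨h4', h5'⟩ := componentLevel_mem L hL q
  have hA : ∀ a b, componentLevel L q₀ ≤ a → a < b → b ≤ L + 1 →
      componentLevel L q ≤ transition q₀ q a ∧ transition q₀ q a < transition q₀ q b := by
    intro a b ha hab hb
    refine transition_lt_of_upper hL hc h (fun a ha r hr hne h0 => ((hsupp a ha r hr hne).2).1 h0)
      hb (fun a ha r hr hne _ hab => ?_) ha hab
    have := (hsupp a ha r hr hne).1
    omega
  have hB : ∀ a b, a < componentLevel L q₀ → b < a → 3 ≤ b →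
      transition q₀ q a < componentLevel L q ∧ transition q₀ q b < transition q₀ q a := by
    intro a b ha hab hb
    refine transition_lt_of_lower hL hc h (fun a ha r hr hne h0 => ?_)
      hb (fun a ha r hr hne _ hab => ?_) ha hab
    · have := (hsupp a ha r hr hne).2
      omega
    · have := (hsupp a ha r hr hne).1
      omega
  have hA' : ∀ a, componentLevel L q₀ ≤ a → a ≤ L + 1 → componentLevel L q ≤ transition q₀ q a := by
    intro a ha haL
    rcases haL.lt_or_eq with h | rfl
    · exact (hA a (L + 1) ha h le_rfl).1
    · rwa [transition_last]
  have hB' : ∀ a, a < componentLevel L q₀ → 3 ≤ a → transition q₀ q a < componentLevel L q := by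
    intro a ha h3
    rcases h3.lt_or_eq with h | rfl
    · exact (hB a 3 ha h le_rfl).1
    · rw [transition_three hL]; omega
  have hmono : ∀ a, 3 ≤ a → a ≤ L → transition q₀ q a < transition q₀ q (a + 1) := by
    intro a h3 haL
    by_cases ha : componentLevel L q₀ ≤ a
    · exact (hA a (a + 1) ha (by omega) (by omega)).2
    · by_cases ha' : a + 1 < componentLevel L q₀
      · exact (hB (a + 1) a ha' (by omega) h3).2
      -- At the gap between the chains there is no edge; the two images are separated by the level
      -- of `q`.
      · exact (hB' a (by omega) h3).trans_le (hA' (a + 1) (by omega) (by omega))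
  have hge : ∀ a, 3 ≤ a → a ≤ L + 1 → a ≤ transition q₀ q a := by
    intro a h3
    induction a, h3 using Nat.le_induction with
    | base => intro _; rw [transition_three hL]
    | succ a h3 ih =>
      intro haL
      have := ih (by omega)
      have := hmono a h3 (by omega)
      omega
  have hle : ∀ t a, a + t = L + 1 → 3 ≤ a → transition q₀ q a ≤ a := by
    intro t
    induction t with
    | zero => intro a ha _; rw [show a = L + 1 by omega, transition_last]
    | succ t ih =>
      intro a ha h3
      have := ih (a + 1) (by omega) (by omega)
      have := hmono a h3 (by omega)
      omega
  have hid : ∀ a, 3 ≤ a → a ≤ L + 1 → transition q₀ q a = a := fun a h3 haL =>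
    le_antisymm (hle (L + 1 - a) a (by omega) h3) (hge a h3 haL)
  refine component_ext ?_ fun a ha => ?_
  · have e1 := hA' (componentLevel L q₀) le_rfl h5
    have e2 := hB' (componentLevel L q₀ - 1) (by omega) (by omega)
    rw [hid _ (by omega) (by omega)] at e1 e2
    omega
  · rw [Finset.mem_Icc] at ha
    rw [← positionLabel_transition q₀ q a, hid a (by omega) (by omega)]

theorem chainProduct_ne_zero_of_supportedOnChains (hL : 4 ≤ L) {q : ComponentIndex L}
    {c : ℕ → ℕ → ℝ} (hc : ∀ k j, c k j = -c j k) (hsupp : SupportedOnChains q c)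
    (hne : ∀ a ∈ (Finset.Icc 3 L).erase (componentLevel L q - 1),
      c (positionLabel L q a) (positionLabel L q (a + 1)) ≠ 0) : chainProduct L q c ≠ 0 := by
  obtain ⟨h4, h5⟩ := componentLevel_mem L hL q
  refine mul_ne_zero (Finset.prod_ne_zero_iff.2 fun p hp => ?_)
    (Finset.prod_ne_zero_iff.2 fun p hp => ?_)
  · rw [Finset.mem_Icc] at hp
    rw [Finset.sum_eq_single (p + 1)]
    · exact hne p (by simp; omega)
    · intro r hr hrp
      rw [Finset.mem_Icc] at hr
      by_contra h
      have := (hsupp p (Finset.mem_Icc.2 (by omega)) r (Finset.mem_Icc.2 (by omega)) h).1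
      omega
    · intro h
      exact absurd (Finset.mem_Icc.2 (by omega)) h
  · rw [Finset.mem_Ico] at hp
    rw [Finset.sum_eq_single (p - 1)]
    · have := hne (p - 1) (by simp; omega)
      rwa [show p - 1 + 1 = p by omega] at this
    · intro r hr hrp
      rw [Finset.mem_Ico] at hr
      by_contra h
      rw [hc, neg_eq_zero] at h
      have := (hsupp p (Finset.mem_Icc.2 (by omega)) r (Finset.mem_Icc.2 (by omega)) h).1
      omega
    · intro h
      exact absurd (Finset.mem_Ico.2 (by omega)) h

end ChainOrder

/-! ### Test circulations and test positions -/

section Flows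

variable {L : ℕ}

/-- The unit flow along the edge from `a` to `b`. -/
def edgeFlow (a b k j : ℕ) : ℝ :=
  (if k = a ∧ j = b then 1 else 0) - (if k = b ∧ j = a then 1 else 0)

/-- The unit flow along the triangle `u → v → 3 → u`. -/
def triangleFlow (u v k j : ℕ) : ℝ :=
  edgeFlow u v k j + edgeFlow v 3 k j + edgeFlow 3 u k j

/-- The sum of the triangles over the edges of the two chains of a component. -/
def chainFlow (L : ℕ) (q : ComponentIndex L) (k j : ℕ) : ℝ :=
  ∑ a ∈ (Finset.Icc 3 L).erase (componentLevel L q - 1),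
    triangleFlow (positionLabel L q a) (positionLabel L q (a + 1)) k j

/-- Skew functions that satisfy the critical point equations at the labels `4, …, L`. -/
def IsCirculation (L : ℕ) (c : ℕ → ℕ → ℝ) : Prop :=
  (∀ k j, c k j = -c j k) ∧ ∀ k ∈ Finset.Icc 4 L, ∑ j ∈ Finset.Icc 1 L, c k j = 0

theorem IsCirculation.add {c d : ℕ → ℕ → ℝ} (hc : IsCirculation L c) (hd : IsCirculation L d) :
    IsCirculation L (c + d) := by
  refine ⟨fun k j => ?_, fun k hk => ?_⟩
  · simp only [Pi.add_apply]
    rw [hc.1 k j, hd.1 k j]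
    ring
  · simp only [Pi.add_apply]
    rw [Finset.sum_add_distrib, hc.2 k hk, hd.2 k hk, add_zero]

theorem IsCirculation.smul {c : ℕ → ℕ → ℝ} (hc : IsCirculation L c) (t : ℝ) :
    IsCirculation L (t • c) := by
  refine ⟨fun k j => ?_, fun k hk => ?_⟩
  · simp only [Pi.smul_apply, smul_eq_mul]
    rw [hc.1 k j]
    ring
  · simp only [Pi.smul_apply, smul_eq_mul]
    rw [← Finset.mul_sum, hc.2 k hk, mul_zero]

theorem edgeFlow_skew (a b k j : ℕ) : edgeFlow a b k j = -edgeFlow a b j k := by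
  simp only [edgeFlow, and_comm]
  ring

theorem sum_edgeFlow {a b : ℕ} (ha : a ∈ Finset.Icc 1 L) (hb : b ∈ Finset.Icc 1 L) (k : ℕ) :
    ∑ j ∈ Finset.Icc 1 L, edgeFlow a b k j =
      (if k = a then 1 else 0) - (if k = b then 1 else 0) := by
  simp only [edgeFlow, ite_and]
  rw [Finset.sum_sub_distrib]
  congr 1
  · split_ifs
    · rw [Finset.sum_ite_eq', if_pos hb]
    · exact Finset.sum_const_zero
  · split_ifs
    · rw [Finset.sum_ite_eq', if_pos ha]
    · exact Finset.sum_const_zero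

/-- Conservation is only required at the integrated labels, so an edge between two of the labels 1,
2, 3 need not be closed up. -/
theorem isCirculation_edgeFlow {a b : ℕ} (ha : a ∈ Finset.Icc 1 3) (hb : b ∈ Finset.Icc 1 3)
    (hL : 4 ≤ L) : IsCirculation L (edgeFlow a b) := by
  rw [Finset.mem_Icc] at ha hb
  refine ⟨edgeFlow_skew a b, fun k hk => ?_⟩
  rw [Finset.mem_Icc] at hk
  rw [sum_edgeFlow (Finset.mem_Icc.2 (by omega)) (Finset.mem_Icc.2 (by omega)),
    if_neg (by omega), if_neg (by omega), sub_zero]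

theorem isCirculation_triangleFlow (hL : 4 ≤ L) {u v : ℕ} (hu : u ∈ Finset.Icc 1 L)
    (hv : v ∈ Finset.Icc 1 L) : IsCirculation L (triangleFlow u v) := by
  have h3 : 3 ∈ Finset.Icc 1 L := Finset.mem_Icc.2 (by omega)
  refine ⟨fun k j => ?_, fun k _ => ?_⟩
  · simp only [triangleFlow]
    rw [edgeFlow_skew u v, edgeFlow_skew v 3, edgeFlow_skew 3 u]
    ring
  · simp only [triangleFlow]
    rw [Finset.sum_add_distrib, Finset.sum_add_distrib, sum_edgeFlow hu hv, sum_edgeFlow hv h3,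
      sum_edgeFlow h3 hu]
    ring

theorem isCirculation_chainFlow (hL : 4 ≤ L) (q : ComponentIndex L) :
    IsCirculation L (chainFlow L q) := by
  have ht : ∀ a ∈ (Finset.Icc 3 L).erase (componentLevel L q - 1),
      IsCirculation L (triangleFlow (positionLabel L q a) (positionLabel L q (a + 1))) := by
    intro a ha
    have ha' := Finset.mem_Icc.1 (Finset.mem_of_mem_erase ha)
    exact isCirculation_triangleFlow hL (positionLabel_mem hL q (Finset.mem_Icc.2 (by omega))).1
      (positionLabel_mem hL q (Finset.mem_Icc.2 (by omega))).1
  refine ⟨fun k j => ?_, fun k hk => ?_⟩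
  · simp only [chainFlow]
    rw [← Finset.sum_neg_distrib]
    exact Finset.sum_congr rfl fun a ha => (ht a ha).1 k j
  · simp only [chainFlow]
    rw [Finset.sum_comm]
    exact Finset.sum_eq_zero fun a ha => (ht a ha).2 k hk

/-- The label 3 occupies none of the positions 3, …, L + 1, so the two edges that close the triangle
are invisible to the chain products. -/
theorem triangleFlow_positionLabel (hL : 4 ≤ L) (q : ComponentIndex L) {p r : ℕ} (a b : ℕ)
    (hp : p ∈ Finset.Icc 3 (L + 1)) (hr : r ∈ Finset.Icc 3 (L + 1)) :
    triangleFlow (positionLabel L q a) (positionLabel L q b) (positionLabel L q p)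
      (positionLabel L q r) = (if p = a ∧ r = b then 1 else 0) - (if p = b ∧ r = a then 1 else 0) := by
  have hp3 := (positionLabel_mem hL q hp).2
  have hr3 := (positionLabel_mem hL q hr).2
  simp [triangleFlow, edgeFlow, hp3, hr3]

theorem chainFlow_positionLabel (hL : 4 ≤ L) (q : ComponentIndex L) {p r : ℕ}
    (hp : p ∈ Finset.Icc 3 (L + 1)) (hr : r ∈ Finset.Icc 3 (L + 1)) :
    chainFlow L q (positionLabel L q p) (positionLabel L q r) =
      (if r = p + 1 ∧ p ∈ (Finset.Icc 3 L).erase (componentLevel L q - 1) then 1 else 0) -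
        (if p = r + 1 ∧ r ∈ (Finset.Icc 3 L).erase (componentLevel L q - 1) then 1 else 0) := by
  rw [chainFlow, Finset.sum_congr rfl fun a _ =>
    triangleFlow_positionLabel hL q a (a + 1) hp hr, Finset.sum_sub_distrib]
  congr 1
  · by_cases h : r = p + 1
    · simp [h]
    · rw [if_neg fun h' => h h'.1]
      exact Finset.sum_eq_zero fun a _ => if_neg fun h' => h (by omega)
  · by_cases h : p = r + 1
    · simp [h]
    · rw [if_neg fun h' => h h'.1]
      exact Finset.sum_eq_zero fun a _ => if_neg fun h' => h (by omega)

theorem supportedOnChains_chainFlow (hL : 4 ≤ L) (q : ComponentIndex L) :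
    SupportedOnChains q (chainFlow L q) := by
  intro a ha r hr hne
  obtain ⟨h4, h5⟩ := componentLevel_mem L hL q
  have ha' := Finset.mem_Icc.1 ha
  rw [chainFlow_positionLabel hL q (Finset.mem_Icc.2 (by omega)) hr] at hne
  by_contra hcon
  refine hne ?_
  rw [if_neg, if_neg, sub_zero]
  all_goals
    rintro ⟨h, h'⟩
    simp at h'
    omega

theorem chainFlow_edge (hL : 4 ≤ L) (q : ComponentIndex L) {a : ℕ}
    (ha : a ∈ (Finset.Icc 3 L).erase (componentLevel L q - 1)) :
    chainFlow L q (positionLabel L q a) (positionLabel L q (a + 1)) = 1 := by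
  have ha' := Finset.mem_Icc.1 (Finset.mem_of_mem_erase ha)
  rw [chainFlow_positionLabel hL q (Finset.mem_Icc.2 (by omega)) (Finset.mem_Icc.2 (by omega)),
    if_pos ⟨rfl, ha⟩, if_neg (by omega), sub_zero]

theorem pairing_add (R : MandelstamIndex L → ℂ) (c d : ℕ → ℕ → ℝ) (X : ℕ → ℝ) :
    pairing L R (c + d) X = pairing L R c X + pairing L R d X := by
  simp only [pairing, ← Finset.sum_add_distrib, Pi.add_apply]
  refine Finset.sum_congr rfl fun k _ => Finset.sum_congr rfl fun j _ => ?_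
  push_cast
  ring

theorem pairing_smul (R : MandelstamIndex L → ℂ) (t : ℝ) (c : ℕ → ℕ → ℝ) (X : ℕ → ℝ) :
    pairing L R (t • c) X = t * pairing L R c X := by
  simp only [pairing, Finset.mul_sum, Pi.smul_apply, smul_eq_mul]
  refine Finset.sum_congr rfl fun k _ => Finset.sum_congr rfl fun j _ => ?_
  push_cast
  ring

theorem pairing_edgeFlow (R : MandelstamIndex L → ℂ) {a b : ℕ} (ha : a ∈ Finset.Icc 1 L)
    (hb : b ∈ Finset.Icc 1 L) (X : ℕ → ℝ) :
    pairing L R (edgeFlow a b) X = 2 * (mandelstam L R a b * (X a - X b : ℝ)) := by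
  have h1 : ∀ u ∈ Finset.Icc 1 L, ∀ v ∈ Finset.Icc 1 L,
      ∑ k ∈ Finset.Icc 1 L, ∑ j ∈ Finset.Icc 1 L,
        (if k = u then if j = v then mandelstam L R k j * (X k - X j : ℝ) else 0 else 0) =
      mandelstam L R u v * (X u - X v : ℝ) := by
    intro u hu v hv
    rw [Finset.sum_eq_single_of_mem u hu, Finset.sum_eq_single_of_mem v hv]
    · simp
    · intro j _ h
      simp [h]
    · intro k _ h
      simp [h]
  have h2 : pairing L R (edgeFlow a b) X =
      mandelstam L R a b * (X a - X b : ℝ) - mandelstam L R b a * (X b - X a : ℝ) := by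
    rw [← h1 a ha b hb, ← h1 b hb a ha, pairing]
    simp only [← Finset.sum_sub_distrib]
    refine Finset.sum_congr rfl fun k _ => Finset.sum_congr rfl fun j _ => ?_
    simp only [edgeFlow, ite_and]
    split_ifs <;> push_cast <;> ring
  rw [h2, mandelstam_symm L R b a]
  push_cast
  ring

theorem pairing_triangleFlow (hL : 4 ≤ L) (R : MandelstamIndex L → ℂ) {u v : ℕ}
    (hu : u ∈ Finset.Icc 1 L) (hv : v ∈ Finset.Icc 1 L) (X : ℕ → ℝ) :
    pairing L R (triangleFlow u v) X = 2 * (mandelstam L R u v * (X u - X v : ℝ) +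
      mandelstam L R 3 v * (X v - X 3 : ℝ) + mandelstam L R 3 u * (X 3 - X u : ℝ)) := by
  have h3 : 3 ∈ Finset.Icc 1 L := Finset.mem_Icc.2 (by omega)
  have : triangleFlow u v = edgeFlow u v + edgeFlow v 3 + edgeFlow 3 u := rfl
  rw [this, pairing_add, pairing_add, pairing_edgeFlow R hu hv, pairing_edgeFlow R hv h3,
    pairing_edgeFlow R h3 hu, mandelstam_symm L R v 3]
  ring

/-- Apart from edges at label 3, a pairing evaluated at `cutPosition` only sees edges across the
cut, and each cut is crossed by at most one edge of the chains. -/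
theorem pairing_chainFlow (R : MandelstamIndex L → ℂ) (q : ComponentIndex L) (X : ℕ → ℝ) :
    pairing L R (chainFlow L q) X = ∑ a ∈ (Finset.Icc 3 L).erase (componentLevel L q - 1),
      pairing L R (triangleFlow (positionLabel L q a) (positionLabel L q (a + 1))) X := by
  simp only [pairing, chainFlow]
  symm
  rw [Finset.sum_comm]
  refine Finset.sum_congr rfl fun k _ => ?_
  rw [Finset.sum_comm]
  refine Finset.sum_congr rfl fun j _ => ?_
  rw [Finset.sum_mul, Complex.ofReal_sum, Finset.mul_sum]

/-- The positions `1` for the labels up to position `m` of a component and `0` beyond. -/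
def cutPosition (q : ComponentIndex L) (x : ℝ) (m k : ℕ) : ℝ :=
  if k = 3 then x else if (positionLabel L q).symm k ≤ m then 1 else 0

theorem cutPosition_positionLabel (hL : 4 ≤ L) (q : ComponentIndex L) (x : ℝ) (m : ℕ) {p : ℕ}
    (hp : p ∈ Finset.Icc 3 (L + 1)) :
    cutPosition q x m (positionLabel L q p) = if p ≤ m then 1 else 0 := by
  rw [cutPosition, if_neg (positionLabel_mem hL q hp).2, Equiv.symm_apply_apply]

theorem cutPosition_one (hL : 4 ≤ L) (q : ComponentIndex L) (x : ℝ) {m : ℕ} (hm : m ≤ L) :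
    cutPosition q x m 1 = 0 := by
  have := cutPosition_positionLabel hL q x m (p := L + 1) (Finset.mem_Icc.2 (by omega))
  rwa [positionLabel_last, if_neg (by omega)] at this

theorem cutPosition_two (hL : 4 ≤ L) (q : ComponentIndex L) (x : ℝ) {m : ℕ} (hm : 3 ≤ m) :
    cutPosition q x m 2 = 1 := by
  have := cutPosition_positionLabel hL q x m (p := 3) (Finset.mem_Icc.2 (by omega))
  rwa [positionLabel_three hL, if_pos hm] at this

theorem cutPosition_three (q : ComponentIndex L) (x : ℝ) (m : ℕ) : cutPosition q x m 3 = x :=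
  if_pos rfl

end Flows

/-! ### Linear independence of the components -/

section Independence

variable {L : ℕ} {x : ℝ} {R : ComponentIndex L → MandelstamIndex L → ℂ}

/-- All relations at circulations. -/
def AnnihilatesCirculations (L : ℕ) (x : ℝ) (R : ComponentIndex L → MandelstamIndex L → ℂ) : Prop :=
  ∀ c, IsCirculation L c → ∀ X : ℕ → ℝ, X 1 = 0 → X 2 = 1 → X 3 = x →
    ∑ q, pairing L (R q) c X * (chainProduct L q c : ℂ) = 0

theorem pairing_eq_zero_of_ne (hL : 4 ≤ L) (hR : AnnihilatesCirculations L x R)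
    (q : ComponentIndex L) {c : ℕ → ℕ → ℝ} (hc : IsCirculation L c)
    (hsupp : SupportedOnChains q c)
    (hne : ∀ a ∈ (Finset.Icc 3 L).erase (componentLevel L q - 1),
      c (positionLabel L q a) (positionLabel L q (a + 1)) ≠ 0)
    {X : ℕ → ℝ} (h1 : X 1 = 0) (h2 : X 2 = 1) (h3 : X 3 = x) : pairing L (R q) c X = 0 := by
  have h := hR c hc X h1 h2 h3
  rw [Finset.sum_eq_single_of_mem q (Finset.mem_univ q)] at h
  · refine (mul_eq_zero.1 h).resolve_right ?_
    exact_mod_cast chainProduct_ne_zero_of_supportedOnChains hL hc.1 hsupp hne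
  · intro q' _ hq'
    have : chainProduct L q' c = 0 := by
      by_contra h'
      exact hq' (eq_of_chainProduct_ne_zero hL hc.1 hsupp h')
    rw [this, Complex.ofReal_zero, mul_zero]

/-- Adding `c` to `chainFlow`, whose chain edges all equal 1, keeps these edges nonzero. Both flows
are annihilated, and the pairing is linear in the flow. -/
theorem pairing_eq_zero_of_nonneg (hL : 4 ≤ L) (hR : AnnihilatesCirculations L x R)
    (q : ComponentIndex L) {c : ℕ → ℕ → ℝ} (hc : IsCirculation L c)
    (hsupp : SupportedOnChains q c)
    (hnn : ∀ a ∈ (Finset.Icc 3 L).erase (componentLevel L q - 1),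
      0 ≤ c (positionLabel L q a) (positionLabel L q (a + 1)))
    {X : ℕ → ℝ} (h1 : X 1 = 0) (h2 : X 2 = 1) (h3 : X 3 = x) : pairing L (R q) c X = 0 := by
  have hs := supportedOnChains_chainFlow hL q
  have e1 := pairing_eq_zero_of_ne hL hR q (isCirculation_chainFlow hL q) hs
    (fun a ha => by rw [chainFlow_edge hL q ha]; exact one_ne_zero) h1 h2 h3
  have e2 := pairing_eq_zero_of_ne hL hR q ((isCirculation_chainFlow hL q).add hc)
    (fun a ha r hr hne => by
      by_cases h0 : chainFlow L q (positionLabel L q a) (positionLabel L q r) = 0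
      · refine hsupp a ha r hr fun h => hne ?_
        rw [Pi.add_apply, Pi.add_apply, h0, h, add_zero]
      · exact hs a ha r hr h0)
    (fun a ha => by
      rw [Pi.add_apply, Pi.add_apply, chainFlow_edge hL q ha]
      have := hnn a ha
      positivity) h1 h2 h3
  rwa [pairing_add, e1, zero_add] at e2

/-- Edges from 3 to 1 or 2 do not enter any chain product, and they pair with the nonzero
differences x and x - 1. -/
theorem mandelstam_three_one_two (hL : 4 ≤ L) (hx0 : 0 < x) (hx1 : x < 1)
    (hR : AnnihilatesCirculations L x R) (q : ComponentIndex L) :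
    mandelstam L (R q) 3 1 = 0 ∧ mandelstam L (R q) 3 2 = 0 := by
  have key : ∀ a ∈ Finset.Icc 1 2, pairing L (R q) (edgeFlow 3 a) (cutPosition q x 3) = 0 := by
    intro a ha
    have hz : ∀ p ∈ Finset.Icc 3 (L + 1), ∀ r ∈ Finset.Icc 3 (L + 1),
        edgeFlow 3 a (positionLabel L q p) (positionLabel L q r) = 0 := by
      intro p hp r hr
      simp [edgeFlow, (positionLabel_mem hL q hp).2, (positionLabel_mem hL q hr).2]
    rw [Finset.mem_Icc] at ha
    refine pairing_eq_zero_of_nonneg hL hR q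
      (isCirculation_edgeFlow (by simp) (Finset.mem_Icc.2 (by omega)) hL) ?_ ?_
      (cutPosition_one hL q x (by omega)) (cutPosition_two hL q x le_rfl) (cutPosition_three q x 3)
    · intro a ha r hr hne
      rw [Finset.mem_Icc] at ha
      exact absurd (hz a (Finset.mem_Icc.2 (by omega)) r hr) hne
    · intro a ha
      simp at ha
      exact (hz a (Finset.mem_Icc.2 (by omega)) (a + 1) (Finset.mem_Icc.2 (by omega))).ge
  have k1 := key 1 (by simp)
  have k2 := key 2 (by simp)
  rw [pairing_edgeFlow _ (Finset.mem_Icc.2 (by omega)) (Finset.mem_Icc.2 (by omega)),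
    cutPosition_three] at k1 k2
  rw [cutPosition_one hL q x (by omega)] at k1
  rw [cutPosition_two hL q x le_rfl] at k2
  have hx : ((x - 0 : ℝ) : ℂ) ≠ 0 := by exact_mod_cast (by linarith : x - 0 ≠ 0)
  have hx' : ((x - 1 : ℝ) : ℂ) ≠ 0 := by exact_mod_cast (by linarith : x - 1 ≠ 0)
  simp only [mul_eq_zero, hx, hx', or_false, OfNat.ofNat_ne_zero, false_or] at k1 k2
  exact ⟨k1, k2⟩

theorem chain_triangle (hL : 4 ≤ L) (hR : AnnihilatesCirculations L x R) (q : ComponentIndex L)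
    {a m : ℕ} (ha : a ∈ (Finset.Icc 3 L).erase (componentLevel L q - 1)) (hm : 3 ≤ m)
    (hmL : m ≤ L) :
    mandelstam L (R q) (positionLabel L q a) (positionLabel L q (a + 1)) *
        (((if a ≤ m then 1 else 0) - (if a + 1 ≤ m then 1 else 0) : ℝ) : ℂ) +
      mandelstam L (R q) 3 (positionLabel L q (a + 1)) *
        (((if a + 1 ≤ m then 1 else 0) - x : ℝ) : ℂ) +
      mandelstam L (R q) 3 (positionLabel L q a) *
        ((x - (if a ≤ m then 1 else 0) : ℝ) : ℂ) = 0 := by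
  obtain ⟨h4, h5⟩ := componentLevel_mem L hL q
  have ha' := Finset.mem_erase.1 ha
  rw [Finset.mem_Icc] at ha'
  have hp : a ∈ Finset.Icc 3 (L + 1) := Finset.mem_Icc.2 (by omega)
  have hp' : a + 1 ∈ Finset.Icc 3 (L + 1) := Finset.mem_Icc.2 (by omega)
  have h := pairing_eq_zero_of_nonneg hL hR q
    (isCirculation_triangleFlow hL (positionLabel_mem hL q hp).1 (positionLabel_mem hL q hp').1)
    (fun p hp r hr hne => by
      have hp4 := Finset.mem_Icc.1 hp
      rw [triangleFlow_positionLabel hL q _ _ (Finset.mem_Icc.2 (by omega)) hr] at hne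
      by_contra hcon
      refine hne ?_
      rw [if_neg (by omega), if_neg (by omega), sub_zero])
    (fun p hp => by
      have hp4 := Finset.mem_Icc.1 (Finset.mem_of_mem_erase hp)
      rw [triangleFlow_positionLabel hL q _ _ (Finset.mem_Icc.2 (by omega))
        (Finset.mem_Icc.2 (by omega)), if_neg (show ¬ (p = a + 1 ∧ p + 1 = a) by omega), sub_zero]
      positivity)
    (cutPosition_one hL q x hmL) (cutPosition_two hL q x hm) (cutPosition_three q x m)
  rw [pairing_triangleFlow hL _ (positionLabel_mem hL q hp).1 (positionLabel_mem hL q hp').1,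
    cutPosition_three, cutPosition_positionLabel hL q x m hp,
    cutPosition_positionLabel hL q x m hp'] at h
  exact (mul_eq_zero.1 h).resolve_left two_ne_zero

/-- Vanishing spreads along each chain from its root. The cut is placed so that both ends of the
current chain edge lie on the same side; the edge drops out of the triangle relation and only the
two edges to label 3 remain. -/
theorem mandelstam_three (hL : 4 ≤ L) (hx0 : 0 < x) (hx1 : x < 1)
    (hR : AnnihilatesCirculations L x R) (q : ComponentIndex L) {a : ℕ}
    (ha : a ∈ Finset.Icc 3 (L + 1)) : mandelstam L (R q) 3 (positionLabel L q a) = 0 := by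
  obtain ⟨h4, h5⟩ := componentLevel_mem L hL q
  obtain ⟨h31, h32⟩ := mandelstam_three_one_two hL hx0 hx1 hR q
  have hx : (x : ℂ) ≠ 0 := by exact_mod_cast hx0.ne'
  have hx' : ((1 - x : ℝ) : ℂ) ≠ 0 := by exact_mod_cast (by linarith : 1 - x ≠ 0)
  rw [Finset.mem_Icc] at ha
  by_cases hia : componentLevel L q ≤ a
  · have key : ∀ t a, a + t = L + 1 → componentLevel L q ≤ a →
        mandelstam L (R q) 3 (positionLabel L q a) = 0 := by
      intro t
      induction t with
      | zero => intro a ha _; rw [show a = L + 1 by omega, positionLabel_last, h31]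
      | succ t ih =>
        intro a ha hia
        have h := chain_triangle hL hR q (a := a) (m := a - 1) (by simp; omega) (by omega)
          (by omega)
        rw [ih (a + 1) (by omega) (by omega), if_neg (by omega), if_neg (by omega), sub_zero,
          sub_zero, Complex.ofReal_zero, mul_zero, zero_mul, zero_add, zero_add] at h
        exact (mul_eq_zero.1 h).resolve_right hx
    exact key (L + 1 - a) a (by omega) hia
  · obtain ⟨h3, -⟩ := ha
    induction a, h3 using Nat.le_induction with
    | base => rw [positionLabel_three hL, h32]
    | succ a h3 ih =>
      have h := chain_triangle hL hR q (a := a) (m := a + 1) (by simp; omega) (by omega) (by omega)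
      rw [ih (by omega), if_pos (by omega), if_pos (by omega), sub_self, Complex.ofReal_zero,
        mul_zero, zero_mul, zero_add, add_zero] at h
      exact (mul_eq_zero.1 h).resolve_right hx'

/-- Here the cut separates the two ends, and the edges to label 3 are already known to vanish. -/
theorem mandelstam_chain_edge (hL : 4 ≤ L) (hx0 : 0 < x) (hx1 : x < 1)
    (hR : AnnihilatesCirculations L x R) (q : ComponentIndex L) {a : ℕ}
    (ha : a ∈ (Finset.Icc 3 L).erase (componentLevel L q - 1)) :
    mandelstam L (R q) (positionLabel L q a) (positionLabel L q (a + 1)) = 0 := by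
  have ha' := Finset.mem_Icc.1 (Finset.mem_of_mem_erase ha)
  have h := chain_triangle hL hR q ha ha'.1 ha'.2
  rw [mandelstam_three hL hx0 hx1 hR q (Finset.mem_Icc.2 (by omega)),
    mandelstam_three hL hx0 hx1 hR q (Finset.mem_Icc.2 (by omega)), if_pos le_rfl,
    if_neg (by omega)] at h
  simpa using h

theorem mandelstam_three_all (hL : 4 ≤ L) (hx0 : 0 < x) (hx1 : x < 1)
    (hR : AnnihilatesCirculations L x R) (q : ComponentIndex L) {k : ℕ}
    (hk : k ∈ Finset.Icc 1 L) : mandelstam L (R q) 3 k = 0 := by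
  by_cases hk3 : k = 3
  · rw [hk3, mandelstam, dif_neg (by omega), dif_neg (by omega)]
  · have := mandelstam_three hL hx0 hx1 hR q (positionLabel_symm_mem hL q hk hk3)
    rwa [Equiv.apply_symm_apply] at this

/-- If the chain edge across a cut does not contribute, neither does any other edge across it. -/
theorem mandelstam_eq_zero_of_cut (hL : 4 ≤ L) (hx0 : 0 < x) (hx1 : x < 1)
    (hR : AnnihilatesCirculations L x R) (q₀ : ComponentIndex L) {a b m : ℕ} (ha3 : 3 ≤ a)
    (ham : a ≤ m) (hmb : m < b) (hbL : b ≤ L + 1)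
    (hcut : m ≠ componentLevel L q₀ - 1 → ∀ t : ℝ, t ≠ 0 → ∀ q,
      chainProduct L q (chainFlow L q₀ +
        t • triangleFlow (positionLabel L q₀ a) (positionLabel L q₀ b)) ≠ 0 →
      mandelstam L (R q) (positionLabel L q₀ m) (positionLabel L q₀ (m + 1)) = 0) :
    mandelstam L (R q₀) (positionLabel L q₀ a) (positionLabel L q₀ b) = 0 := by
  have hpa : a ∈ Finset.Icc 3 (L + 1) := Finset.mem_Icc.2 (by omega)
  have hpb : b ∈ Finset.Icc 3 (L + 1) := Finset.mem_Icc.2 (by omega)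
  have hla := (positionLabel_mem hL q₀ hpa).1
  have hlb := (positionLabel_mem hL q₀ hpb).1
  set e := triangleFlow (positionLabel L q₀ a) (positionLabel L q₀ b) with he
  set X := cutPosition q₀ x m with hX
  have hpe : ∀ q, pairing L (R q) e X =
      2 * mandelstam L (R q) (positionLabel L q₀ a) (positionLabel L q₀ b) := by
    intro q
    rw [he, pairing_triangleFlow hL _ hla hlb, mandelstam_three_all hL hx0 hx1 hR q hla,
      mandelstam_three_all hL hx0 hx1 hR q hlb, hX, cutPosition_positionLabel hL q₀ x m hpa,
      cutPosition_positionLabel hL q₀ x m hpb, if_pos ham, if_neg (by omega)]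
    simp
  have hpc : ∀ q, pairing L (R q) (chainFlow L q₀) X =
      if m = componentLevel L q₀ - 1 then 0
      else 2 * mandelstam L (R q) (positionLabel L q₀ m) (positionLabel L q₀ (m + 1)) := by
    intro q
    have hterm : ∀ p ∈ Finset.Icc 3 L, pairing L (R q)
        (triangleFlow (positionLabel L q₀ p) (positionLabel L q₀ (p + 1))) X =
        if p = m then 2 * mandelstam L (R q) (positionLabel L q₀ m) (positionLabel L q₀ (m + 1))
        else 0 := by
      intro p hp
      rw [Finset.mem_Icc] at hp
      have hp1 : p ∈ Finset.Icc 3 (L + 1) := Finset.mem_Icc.2 (by omega)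
      have hp2 : p + 1 ∈ Finset.Icc 3 (L + 1) := Finset.mem_Icc.2 (by omega)
      have hl1 := (positionLabel_mem hL q₀ hp1).1
      have hl2 := (positionLabel_mem hL q₀ hp2).1
      rw [pairing_triangleFlow hL _ hl1 hl2, mandelstam_three_all hL hx0 hx1 hR q hl1,
        mandelstam_three_all hL hx0 hx1 hR q hl2, hX, cutPosition_positionLabel hL q₀ x m hp1,
        cutPosition_positionLabel hL q₀ x m hp2]
      rcases lt_trichotomy p m with h | rfl | h
      · rw [if_pos h.le, if_pos (by omega), if_neg (by omega)]
        simp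
      · rw [if_pos le_rfl, if_neg (by omega), if_pos rfl]
        simp
      · rw [if_neg (by omega), if_neg (by omega), if_neg (by omega)]
        simp
    rw [pairing_chainFlow, Finset.sum_congr rfl fun p hp =>
      hterm p (Finset.mem_of_mem_erase hp), Finset.sum_ite_eq']
    have hm3 : m ∈ Finset.Icc 3 L := Finset.mem_Icc.2 (by omega)
    by_cases h : m = componentLevel L q₀ - 1
    · simp [h]
    · rw [if_pos (Finset.mem_erase.2 ⟨h, hm3⟩), if_neg h]
  -- With the chain edge across the cut gone, the pairing is 2t times the chord coefficient.
  -- Dividing by t and letting t tend to 0 turns the chord off in the chain products, so only `q₀`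
  -- survives.
  set f : ℝ → ℂ := fun t => ∑ q,
    mandelstam L (R q) (positionLabel L q₀ a) (positionLabel L q₀ b) *
      (chainProduct L q (chainFlow L q₀ + t • e) : ℂ) with hf
  have hfz : Set.EqOn f (fun _ => 0) {0}ᶜ := by
    intro t ht
    have ht0 : t ≠ 0 := ht
    have h := hR (chainFlow L q₀ + t • e)
      ((isCirculation_chainFlow hL q₀).add ((isCirculation_triangleFlow hL hla hlb).smul t)) X
      (cutPosition_one hL q₀ x (by omega)) (cutPosition_two hL q₀ x (by omega))
      (cutPosition_three q₀ x m)
    have hq : ∀ q, pairing L (R q) (chainFlow L q₀ + t • e) X *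
        (chainProduct L q (chainFlow L q₀ + t • e) : ℂ) = 2 * t *
        (mandelstam L (R q) (positionLabel L q₀ a) (positionLabel L q₀ b) *
          (chainProduct L q (chainFlow L q₀ + t • e) : ℂ)) := by
      intro q
      by_cases h0 : chainProduct L q (chainFlow L q₀ + t • e) = 0
      · rw [h0]; simp
      · have : pairing L (R q) (chainFlow L q₀) X = 0 := by
          rw [hpc]
          split_ifs with hm
          · rfl
          · rw [hcut hm t ht0 q h0, mul_zero]
        rw [pairing_add, this, pairing_smul, hpe]
        ring
    rw [Finset.sum_congr rfl fun q _ => hq q, ← Finset.mul_sum] at h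
    refine (mul_eq_zero.1 h).resolve_left (mul_ne_zero two_ne_zero ?_)
    exact_mod_cast ht0
  have hfc : Continuous f := by
    simp only [hf, chainProduct, Pi.add_apply, Pi.smul_apply, smul_eq_mul]
    fun_prop
  have h0 : f 0 = 0 := congrFun (hfc.ext_on (dense_compl_singleton 0) continuous_const hfz) 0
  have hs := supportedOnChains_chainFlow hL q₀
  have hskew := (isCirculation_chainFlow hL q₀).1
  simp only [hf, zero_smul, add_zero] at h0
  rw [Finset.sum_eq_single_of_mem q₀ (Finset.mem_univ q₀)] at h0
  · refine (mul_eq_zero.1 h0).resolve_right ?_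
    exact_mod_cast chainProduct_ne_zero_of_supportedOnChains hL hskew hs
      fun a ha => by rw [chainFlow_edge hL q₀ ha]; exact one_ne_zero
  · intro q _ hq
    have : chainProduct L q (chainFlow L q₀) = 0 := by
      by_contra h'
      exact hq (eq_of_chainProduct_ne_zero hL hskew hs h')
    rw [this, Complex.ofReal_zero, mul_zero]

theorem support_chainFlow_add_chord (hL : 4 ≤ L) (q : ComponentIndex L) (t : ℝ) (J K : ℕ) {p r : ℕ}
    (hp : p ∈ Finset.Icc 4 L) (hr : r ∈ Finset.Icc 3 (L + 1))
    (h : (chainFlow L q + t • triangleFlow (positionLabel L q J) (positionLabel L q K))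
      (positionLabel L q p) (positionLabel L q r) ≠ 0) :
    ((r = p + 1 ∨ p = r + 1) ∧ (componentLevel L q ≤ p ↔ componentLevel L q ≤ r)) ∨
      (p = J ∧ r = K) ∨ (p = K ∧ r = J) := by
  by_cases h0 : chainFlow L q (positionLabel L q p) (positionLabel L q r) = 0
  · right
    have hp4 := Finset.mem_Icc.1 hp
    rw [Pi.add_apply, Pi.add_apply, h0, Pi.smul_apply, Pi.smul_apply,
      triangleFlow_positionLabel hL q _ _ (Finset.mem_Icc.2 (by omega)) hr] at h
    by_contra hcon
    push Not at hcon
    refine h ?_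
    rw [if_neg fun h' => hcon.1 h'.1 h'.2, if_neg fun h' => hcon.2 h'.1 h'.2]
    simp
  · exact Or.inl (supportedOnChains_chainFlow hL q p hp r hr h0)

theorem skew_chainFlow_add_chord (hL : 4 ≤ L) (q : ComponentIndex L) (t : ℝ) {J K : ℕ}
    (hJ : J ∈ Finset.Icc 3 (L + 1)) (hK : K ∈ Finset.Icc 3 (L + 1)) (k j : ℕ) :
    (chainFlow L q + t • triangleFlow (positionLabel L q J) (positionLabel L q K)) k j =
      -(chainFlow L q + t • triangleFlow (positionLabel L q J) (positionLabel L q K)) j k :=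
  ((isCirculation_chainFlow hL q).add ((isCirculation_triangleFlow hL
    (positionLabel_mem hL q hJ).1 (positionLabel_mem hL q hK).1).smul t)).1 k j

/-- Induction on the end nearer to the root, for all components at once. The cut lies just after
`J`, so the chain edge across it joins `J` and `J + 1`. The chord does not jump over any position
from `K` on; hence in every surviving component these two labels stand in the upper chain before
position `K`, and the induction hypothesis applies there. -/
theorem mandelstam_upper (hL : 4 ≤ L) (hx0 : 0 < x) (hx1 : x < 1)
    (hR : AnnihilatesCirculations L x R) (K : ℕ) :
    ∀ (q : ComponentIndex L) (J : ℕ), componentLevel L q ≤ J → J < K → K ≤ L + 1 →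
      mandelstam L (R q) (positionLabel L q J) (positionLabel L q K) = 0 := by
  induction K using Nat.strong_induction_on with
  | _ K ih =>
    intro q J hJ hJK hKL
    obtain ⟨h4, h5⟩ := componentLevel_mem L hL q
    by_cases hadj : K = J + 1
    · rw [hadj]
      exact mandelstam_chain_edge hL hx0 hx1 hR q (by simp; omega)
    refine mandelstam_eq_zero_of_cut hL hx0 hx1 hR q (m := J) (by omega) le_rfl hJK hKL
      fun _ t _ q' hne => ?_
    have hskew := skew_chainFlow_add_chord hL q t (J := J) (K := K)
      (Finset.mem_Icc.2 (by omega)) (Finset.mem_Icc.2 (by omega))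
    have hlt : ∀ a b, componentLevel L q ≤ a → a < b → K ≤ b → b ≤ L + 1 →
        componentLevel L q' ≤ transition q q' a ∧ transition q q' a < transition q q' b := by
      intro a b ha hab hKb hb
      refine transition_lt_of_upper hL hskew hne (fun p hp r hr h h0 => ?_) hb
        (fun p hp r hr h h0 hpb => ?_) ha hab
      · have := support_chainFlow_add_chord hL q t J K hp hr h
        omega
      · have := support_chainFlow_add_chord hL q t J K hp hr h
        omega
    have hle : ∀ t b, b + t = L + 1 → K ≤ b → transition q q' b ≤ b := by
      intro t
      induction t with
      | zero => intro b hb _; rw [show b = L + 1 by omega, transition_last]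
      | succ t iht =>
        intro b hb hKb
        have := iht (b + 1) (by omega) (by omega)
        have := (hlt b (b + 1) (by omega) (by omega) (by omega) (by omega)).2
        omega
    have h1 := hlt J K hJ hJK le_rfl hKL
    have h2 := hlt (J + 1) K (by omega) (by omega) le_rfl hKL
    have h3 := hle (L + 1 - K) K (by omega) le_rfl
    have hd : transition q q' J ≠ transition q q' (J + 1) :=
      (transition_injective q q').ne (by omega)
    rw [← positionLabel_transition q q' J, ← positionLabel_transition q q' (J + 1)]
    rcases lt_or_gt_of_ne hd with h | h
    · exact ih _ (by omega) q' _ h1.1 h (by omega)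
    · rw [mandelstam_symm]
      exact ih _ (by omega) q' _ h2.1 h (by omega)

/-- The mirror argument: the cut lies just before `K`, and the induction moves the end nearer to the
root at position 3 away from it. -/
theorem mandelstam_lower (hL : 4 ≤ L) (hx0 : 0 < x) (hx1 : x < 1)
    (hR : AnnihilatesCirculations L x R) (n : ℕ) :
    ∀ (q : ComponentIndex L) (J K : ℕ), L + 1 - J = n → 3 ≤ J → J < K → K < componentLevel L q →
      mandelstam L (R q) (positionLabel L q J) (positionLabel L q K) = 0 := by
  induction n using Nat.strong_induction_on with
  | _ n ih =>
    intro q J K hn hJ hJK hKL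
    obtain ⟨h4, h5⟩ := componentLevel_mem L hL q
    by_cases hadj : K = J + 1
    · rw [hadj]
      exact mandelstam_chain_edge hL hx0 hx1 hR q (by simp; omega)
    refine mandelstam_eq_zero_of_cut hL hx0 hx1 hR q (m := K - 1) hJ (by omega) (by omega)
      (by omega) fun _ t _ q' hne => ?_
    rw [show K - 1 + 1 = K by omega]
    have hskew := skew_chainFlow_add_chord hL q t (J := J) (K := K)
      (Finset.mem_Icc.2 (by omega)) (Finset.mem_Icc.2 (by omega))
    have hlt : ∀ a b, a < componentLevel L q → b < a → b ≤ J → 3 ≤ b →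
        transition q q' a < componentLevel L q' ∧ transition q q' b < transition q q' a := by
      intro a b ha hab hKb hb
      refine transition_lt_of_lower hL hskew hne (fun p hp r hr h h0 => ?_) hb
        (fun p hp r hr h h0 hpb => ?_) ha hab
      · have := support_chainFlow_add_chord hL q t J K hp hr h
        omega
      · have := support_chainFlow_add_chord hL q t J K hp hr h
        omega
    have hle : ∀ b, 3 ≤ b → b ≤ J → b ≤ transition q q' b := by
      intro b h3
      induction b, h3 using Nat.le_induction with
      | base => intro _; rw [transition_three hL]
      | succ b h3 ihb =>
        intro hbJ
        have := ihb (by omega)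
        have := (hlt (b + 1) b (by omega) (by omega) (by omega) h3).2
        omega
    have h1 := hlt K J hKL hJK le_rfl hJ
    have h2 := hlt (K - 1) J (by omega) (by omega) le_rfl hJ
    have h3 := hle J hJ le_rfl
    have hd : transition q q' (K - 1) ≠ transition q q' K :=
      (transition_injective q q').ne (by omega)
    obtain ⟨h4', h5'⟩ := componentLevel_mem L hL q'
    rw [← positionLabel_transition q q' K, ← positionLabel_transition q q' (K - 1)]
    rcases lt_or_gt_of_ne hd with h | h
    · exact ih (L + 1 - transition q q' (K - 1)) (by omega) q' _ _ rfl (by omega) h h1.1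
    · rw [mandelstam_symm]
      exact ih (L + 1 - transition q q' K) (by omega) q' _ _ rfl (by omega) h h2.1

theorem eq_zero_of_annihilatesCirculations (hL : 4 ≤ L) (hx0 : 0 < x) (hx1 : x < 1)
    (hR : AnnihilatesCirculations L x R) (q : ComponentIndex L) (p : MandelstamIndex L) :
    R q p = 0 := by
  have hpos : ∀ a b, 3 ≤ a → a < b → b ≤ L + 1 →
      mandelstam L (R q) (positionLabel L q a) (positionLabel L q b) = 0 := by
    intro a b ha hab hb
    obtain ⟨h4, h5⟩ := componentLevel_mem L hL q
    by_cases h1 : componentLevel L q ≤ a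
    · exact mandelstam_upper hL hx0 hx1 hR b q a h1 hab hb
    by_cases h2 : b < componentLevel L q
    · exact mandelstam_lower hL hx0 hx1 hR _ q a b rfl ha hab h2
    -- For labels in different chains the cut goes through the gap, which no chain edge crosses.
    exact mandelstam_eq_zero_of_cut hL hx0 hx1 hR q (m := componentLevel L q - 1) ha (by omega)
      (by omega) hb fun h => absurd rfl h
  have h := p.2
  rw [← mandelstam_mk L (R q) p]
  have hk : p.1.1 ∈ Finset.Icc 1 L := Finset.mem_Icc.2 (by omega)
  have hj : p.1.2 ∈ Finset.Icc 1 L := Finset.mem_Icc.2 (by omega)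
  by_cases hk3 : p.1.1 = 3
  · rw [hk3]
    exact mandelstam_three_all hL hx0 hx1 hR q hj
  by_cases hj3 : p.1.2 = 3
  · rw [hj3, mandelstam_symm]
    exact mandelstam_three_all hL hx0 hx1 hR q hk
  have ha := Finset.mem_Icc.1 (positionLabel_symm_mem hL q hk hk3)
  have hb := Finset.mem_Icc.1 (positionLabel_symm_mem hL q hj hj3)
  have hne : (positionLabel L q).symm p.1.1 ≠ (positionLabel L q).symm p.1.2 :=
    (positionLabel L q).symm.injective.ne (by omega)
  rw [← Equiv.apply_symm_apply (positionLabel L q) p.1.1,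
    ← Equiv.apply_symm_apply (positionLabel L q) p.1.2]
  rcases lt_or_gt_of_ne hne with h | h
  · exact hpos _ _ ha.1 h hb.2
  · rw [mandelstam_symm]
    exact hpos _ _ hb.1 h ha.2

/-- The components of the vector are linearly independent over the linear forms in the Mandelstam
variables. -/
theorem linear_relation_eq_zero (hL : 4 ≤ L) (hx0 : 0 < x) (hx1 : x < 1)
    (R : ComponentIndex L → MandelstamIndex L → ℂ)
    (hR : ∀ s : MandelstamIndex L → ℂ, (∀ p, 0 < (s p).re) →
      ∑ q, (∑ p, R q p * s p) * selbergVector L s x q = 0)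
    (q : ComponentIndex L) (p : MandelstamIndex L) : R q p = 0 :=
  eq_zero_of_annihilatesCirculations hL hx0 hx1
    (fun _ hc _ h1 h2 h3 => sum_pairing_mul_chainProduct hL hx0 hx1 R hR hc.1 hc.2 h1 h2 h3) q p

end Independence

/-! ### Existence and uniqueness of the matrices -/

section KZPairs

variable {L : ℕ}

theorem exists_kzPair (hL : 4 ≤ L) : ∃ e₀ e₁ : MandelstamMatrix L, IsKZPair L e₀ e₁ ∧
    (∀ q σ, e₀ q (Sum.inl σ) = if q = Sum.inl σ then sMax L else 0) ∧
    ∀ σ q, e₁ (Sum.inl σ) q = if q = Sum.inl σ then mandelstamVar L 2 3 else 0 := by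
  choose r₀ r₁ h₀ h₁ hmax h23 hrel using fun q => exists_kz_rows (L := L) hL q
  refine ⟨Matrix.of r₀, Matrix.of r₁, ⟨fun p q => h₀ p q, fun p q => h₁ p q, ?_⟩,
    fun q σ => hmax q σ, fun σ q => h23 _ σ rfl q⟩
  intro s hs x hx
  refine hasDerivAt_pi.2 fun q => ?_
  have := hasDerivAt_selbergVector_apply hL hs
    (r₀ := fun q q' => MvPolynomial.eval s (r₀ q q'))
    (r₁ := fun q q' => MvPolynomial.eval s (r₁ q q')) (fun q => hrel q s) hx.1 hx.2 q
  refine this.congr_deriv ?_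
  rw [Matrix.mulVec, dotProduct]
  refine Finset.sum_congr rfl fun q' _ => ?_
  simp [kzCoefficient]

/-- Derivatives are unique, so at each x the difference of the two right-hand sides is a linear
relation between the components with coefficients linear in s, hence trivial. -/
theorem IsKZPair.unique (hL : 4 ≤ L) {e₀ e₁ e₀' e₁' : MandelstamMatrix L}
    (h : IsKZPair L e₀ e₁) (h' : IsKZPair L e₀' e₁') : e₀ = e₀' ∧ e₁ = e₁' := by
  have hspan : ∀ {e e' : MandelstamMatrix L}, HasLinearEntries L e → HasLinearEntries L e' →
      ∀ q q', ∃ f : MandelstamIndex L → ℂ, ∑ p, f p • MvPolynomial.X p = e q q' - e' q q' := by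
    intro e e' he he' q q'
    exact (Submodule.mem_span_range_iff_exists_fun ℂ).1 (Submodule.sub_mem _ (he q q') (he' q q'))
  choose f₀ hf₀ using hspan h.1 h'.1
  choose f₁ hf₁ using hspan h.2.1 h'.2.1
  have hev : ∀ (g : MandelstamIndex L → ℂ) (s : MandelstamIndex L → ℂ),
      MvPolynomial.eval s (∑ p, g p • (MvPolynomial.X p : MvPolynomial (MandelstamIndex L) ℂ)) =
        ∑ p, g p * s p := by
    intro g s
    simp [MvPolynomial.smul_eval]
  have hzero : ∀ x ∈ Set.Ioo (0 : ℝ) 1, ∀ q q' p,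
      (x : ℂ)⁻¹ * f₀ q q' p + ((x : ℂ) - 1)⁻¹ * f₁ q q' p = 0 := by
    intro x hx q
    refine linear_relation_eq_zero hL hx.1 hx.2
      (fun q' p => (x : ℂ)⁻¹ * f₀ q q' p + ((x : ℂ) - 1)⁻¹ * f₁ q q' p) fun s hs => ?_
    have hd := congrFun ((h.2.2 s hs x hx).unique (h'.2.2 s hs x hx)) q
    rw [Matrix.mulVec, Matrix.mulVec, dotProduct, dotProduct, ← sub_eq_zero,
      ← Finset.sum_sub_distrib] at hd
    rw [← hd]
    refine Finset.sum_congr rfl fun q' _ => ?_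
    have e0 := congrArg (MvPolynomial.eval s) (hf₀ q q')
    have e1 := congrArg (MvPolynomial.eval s) (hf₁ q q')
    rw [hev, map_sub] at e0 e1
    rw [← sub_mul]
    congr 1
    simp only [add_mul, Finset.sum_add_distrib, mul_assoc, ← Finset.mul_sum, e0, e1,
      Matrix.add_apply, Matrix.smul_apply, Matrix.map_apply, smul_eq_mul]
    ring
  have hboth : ∀ q q' p, f₀ q q' p = 0 ∧ f₁ q q' p = 0 := by
    intro q q' p
    -- Two values of x separate the poles at 0 and at 1.
    have h1 := hzero (1 / 2) (by norm_num) q q' p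
    have h2 := hzero (1 / 3) (by norm_num) q q' p
    push_cast at h1 h2
    norm_num at h1 h2
    constructor
    · linear_combination (2 / 3 : ℂ) * h2 - (1 / 2 : ℂ) * h1
    · linear_combination (2 / 3 : ℂ) * h2 - h1
  constructor
  · ext1 q q'
    rw [← sub_eq_zero, ← hf₀]
    exact Finset.sum_eq_zero fun p _ => by rw [(hboth q q' p).1, zero_smul]
  · ext1 q q'
    rw [← sub_eq_zero, ← hf₁]
    exact Finset.sum_eq_zero fun p _ => by rw [(hboth q q' p).2, zero_smul]

end KZPairs

theorem mainTheorem6 (L : ℕ) (hL : 4 ≤ L) :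
    -- the blocks have sizes `(L-3)!` and `(L-3)! (L-3)`
    (Fintype.card (FirstBlock L) = (L - 3).factorial ∧
      Fintype.card (SecondBlock L) = (L - 3).factorial * (L - 3)) ∧
    -- the integrals defining the vector converge absolutely
    (∀ s : MandelstamIndex L → ℂ, (∀ p, 0 < (s p).re) → ∀ x₃ ∈ Set.Ioo (0 : ℝ) 1,
      ∀ q : FirstBlock L ⊕ SecondBlock L,
        IntegrableOn (selbergIntegrand L (componentLevel L q) (componentPerm L q) s x₃)
          (selbergDomain L x₃)) ∧
    -- the matrices of the equation exist
    (∃ e₀ e₁ : MandelstamMatrix L, IsKZPair L e₀ e₁) ∧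
    -- and they have the asserted block forms
    ∀ e₀ e₁ : MandelstamMatrix L, IsKZPair L e₀ e₁ →
      (∃ (a : Matrix (FirstBlock L) (SecondBlock L) (MvPolynomial (MandelstamIndex L) ℂ))
          (b : Matrix (SecondBlock L) (SecondBlock L) (MvPolynomial (MandelstamIndex L) ℂ)),
          e₀ = Matrix.fromBlocks (sMax L • (1 : Matrix _ _ _)) a 0 b) ∧
      (∃ (c : Matrix (SecondBlock L) (FirstBlock L) (MvPolynomial (MandelstamIndex L) ℂ))
          (d : Matrix (SecondBlock L) (SecondBlock L) (MvPolynomial (MandelstamIndex L) ℂ)),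
          e₁ = Matrix.fromBlocks (mandelstamVar L 2 3 • (1 : Matrix _ _ _)) 0 c d) := by

  obtain ⟨e₀, e₁, hKZ, h₀, h₁⟩ := exists_kzPair hL
  refine ⟨⟨?_, ?_⟩, fun s hs x hx q => integrableOn_selbergIntegrand hL hs hx.1 hx.2 q,
    ⟨e₀, e₁, hKZ⟩, fun e₀' e₁' hKZ' => ?_⟩
  · rw [Fintype.card_perm, Fintype.card_coe, Nat.card_Icc, show L + 1 - 4 = L - 3 by omega]
  · rw [Fintype.card_prod, Fintype.card_perm, Fintype.card_coe, Fintype.card_coe, Nat.card_Icc,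
      Nat.card_Icc, show L + 1 - 4 = L - 3 by omega, show L + 1 + 1 - 5 = L - 3 by omega, mul_comm]
  -- By uniqueness the block forms need only be checked for the constructed pair.
  obtain ⟨rfl, rfl⟩ := hKZ.unique hL hKZ'
  constructor
  · refine ⟨e₀.toBlocks₁₂, e₀.toBlocks₂₂, ?_⟩
    conv_lhs => rw [← Matrix.fromBlocks_toBlocks e₀]
    congr 1
    · ext1 σ τ
      simp [Matrix.toBlocks₁₁, h₀, Matrix.one_apply]
    · ext1 σ τ
      simp [Matrix.toBlocks₂₁, h₀]
  · refine ⟨e₁.toBlocks₂₁, e₁.toBlocks₂₂, ?_⟩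
    conv_lhs => rw [← Matrix.fromBlocks_toBlocks e₁]
    congr 1
    · ext1 σ τ
      simp [Matrix.toBlocks₁₁, h₁, Matrix.one_apply, eq_comm]
    · ext1 σ τ
      simp [Matrix.toBlocks₁₂, h₁]
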